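/- **Proposition 5.1.** Let $\lambda\ge 1$ be an integer, $k=2(\lambda+1)$, and $u_0\in H^1(\mathbb R)\cap W^{1,k}(\mathbb R)$ with weak derivative $(u_0)_x$. Let $x_0(Y)$ denote the inverse of the increasing bijection $x\mapsto\int_0^x(1+(u_0)_x^2)^{k/2}\,dx$ of $\mathbb R$. For functions $u,v,\xi$ of $Y\in\mathbb R$ set $$\kappa(Y,Y')=\exp\Big(-\Big|\int_Y^{Y'}\cos^k\tfrac{v(s)}2\,\xi(s)\,ds\Big|\Big),\quad f=\Big[\tfrac{2\lambda+1}2u^\lambda\sin^2\tfrac v2\cos^{k-2}\tfrac v2+u^{\lambda+2}\cos^k\tfrac v2\Big]\xi,\quad q=u^{\lambda-1}\sin^3\tfrac v2\cos^{k-3}\tfrac v2\,\xi,$$ $$P(Y)=\tfrac12\int_{\mathbb R}\kappa(Y,Y')f(Y')\,dY',\qquad P_x(Y)=\tfrac12\Big(\int_Y^\infty-\int_{-\infty}^Y\Big)\kappa(Y,Y')f(Y')\,dY',$$ $$Q(Y)=\tfrac\lambda4\int_{\mathbb R}\kappa(Y,Y')q(Y')\,dY',\qquad Q_x(Y)=\tfrac\lambda4\Big(\int_Y^\infty-\int_{-\infty}^Y\Big)\kappa(Y,Y')q(Y')\,dY'.$$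 Consider the Cauchy problem $$\begin{cases}u_T=-P_x-Q,\\ v_T=-u^\lambda\sin^2\frac v2+2u^{\lambda+2}\cos^2\frac v2-2\cos^2\frac v2\,(P+Q_x),\\ \xi_T=\frac{\lambda+1}2u^\lambda\xi\sin v+(\lambda+1)u^{\lambda+2}\xi\sin v-(\lambda+1)\xi\sin v\,(P+Q_x),\end{cases}$$ $$u(0,Y)=u_0(x_0(Y)),\qquad v(0,Y)=2\arctan\,(u_0)_x(x_0(Y)),\qquad \xi(0,Y)=1,$$ as an ordinary differential equation in the Banach space $X=(H^1\cap W^{1,k})\times(L^2\cap L^\infty)\times L^\infty$ of functions of $Y$: a solution on a time interval is an $X$-valued curve which is differentiable at every time in the norm of $X$ (one-sidedly at endpoints), with the right-hand side of the system as derivative, and which takes the initial values. Then this problem has a solution $(u,v,\xi)$ defined for all $T\in[0,\infty)$. It is unique: for every $\mathcal T>0$, every solution on $[0,\mathcal T]$ coincides with it on $[0,\mathcal T]$. Moreover, on every interval $[0,\mathcal T]$ the quantities $\|u\|_{H^1}$, $\|u\|_{W^{1,k}}$, $\|v\|_{L^2}$, $\|v\|_{L^\infty}$, $\|\xi\|_{L^\infty}$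 and $\|1/\xi\|_{L^\infty}$ remain bounded, and $\xi>0$ almost everywhere. -/

import Mathlib

open MeasureTheory Filter Topology Set
open scoped ENNReal ContDiff

noncomputable section

namespace LambdaFamily

/-! ### One-dimensional Sobolev spaces -/

/-- `g` is a weak (distributional) derivative of `f` on the real line. -/
structure HasWeakDeriv (f g : ℝ → ℝ) : Prop where
  locallyIntegrable : LocallyIntegrable f volume
  locallyIntegrable_deriv : LocallyIntegrable g volume
  integral_eq : ∀ φ : ℝ → ℝ, ContDiff ℝ ∞ φ → HasCompactSupport φ →
    ∫ x, f x * deriv φ x = -∫ x, g x * φ x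

/-- Membership in `W^{1,p}(ℝ)`. -/
def MemW1 (p : ℝ≥0∞) (f : ℝ → ℝ) : Prop :=
  MemLp f p volume ∧ ∃ g : ℝ → ℝ, HasWeakDeriv f g ∧ MemLp g p volume

/-- The norm `‖f‖_{L^p} + ‖f'‖_{L^p}` of `W^{1,p}(ℝ)`. A weak derivative is unique up to null
sets, so the infimum is attained at it; the value is `∞` if `f` has no weak derivative. -/
def w1Norm (p : ℝ≥0∞) (f : ℝ → ℝ) : ℝ≥0∞ :=
  ⨅ (g : ℝ → ℝ) (_ : HasWeakDeriv f g), eLpNorm f p volume + eLpNorm g p volume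

/-- The exponent `k = 2 (l + 1)`, where `l` is the parameter of the family of equations. -/
def expK (l : ℕ) : ℕ := 2 * (l + 1)

/-! ### The state space `(H¹ ∩ W^{1,k}) × (L² ∩ L^∞) × L^∞` -/

/-- Membership in the state space. -/
structure MemX (l : ℕ) (u v ξ : ℝ → ℝ) : Prop where
  u_H1 : MemW1 2 u
  u_W1k : MemW1 (expK l : ℝ≥0∞) u
  v_L2 : MemLp v 2 volume
  v_Linfty : MemLp v ∞ volume
  xi_Linfty : MemLp ξ ∞ volume

/-- The norm of the state space. -/
def normX (l : ℕ) (u v ξ : ℝ → ℝ) : ℝ≥0∞ :=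
  w1Norm 2 u + w1Norm (expK l : ℝ≥0∞) u + eLpNorm v 2 volume + eLpNorm v ∞ volume
    + eLpNorm ξ ∞ volume

/-! ### The nonlocal terms, at a fixed time -/

/-- `exp (-|∫_Y^{Y'} cos^k (v/2) ξ ds|)`. -/
def kern (l : ℕ) (v ξ : ℝ → ℝ) (Y Y' : ℝ) : ℝ :=
  Real.exp (-|∫ s in Y..Y', Real.cos (v s / 2) ^ expK l * ξ s|)

/-- The density in `P` and `P_x`. -/
def densP (l : ℕ) (u v ξ : ℝ → ℝ) (Y : ℝ) : ℝ :=
  ((2 * (l : ℝ) + 1) / 2 * u Y ^ l * Real.sin (v Y / 2) ^ 2 * Real.cos (v Y / 2) ^ (expK l - 2)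
    + u Y ^ (l + 2) * Real.cos (v Y / 2) ^ expK l) * ξ Y

/-- The density in `Q` and `Q_x`; it is used for `l ≥ 1` only, where the exponents `l - 1` and
`k - 3` are natural numbers. -/
def densQ (l : ℕ) (u v ξ : ℝ → ℝ) (Y : ℝ) : ℝ :=
  u Y ^ (l - 1) * Real.sin (v Y / 2) ^ 3 * Real.cos (v Y / 2) ^ (expK l - 3) * ξ Y

def P (l : ℕ) (u v ξ : ℝ → ℝ) (Y : ℝ) : ℝ :=
  1 / 2 * ∫ Y', kern l v ξ Y Y' * densP l u v ξ Y'

def Px (l : ℕ) (u v ξ : ℝ → ℝ) (Y : ℝ) : ℝ :=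
  1 / 2 * ((∫ Y' in Ioi Y, kern l v ξ Y Y' * densP l u v ξ Y')
    - ∫ Y' in Iic Y, kern l v ξ Y Y' * densP l u v ξ Y')

def Q (l : ℕ) (u v ξ : ℝ → ℝ) (Y : ℝ) : ℝ :=
  (l : ℝ) / 4 * ∫ Y', kern l v ξ Y Y' * densQ l u v ξ Y'

def Qx (l : ℕ) (u v ξ : ℝ → ℝ) (Y : ℝ) : ℝ :=
  (l : ℝ) / 4 * ((∫ Y' in Ioi Y, kern l v ξ Y Y' * densQ l u v ξ Y')
    - ∫ Y' in Iic Y, kern l v ξ Y Y' * densQ l u v ξ Y')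

/-! ### The semilinear system -/

/-- Right-hand side of the equation for `u_T`. -/
def rhsU (l : ℕ) (u v ξ : ℝ → ℝ) (Y : ℝ) : ℝ :=
  -Px l u v ξ Y - Q l u v ξ Y

/-- Right-hand side of the equation for `v_T`. -/
def rhsV (l : ℕ) (u v ξ : ℝ → ℝ) (Y : ℝ) : ℝ :=
  -u Y ^ l * Real.sin (v Y / 2) ^ 2 + 2 * u Y ^ (l + 2) * Real.cos (v Y / 2) ^ 2
    - 2 * Real.cos (v Y / 2) ^ 2 * (P l u v ξ Y + Qx l u v ξ Y)

/-- Right-hand side of the equation for `ξ_T`. -/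
def rhsXi (l : ℕ) (u v ξ : ℝ → ℝ) (Y : ℝ) : ℝ :=
  ((l : ℝ) + 1) / 2 * u Y ^ l * ξ Y * Real.sin (v Y)
    + ((l : ℝ) + 1) * u Y ^ (l + 2) * ξ Y * Real.sin (v Y)
    - ((l : ℝ) + 1) * ξ Y * Real.sin (v Y) * (P l u v ξ Y + Qx l u v ξ Y)

/-- The initial characteristic coordinate `x ↦ ∫_0^x (1 + (u₀)_x²)^{k/2}`, with `g = (u₀)_x`. -/
def charCoord (l : ℕ) (g : ℝ → ℝ) (x : ℝ) : ℝ :=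
  ∫ s in (0 : ℝ)..x, (1 + g s ^ 2) ^ (expK l / 2)

/-- `x₀(Y)`, the inverse of the increasing bijection `charCoord l g`. -/
def x0 (l : ℕ) (g : ℝ → ℝ) : ℝ → ℝ := Function.invFun (charCoord l g)

/-- `(u, v, ξ)` (first argument: the time `T`, second argument: `Y`) is a solution on the time
interval `I ∋ 0` of the Cauchy problem for the semilinear system, with data given by `u₀` and its
weak derivative `g`: a curve in the state space `X` that is differentiable in the norm of `X`
(one-sidedly at endpoints of `I`), whose derivative is the right-hand side of the system, and
which has the prescribed initial value. Functions of `Y` are taken up to null sets. -/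
structure IsSolutionOn (l : ℕ) (u₀ g : ℝ → ℝ) (I : Set ℝ) (u v ξ : ℝ → ℝ → ℝ) : Prop where
  mem : ∀ T ∈ I, MemX l (u T) (v T) (ξ T)
  deriv : ∀ T ∈ I, Tendsto
    (fun τ => normX l
      (fun Y => (u τ Y - u T Y) / (τ - T) - rhsU l (u T) (v T) (ξ T) Y)
      (fun Y => (v τ Y - v T Y) / (τ - T) - rhsV l (u T) (v T) (ξ T) Y)
      (fun Y => (ξ τ Y - ξ T Y) / (τ - T) - rhsXi l (u T) (v T) (ξ T) Y))
    (𝓝[I \ {T}] T) (𝓝 0)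
  init_u : ∀ᵐ Y, u 0 Y = u₀ (x0 l g Y)
  init_v : ∀ᵐ Y, v 0 Y = 2 * Real.arctan (g (x0 l g Y))
  init_xi : ∀ᵐ Y, ξ 0 Y = 1

end LambdaFamily

end

noncomputable section

namespace LambdaFamily

/-! ### Primitives of locally integrable functions -/

/-- `f` is a primitive of the locally integrable function `f'`. -/
structure IsPrim (f f' : ℝ → ℝ) : Prop where
  locInt : LocallyIntegrable f' volume
  sub_eq : ∀ a b, f b - f a = ∫ x in a..b, f' x

theorem LocallyIntegrable.ii {f : ℝ → ℝ} (h : LocallyIntegrable f volume) (a b : ℝ) :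
    IntervalIntegrable f volume a b :=
  (h.integrableOn_isCompact isCompact_uIcc).intervalIntegrable

namespace IsPrim

variable {f f' g g' : ℝ → ℝ}

theorem ac (h : IsPrim f f') (a b : ℝ) : AbsolutelyContinuousOnInterval f a b := by
  have h1 := (LocallyIntegrable.ii h.locInt a b).absolutelyContinuousOnInterval_intervalIntegral
    (c := a) left_mem_uIcc
  have h2 : AbsolutelyContinuousOnInterval (fun _ : ℝ => f a) a b :=
    (contDiff_const.contDiffOn).absolutelyContinuousOnInterval
  have h3 := h2.fun_add h1
  convert! h3 using 2 with x
  rw [← h.sub_eq a]; ring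

theorem continuous (h : IsPrim f f') : Continuous f := by
  have h1 : f = fun x => f 0 + ∫ y in (0:ℝ)..x, f' y := by
    ext x; rw [← h.sub_eq]; ring
  rw [h1]
  exact continuous_const.add
    (intervalIntegral.continuous_primitive (fun a b => LocallyIntegrable.ii h.locInt a b) 0)

theorem ae_hasDerivAt (h : IsPrim f f') : ∀ᵐ x, HasDerivAt f (f' x) x := by
  filter_upwards [LocallyIntegrable.ae_hasDerivAt_integral h.locInt] with x hx
  have := (hx 0).const_add (f 0)
  convert! this using 2 with y
  rw [← h.sub_eq]; ring

theorem of_ac (hac : ∀ a b, AbsolutelyContinuousOnInterval f a b)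
    (hf' : LocallyIntegrable f' volume) (hd : ∀ᵐ x, HasDerivAt f (f' x) x) : IsPrim f f' := by
  refine ⟨hf', fun a b => ?_⟩
  rw [← (hac a b).integral_deriv_eq_sub]
  apply intervalIntegral.integral_congr_ae
  filter_upwards [hd] with x hx _ using hx.deriv

theorem of_integral (hf' : LocallyIntegrable f' volume) (a : ℝ) :
    IsPrim (fun x => ∫ y in a..x, f' y) f' :=
  ⟨hf', fun b c => intervalIntegral.integral_interval_sub_left
    (LocallyIntegrable.ii hf' a c) (LocallyIntegrable.ii hf' a b)⟩

theorem of_contDiff (h : ContDiff ℝ 1 f) : IsPrim f (deriv f) := by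
  refine of_ac (fun a b => h.contDiffOn.absolutelyContinuousOnInterval)
    (h.continuous_deriv le_rfl).locallyIntegrable (ae_of_all _ fun x => ?_)
  exact (h.differentiable one_ne_zero x).hasDerivAt

theorem congr_ae (h : IsPrim f f') (hg : f' =ᵐ[volume] g') : IsPrim f g' := by
  refine ⟨h.locInt.congr hg, fun a b => ?_⟩
  rw [h.sub_eq]
  apply intervalIntegral.integral_congr_ae
  filter_upwards [hg] with x hx _ using hx

theorem mul (hf : IsPrim f f') (hg : IsPrim g g') :
    IsPrim (fun x => f x * g x) (fun x => f' x * g x + f x * g' x) := by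
  refine of_ac (fun a b => (hf.ac a b).fun_mul (hg.ac a b)) ?_ ?_
  · refine LocallyIntegrable.add ?_ ?_
    · exact locallyIntegrable_iff.2 fun K hK =>
        (hf.locInt.integrableOn_isCompact hK).mul_continuousOn hg.continuous.continuousOn hK
    · exact locallyIntegrable_iff.2 fun K hK =>
        (hg.locInt.integrableOn_isCompact hK).continuousOn_mul hf.continuous.continuousOn hK
  · filter_upwards [hf.ae_hasDerivAt, hg.ae_hasDerivAt] with x hx hy
    exact hx.mul hy

theorem add (hf : IsPrim f f') (hg : IsPrim g g') :
    IsPrim (fun x => f x + g x) (fun x => f' x + g' x) := by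
  refine ⟨hf.locInt.add hg.locInt, fun a b => ?_⟩
  rw [intervalIntegral.integral_add (LocallyIntegrable.ii hf.locInt a b)
    (LocallyIntegrable.ii hg.locInt a b), ← hf.sub_eq, ← hg.sub_eq]
  ring

theorem const_mul (hf : IsPrim f f') (c : ℝ) :
    IsPrim (fun x => c * f x) (fun x => c * f' x) := by
  refine ⟨hf.locInt.smul c, fun a b => ?_⟩
  rw [intervalIntegral.integral_const_mul, ← hf.sub_eq]
  ring

theorem sub (hf : IsPrim f f') (hg : IsPrim g g') :
    IsPrim (fun x => f x - g x) (fun x => f' x - g' x) := by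
  refine ⟨hf.locInt.sub hg.locInt, fun a b => ?_⟩
  rw [intervalIntegral.integral_sub (LocallyIntegrable.ii hf.locInt a b)
    (LocallyIntegrable.ii hg.locInt a b), ← hf.sub_eq, ← hg.sub_eq]
  ring

theorem pow (hf : IsPrim f f') (n : ℕ) :
    IsPrim (fun x => f x ^ (n + 1)) (fun x => (n + 1) * f x ^ n * f' x) := by
  induction n with
  | zero => simpa using hf
  | succ n ih =>
    have := ih.mul hf
    have e : (fun x => ((n : ℝ) + 1) * f x ^ n * f' x * f x + f x ^ (n + 1) * f' x) =
        fun x => (((n + 1 : ℕ) : ℝ) + 1) * f x ^ (n + 1) * f' x := by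
      ext x; push_cast; ring
    rw [e] at this
    simpa only [pow_succ] using this

/-- An integrable primitive of an integrable function vanishes at infinity. -/
theorem tendsto_atTop (hf : IsPrim f f') (hi : Integrable f) (hi' : Integrable f') :
    Tendsto f atTop (𝓝 0) := by
  have h1 : Tendsto (fun b => f 0 + ∫ x in (0:ℝ)..b, f' x) atTop
      (𝓝 (f 0 + ∫ x in Ioi 0, f' x)) :=
    (intervalIntegral_tendsto_integral_Ioi 0 hi'.integrableOn tendsto_id).const_add _
  have h2 : (fun b => f 0 + ∫ x in (0:ℝ)..b, f' x) = f := by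
    ext b; rw [← hf.sub_eq]; ring
  rw [h2] at h1
  have h3 : IntegrableAtFilter f atTop volume := hi.integrableAtFilter _
  have := h3.eq_zero_of_tendsto (fun s hs => ?_) h1
  · rwa [this] at h1
  · obtain ⟨a, ha⟩ := mem_atTop_sets.mp hs
    rw [← top_le_iff, ← Real.volume_Ici (a := a)]
    exact measure_mono ha

theorem tendsto_atBot (hf : IsPrim f f') (hi : Integrable f) (hi' : Integrable f') :
    Tendsto f atBot (𝓝 0) := by
  have h1 : Tendsto (fun b => f 0 - ∫ x in b..(0:ℝ), f' x) atBot
      (𝓝 (f 0 - ∫ x in Iic 0, f' x)) :=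
    (intervalIntegral_tendsto_integral_Iic 0 hi'.integrableOn tendsto_id).const_sub _
  have h2 : (fun b => f 0 - ∫ x in b..(0:ℝ), f' x) = f := by
    ext b; rw [← hf.sub_eq]; ring
  rw [h2] at h1
  have h3 : IntegrableAtFilter f atBot volume := hi.integrableAtFilter _
  have := h3.eq_zero_of_tendsto (fun s hs => ?_) h1
  · rwa [this] at h1
  · obtain ⟨a, ha⟩ := mem_atBot_sets.mp hs
    rw [← top_le_iff, ← Real.volume_Iic (a := a)]
    exact measure_mono ha

theorem integral_eq_zero (hf : IsPrim f f') (hi : Integrable f) (hi' : Integrable f') :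
    ∫ x, f' x = 0 := by
  have h1 := intervalIntegral_tendsto_integral hi' tendsto_neg_atTop_atBot tendsto_id
  have h2 : Tendsto (fun b => f b - f (-b)) atTop (𝓝 (0 - 0)) :=
    (hf.tendsto_atTop hi hi').sub ((hf.tendsto_atBot hi hi').comp tendsto_neg_atTop_atBot)
  simp_rw [hf.sub_eq] at h2
  simpa using tendsto_nhds_unique h1 h2

theorem hasWeakDeriv (hf : IsPrim f f') : HasWeakDeriv f f' := by
  refine ⟨hf.continuous.locallyIntegrable, hf.locInt, fun φ hφ hc => ?_⟩
  have h1 := hf.mul (of_contDiff (hφ.of_le (by norm_cast)))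
  have hc' : HasCompactSupport (deriv φ) := hc.deriv
  have i1 : Integrable (fun x => f x * deriv φ x) :=
    (hf.continuous.mul (hφ.continuous_deriv (by norm_cast))).integrable_of_hasCompactSupport
      hc'.mul_left
  have i2 : Integrable (fun x => f' x * φ x) := by
    have := hf.locInt.integrable_smul_right_of_hasCompactSupport hφ.continuous hc
    simpa using this
  have i3 : Integrable (fun x => f x * φ x) :=
    (hf.continuous.mul hφ.continuous).integrable_of_hasCompactSupport hc.mul_left
  have := h1.integral_eq_zero i3 (i2.add i1)
  rw [integral_add i2 i1] at this
  linarith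

end IsPrim

theorem exists_primitive_of_integral_eq_zero {θ : ℝ → ℝ} (hθ : ContDiff ℝ ∞ θ)
    (hc : HasCompactSupport θ) (h0 : ∫ x, θ x = 0) :
    ∃ φ : ℝ → ℝ, ContDiff ℝ ∞ φ ∧ HasCompactSupport φ ∧ deriv φ = θ := by
  obtain ⟨R, hR⟩ := hc.isCompact.isBounded.subset_closedBall 0
  have hz : ∀ x, x ∉ Icc (-R) R → θ x = 0 := fun x hx => by
    by_contra h
    have := hR (subset_tsupport _ h)
    rw [Real.closedBall_eq_Icc] at this
    simp at this; exact hx ⟨by linarith, by linarith⟩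
  have hd : ∀ x, HasDerivAt (fun x => ∫ y in (-R - 1)..x, θ y) (θ x) x := fun x =>
    intervalIntegral.integral_hasDerivAt_right (hθ.continuous.intervalIntegrable _ _)
      (hθ.continuous.stronglyMeasurableAtFilter _ _) hθ.continuous.continuousAt
  have hdd : deriv (fun x => ∫ y in (-R - 1)..x, θ y) = θ := funext fun x => (hd x).deriv
  refine ⟨fun x => ∫ y in (-R-1)..x, θ y, ?_, ?_, hdd⟩
  · rw [contDiff_infty_iff_deriv, hdd]
    exact ⟨fun x => (hd x).differentiableAt, hθ⟩
  · refine HasCompactSupport.intro (isCompact_Icc (a := -R-1) (b := R+1)) fun x hx => ?_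
    rcases lt_or_ge x (-R-1) with h | h
    · rw [intervalIntegral.integral_symm, intervalIntegral.integral_of_le h.le,
        setIntegral_eq_zero_of_forall_eq_zero, neg_zero]
      intro y hy
      exact hz y fun h' => by have := hy.2; have := h'.1; linarith
    · have hx2 : R + 1 < x := by
        by_contra h'
        exact hx ⟨h, by linarith⟩
      rw [intervalIntegral.integral_eq_integral_of_support_subset, h0]
      intro y hy
      by_contra h'
      refine hy (hz y fun h'' => h' ⟨by have := h''.1; linarith, by have := h''.2; linarith⟩)

theorem HasWeakDeriv.exists_isPrim {f g : ℝ → ℝ} (h : HasWeakDeriv f g) :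
    ∃ f₁ : ℝ → ℝ, f =ᵐ[volume] f₁ ∧ IsPrim f₁ g := by
  set F : ℝ → ℝ := fun x => ∫ y in (0:ℝ)..x, g y with hF
  have hFp : IsPrim F g := IsPrim.of_integral h.locallyIntegrable_deriv 0
  have hFw := hFp.hasWeakDeriv
  obtain ⟨ψ, -, hψc, hψs, hψ1⟩ : ∃ ψ : ℝ → ℝ, True ∧ HasCompactSupport ψ ∧ ContDiff ℝ ∞ ψ ∧
      ∫ x, ψ x = 1 := by
    let b : ContDiffBump (0 : ℝ) := ⟨1, 2, one_pos, one_lt_two⟩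
    exact ⟨b.normed volume, trivial, b.hasCompactSupport_normed, b.contDiff_normed,
      b.integral_normed⟩
  have hint : ∀ (k η : ℝ → ℝ), LocallyIntegrable k volume → ContDiff ℝ ∞ η → HasCompactSupport η →
      Integrable fun x => k x * η x := fun k η hk hη hc => by
    simpa using hk.integrable_smul_right_of_hasCompactSupport hη.continuous hc
  have hk : LocallyIntegrable (fun x => f x - F x) volume :=
    h.locallyIntegrable.sub hFw.locallyIntegrable
  set C : ℝ := ∫ x, (f x - F x) * ψ x with hC
  have key : ∀ᵐ x, f x - F x = C := by
    refine ae_eq_of_integral_contDiff_smul_eq hk (locallyIntegrable_const C) fun η hη hc => ?_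
    have hηi : Integrable η := hη.continuous.integrable_of_hasCompactSupport hc
    have hψi : Integrable ψ := hψs.continuous.integrable_of_hasCompactSupport hψc
    obtain ⟨φ, hφ, hφc, hφd⟩ := exists_primitive_of_integral_eq_zero
      (θ := fun x => η x - (∫ y, η y) * ψ x) (hη.sub (contDiff_const.mul hψs))
      (hc.sub hψc.mul_left) (by
        rw [integral_sub hηi (hψi.const_mul _), integral_const_mul, hψ1]; ring)
    have e1 := h.integral_eq φ hφ hφc
    have e2 := hFw.integral_eq φ hφ hφc
    have hφd' : ∀ x, deriv φ x = η x - (∫ y, η y) * ψ x := fun x => congrFun hφd x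
    have hdc : HasCompactSupport (deriv φ) := hφc.deriv
    have hds : ContDiff ℝ ∞ (deriv φ) := by
      rw [hφd]; exact hη.sub (contDiff_const.mul hψs)
    have e3 : ∫ x, (f x - F x) * deriv φ x = 0 := by
      simp_rw [sub_mul]
      rw [integral_sub (hint _ _ h.locallyIntegrable hds hdc)
        (hint _ _ hFw.locallyIntegrable hds hdc), e1, e2, sub_self]
    have e4 : ∀ x, (f x - F x) * deriv φ x =
        (f x - F x) * η x - (∫ y, η y) * ((f x - F x) * ψ x) := fun x => by rw [hφd']; ring
    simp_rw [e4] at e3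
    rw [integral_sub (hint _ _ hk hη hc) ((hint _ _ hk hψs hψc).const_mul _),
      integral_const_mul] at e3
    simp only [smul_eq_mul]
    rw [integral_mul_const]
    have : ∫ x, η x * (f x - F x) = ∫ x, (f x - F x) * η x := by simp_rw [mul_comm]
    rw [this]; linarith
  refine ⟨fun x => C + F x, ?_, ⟨hFp.locInt, fun a b => ?_⟩⟩
  · filter_upwards [key] with x hx
    linarith
  · rw [← hFp.sub_eq]; ring

/-! ### Local nonlinearities on bounded sets -/

/-- The values `(u, v, ξ)` bounded by `R`. -/
def Box (R : ℝ) : Set (ℝ × ℝ × ℝ) := {p | |p.1| ≤ R ∧ |p.2.1| ≤ R ∧ |p.2.2| ≤ R}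

/-- The two triples differ by at most `δ` in each component. -/
def Near (δ : ℝ) (p q : ℝ × ℝ × ℝ) : Prop :=
  |p.1 - q.1| ≤ δ ∧ |p.2.1 - q.2.1| ≤ δ ∧ |p.2.2 - q.2.2| ≤ δ

def siz (p : ℝ × ℝ × ℝ) : ℝ := |p.1| + |p.2.1|

def gap (δ : ℝ) (p q : ℝ × ℝ × ℝ) : ℝ := |p.1 - q.1| + |p.2.1 - q.2.1| + δ * siz p

/-- Bounded Lipschitz functions on boxes. -/
def IsM (a : ℝ × ℝ × ℝ → ℝ) : Prop :=
  ∀ R, ∃ C, 0 ≤ C ∧ ∀ p ∈ Box R, |a p| ≤ C ∧ ∀ q ∈ Box R, ∀ δ, Near δ p q → |a p - a q| ≤ C * δ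

/-- Lipschitz functions on boxes that vanish where `u = v = 0`, at least linearly. -/
def IsS (a : ℝ × ℝ × ℝ → ℝ) : Prop :=
  ∀ R, ∃ C, 0 ≤ C ∧ ∀ p ∈ Box R, |a p| ≤ C * siz p ∧
    ∀ q ∈ Box R, ∀ δ, Near δ p q → |a p - a q| ≤ C * gap δ p q

theorem siz_nonneg (p : ℝ × ℝ × ℝ) : 0 ≤ siz p := by unfold siz; positivity

theorem Near.nonneg {δ : ℝ} {p q : ℝ × ℝ × ℝ} (h : Near δ p q) : 0 ≤ δ := (abs_nonneg _).trans h.1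

theorem gap_nonneg {δ : ℝ} (h : 0 ≤ δ) (p q : ℝ × ℝ × ℝ) : 0 ≤ gap δ p q := by
  have := siz_nonneg p
  unfold gap; positivity

theorem mul_siz_le_gap (δ : ℝ) (p q : ℝ × ℝ × ℝ) : δ * siz p ≤ gap δ p q := by
  unfold gap
  have := abs_nonneg (p.1 - q.1)
  have := abs_nonneg (p.2.1 - q.2.1)
  linarith

theorem gap_le {R δ : ℝ} {p q : ℝ × ℝ × ℝ} (hp : p ∈ Box R) (h : Near δ p q) :
    gap δ p q ≤ (2 + 2 * R) * δ := by
  have h0 := h.nonneg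
  have : siz p ≤ 2 * R := by unfold siz; linarith [hp.1, hp.2.1]
  have := mul_le_mul_of_nonneg_left this h0
  unfold gap
  linarith [h.1, h.2.1]

namespace IsM

variable {a b : ℝ × ℝ × ℝ → ℝ}

theorem const (c : ℝ) : IsM fun _ => c := fun R =>
  ⟨|c|, abs_nonneg _, fun p _ => ⟨le_rfl, fun q _ δ h => by
    simpa using mul_nonneg (abs_nonneg c) h.nonneg⟩⟩

theorem fst : IsM fun p => p.1 := fun R =>
  ⟨max R 1, by positivity, fun p hp => ⟨hp.1.trans (le_max_left _ _), fun q _ δ h =>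
    h.1.trans (le_mul_of_one_le_left h.nonneg (le_max_right _ _))⟩⟩

theorem thd : IsM fun p => p.2.2 := fun R =>
  ⟨max R 1, by positivity, fun p hp => ⟨hp.2.2.trans (le_max_left _ _), fun q _ δ h =>
    h.2.2.trans (le_mul_of_one_le_left h.nonneg (le_max_right _ _))⟩⟩

theorem cos_half : IsM fun p => Real.cos (p.2.1 / 2) := fun R =>
  ⟨1, zero_le_one, fun p hp => ⟨Real.abs_cos_le_one _, fun q _ δ h => by
    have h1 := Real.abs_cos_sub_cos_le (p.2.1 / 2) (q.2.1 / 2)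
    have h2 : |p.2.1 / 2 - q.2.1 / 2| = |p.2.1 - q.2.1| / 2 := by
      rw [← sub_div, abs_div]; norm_num
    linarith [h.2.1, h.nonneg]⟩⟩

theorem mul (ha : IsM a) (hb : IsM b) : IsM fun p => a p * b p := fun R => by
  obtain ⟨C, hC, h1⟩ := ha R
  obtain ⟨D, hD, h2⟩ := hb R
  refine ⟨C * D + C * D, by positivity, fun p hp => ⟨?_, fun q hq δ h => ?_⟩⟩
  · rw [abs_mul]
    have := mul_le_mul (h1 p hp).1 (h2 p hp).1 (abs_nonneg _) hC
    linarith [mul_nonneg hC hD]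
  · have e : a p * b p - a q * b q = a p * (b p - b q) + b q * (a p - a q) := by ring
    rw [e]
    refine (abs_add_le _ _).trans ?_
    rw [abs_mul, abs_mul]
    have i1 := mul_le_mul (h1 p hp).1 ((h2 p hp).2 q hq δ h) (abs_nonneg _) hC
    have i2 := mul_le_mul (h2 q hq).1 ((h1 p hp).2 q hq δ h) (abs_nonneg _) hD
    linarith

theorem pow (ha : IsM a) (n : ℕ) : IsM fun p => a p ^ n := by
  induction n with
  | zero => simpa using const 1
  | succ n ih => simpa [pow_succ] using ih.mul ha

end IsM

namespace IsS

variable {a b : ℝ × ℝ × ℝ → ℝ}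

theorem fst : IsS fun p => p.1 := fun R =>
  ⟨1, zero_le_one, fun p _ => ⟨by unfold siz; linarith [abs_nonneg p.2.1], fun q _ δ h => by
    have := mul_nonneg h.nonneg (siz_nonneg p)
    unfold gap; linarith [abs_nonneg (p.2.1 - q.2.1)]⟩⟩

theorem sin_mul (c : ℝ) (hc : |c| ≤ 1) : IsS fun p => Real.sin (c * p.2.1) := fun R => by
  refine ⟨1, zero_le_one, fun p _ => ⟨?_, fun q _ δ h => ?_⟩⟩
  · have h1 : |Real.sin (c * p.2.1)| ≤ |c * p.2.1| := Real.abs_sin_le_abs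
    rw [abs_mul] at h1
    have := mul_le_mul_of_nonneg_right hc (abs_nonneg p.2.1)
    unfold siz; linarith [abs_nonneg p.1]
  · have := mul_nonneg h.nonneg (siz_nonneg p)
    have h1 := Real.abs_sin_sub_sin_le (c * p.2.1) (c * q.2.1)
    rw [← mul_sub, abs_mul] at h1
    have := mul_le_mul_of_nonneg_right hc (abs_nonneg (p.2.1 - q.2.1))
    unfold gap; linarith [abs_nonneg (p.1 - q.1)]

theorem sin_half : IsS fun p => Real.sin (p.2.1 / 2) := by
  have := sin_mul (1 / 2) (by rw [abs_of_pos] <;> norm_num)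
  simpa [div_eq_inv_mul] using this

theorem sin : IsS fun p => Real.sin p.2.1 := by
  simpa using sin_mul 1 (by simp)

theorem add (ha : IsS a) (hb : IsS b) : IsS fun p => a p + b p := fun R => by
  obtain ⟨C, hC, h1⟩ := ha R
  obtain ⟨D, hD, h2⟩ := hb R
  refine ⟨C + D, by positivity, fun p hp => ⟨?_, fun q hq δ h => ?_⟩⟩
  · refine (abs_add_le _ _).trans ?_
    linarith [(h1 p hp).1, (h2 p hp).1]
  · have e : a p + b p - (a q + b q) = (a p - a q) + (b p - b q) := by ring
    rw [e]
    refine (abs_add_le _ _).trans ?_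
    linarith [(h1 p hp).2 q hq δ h, (h2 p hp).2 q hq δ h]

theorem mul (ha : IsS a) (hb : IsM b) : IsS fun p => a p * b p := fun R => by
  obtain ⟨C, hC, h1⟩ := ha R
  obtain ⟨D, hD, h2⟩ := hb R
  refine ⟨C * D + C * D, by positivity, fun p hp => ⟨?_, fun q hq δ h => ?_⟩⟩
  · rw [abs_mul]
    have := mul_le_mul (h1 p hp).1 (h2 p hp).1 (abs_nonneg _) (mul_nonneg hC (siz_nonneg p))
    have := mul_nonneg (mul_nonneg hC hD) (siz_nonneg p)
    linarith
  · have e : a p * b p - a q * b q = a p * (b p - b q) + b q * (a p - a q) := by ring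
    rw [e]
    refine (abs_add_le _ _).trans ?_
    rw [abs_mul, abs_mul]
    have i1 := mul_le_mul (h1 p hp).1 ((h2 p hp).2 q hq δ h) (abs_nonneg _)
      (mul_nonneg hC (siz_nonneg p))
    have i2 := mul_le_mul (h2 q hq).1 ((h1 p hp).2 q hq δ h) (abs_nonneg _) hD
    have i3 := mul_le_mul_of_nonneg_left (mul_siz_le_gap δ p q) (mul_nonneg hC hD)
    linarith

theorem isM (ha : IsS a) : IsM a := fun R => by
  obtain ⟨C, hC, h1⟩ := ha R
  refine ⟨C * (2 + 2 * |R|), by positivity, fun p hp => ?_⟩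
  have hR : 0 ≤ R := (abs_nonneg _).trans hp.1
  rw [abs_of_nonneg hR]
  refine ⟨(h1 p hp).1.trans ?_, fun q hq δ h => ((h1 p hp).2 q hq δ h).trans ?_⟩
  · refine mul_le_mul_of_nonneg_left ?_ hC
    unfold siz; linarith [hp.1, hp.2.1]
  · rw [mul_assoc]
    exact mul_le_mul_of_nonneg_left (gap_le hp h) hC

theorem pow_fst {n : ℕ} (hn : n ≠ 0) : IsS fun p => p.1 ^ n := by
  obtain ⟨m, rfl⟩ := Nat.exists_eq_succ_of_ne_zero hn
  simpa [pow_succ, mul_comm] using fst.mul (IsM.fst.pow m)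

theorem pow_sin {n : ℕ} (hn : n ≠ 0) : IsS fun p => Real.sin (p.2.1 / 2) ^ n := by
  obtain ⟨m, rfl⟩ := Nat.exists_eq_succ_of_ne_zero hn
  simpa [pow_succ, mul_comm] using sin_half.mul (sin_half.isM.pow m)

end IsS

/-- The weight `cos^k (v/2) ξ` in the kernel. -/
def weightF (l : ℕ) (p : ℝ × ℝ × ℝ) : ℝ := Real.cos (p.2.1 / 2) ^ expK l * p.2.2

def densPF (l : ℕ) (p : ℝ × ℝ × ℝ) : ℝ :=
  ((2 * (l : ℝ) + 1) / 2 * p.1 ^ l * Real.sin (p.2.1 / 2) ^ 2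
      * Real.cos (p.2.1 / 2) ^ (expK l - 2)
    + p.1 ^ (l + 2) * Real.cos (p.2.1 / 2) ^ expK l) * p.2.2

def densQF (l : ℕ) (p : ℝ × ℝ × ℝ) : ℝ :=
  p.1 ^ (l - 1) * Real.sin (p.2.1 / 2) ^ 3 * Real.cos (p.2.1 / 2) ^ (expK l - 3) * p.2.2

def localVF (l : ℕ) (p : ℝ × ℝ × ℝ) : ℝ :=
  -p.1 ^ l * Real.sin (p.2.1 / 2) ^ 2 + 2 * p.1 ^ (l + 2) * Real.cos (p.2.1 / 2) ^ 2

def localXiF (l : ℕ) (p : ℝ × ℝ × ℝ) : ℝ :=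
  ((l : ℝ) + 1) / 2 * p.1 ^ l * p.2.2 * Real.sin p.2.1
    + ((l : ℝ) + 1) * p.1 ^ (l + 2) * p.2.2 * Real.sin p.2.1

def coefVF (p : ℝ × ℝ × ℝ) : ℝ := 2 * Real.cos (p.2.1 / 2) ^ 2

def coefXiF (l : ℕ) (p : ℝ × ℝ × ℝ) : ℝ := ((l : ℝ) + 1) * p.2.2 * Real.sin p.2.1

theorem isM_weightF (l : ℕ) : IsM (weightF l) := (IsM.cos_half.pow _).mul IsM.thd

theorem isM_coefVF : IsM coefVF := (IsM.const 2).mul (IsM.cos_half.pow 2)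

theorem isS_coefXiF (l : ℕ) : IsS (coefXiF l) := by
  have := IsS.sin.mul ((IsM.const ((l : ℝ) + 1)).mul IsM.thd)
  unfold coefXiF; simpa [mul_comm] using this

theorem isS_densPF (l : ℕ) : IsS (densPF l) := by
  have h1 := ((IsS.pow_sin two_ne_zero).mul (((IsM.const ((2 * (l : ℝ) + 1) / 2)).mul
    (IsM.fst.pow l)).mul ((IsM.cos_half.pow (expK l - 2)).mul IsM.thd)))
  have h2 := (IsS.pow_fst (n := l + 2) (by omega)).mul ((IsM.cos_half.pow (expK l)).mul IsM.thd)
  convert h1.add h2 using 2 with p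
  unfold densPF; ring

theorem isS_densQF (l : ℕ) : IsS (densQF l) := by
  have h1 := ((IsS.pow_sin three_ne_zero).mul
    ((IsM.fst.pow (l - 1)).mul ((IsM.cos_half.pow (expK l - 3)).mul IsM.thd)))
  convert h1 using 2 with p
  unfold densQF; ring

theorem isS_localVF (l : ℕ) : IsS (localVF l) := by
  have h1 := (IsS.pow_sin two_ne_zero).mul ((IsM.const (-1)).mul (IsM.fst.pow l))
  have h2 := (IsS.pow_fst (n := l + 2) (by omega)).mul ((IsM.const 2).mul (IsM.cos_half.pow 2))
  convert h1.add h2 using 2 with p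
  unfold localVF; ring

theorem isS_localXiF (l : ℕ) : IsS (localXiF l) := by
  have h1 := IsS.sin.mul ((IsM.const (((l : ℝ) + 1) / 2)).mul ((IsM.fst.pow l).mul IsM.thd))
  have h2 := IsS.sin.mul ((IsM.const ((l : ℝ) + 1)).mul ((IsM.fst.pow (l + 2)).mul IsM.thd))
  convert h1.add h2 using 2 with p
  unfold localXiF; ring

/-! ### Exponential convolution and Young's inequality -/

theorem sq_lintegral_mul_le {k H : ℝ → ℝ≥0∞} (hk : Measurable k) (hH : Measurable H) :
    (∫⁻ x, k x * H x) ^ 2 ≤ (∫⁻ x, k x) * ∫⁻ x, k x * H x ^ 2 := by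
  have h := ENNReal.lintegral_mul_le_Lp_mul_Lq volume Real.HolderConjugate.two_two
    (f := fun x => k x ^ (1 / 2 : ℝ)) (g := fun x => k x ^ (1 / 2 : ℝ) * H x)
    (hk.pow_const _).aemeasurable ((hk.pow_const _).mul hH).aemeasurable
  have e0 : ∀ x, k x ^ (1 / 2 : ℝ) * k x ^ (1 / 2 : ℝ) = k x := fun x => by
    rw [← ENNReal.rpow_add_of_nonneg _ _ (by norm_num) (by norm_num)]; norm_num
  have e1 : ∀ x, ((fun x => k x ^ (1 / 2 : ℝ)) * fun x => k x ^ (1 / 2 : ℝ) * H x) x =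
      k x * H x := fun x => by
    simp only [Pi.mul_apply]; rw [← mul_assoc, e0]
  have e2 : ∀ x, (k x ^ (1 / 2 : ℝ)) ^ (2 : ℝ) = k x := fun x => by
    rw [← ENNReal.rpow_mul]; norm_num
  have e3 : ∀ x, (k x ^ (1 / 2 : ℝ) * H x) ^ (2 : ℝ) = k x * H x ^ 2 := fun x => by
    rw [ENNReal.mul_rpow_of_nonneg _ _ (by norm_num), e2]; norm_num
  simp_rw [e1, e2, e3] at h
  have h2 := ENNReal.rpow_le_rpow h (show (0 : ℝ) ≤ 2 by norm_num)
  rw [ENNReal.mul_rpow_of_nonneg _ _ (by norm_num), ← ENNReal.rpow_mul, ← ENNReal.rpow_mul] at h2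
  norm_num at h2
  exact h2

theorem integrable_exp_neg_mul_abs {α : ℝ} (hα : 0 < α) :
    Integrable fun x : ℝ => Real.exp (-α * |x|) := by
  have h1 : IntegrableOn (fun x : ℝ => Real.exp (-α * |x|)) (Ioi 0) :=
    (exp_neg_integrableOn_Ioi 0 hα).congr_fun (fun x hx => by
      simp only [abs_of_pos (mem_Ioi.mp hx)]) measurableSet_Ioi
  have h2 : IntegrableOn (fun x : ℝ => Real.exp (-α * |x|)) (Iic 0) :=
    (integrableOn_exp_mul_Iic hα 0).congr_fun (fun x hx => by
      simp only [abs_of_nonpos (mem_Iic.mp hx)]; ring_nf) measurableSet_Iic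
  rw [← integrableOn_univ, ← Iic_union_Ioi (a := (0 : ℝ))]
  exact h2.union h1

theorem integrable_exp_neg_mul_abs_sub {α : ℝ} (hα : 0 < α) (Y : ℝ) :
    Integrable fun x : ℝ => Real.exp (-α * |Y - x|) :=
  (integrable_exp_neg_mul_abs hα).comp_sub_left Y

/-- The mass of the kernel `exp (-α |x|)`. -/
def expMass (α : ℝ) : ℝ := ∫ x : ℝ, Real.exp (-α * |x|)

theorem expMass_nonneg (α : ℝ) : 0 ≤ expMass α := integral_nonneg fun _ => (Real.exp_pos _).le

/-- Convolution with `exp (-α |x|)`. -/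
def expConv (α : ℝ) (h : ℝ → ℝ) (Y : ℝ) : ℝ := ∫ x, Real.exp (-α * |Y - x|) * h x

/-- A measurable function whose supremum and whose `L²` norm are at most `C`. -/
structure Bd (C : ℝ) (h : ℝ → ℝ) : Prop where
  meas : Measurable h
  bound : ∀ Y, |h Y| ≤ C
  l2 : eLpNorm h 2 volume ≤ ENNReal.ofReal C

namespace Bd

variable {C D : ℝ} {h k : ℝ → ℝ}

theorem nonneg (hh : Bd C h) : 0 ≤ C := (abs_nonneg _).trans (hh.bound 0)

theorem memLp (hh : Bd C h) : MemLp h 2 volume :=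
  ⟨hh.meas.aestronglyMeasurable, hh.l2.trans_lt ENNReal.ofReal_lt_top⟩

theorem of_le (hh : Bd C h) (hk : Measurable k) (hle : ∀ Y, |k Y| ≤ |h Y|) : Bd C k :=
  ⟨hk, fun Y => (hle Y).trans (hh.bound Y), (eLpNorm_mono hle).trans hh.l2⟩

theorem mono (hh : Bd C h) (hCD : C ≤ D) : Bd D h :=
  ⟨hh.meas, fun Y => (hh.bound Y).trans hCD, hh.l2.trans (ENNReal.ofReal_le_ofReal hCD)⟩

theorem add (hh : Bd C h) (hk : Bd D k) : Bd (C + D) fun Y => h Y + k Y :=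
  ⟨hh.meas.add hk.meas, fun Y => (abs_add_le _ _).trans (add_le_add (hh.bound Y) (hk.bound Y)), by
    rw [ENNReal.ofReal_add hh.nonneg hk.nonneg]
    exact (eLpNorm_add_le hh.meas.aestronglyMeasurable hk.meas.aestronglyMeasurable
      (by norm_num)).trans (add_le_add hh.l2 hk.l2)⟩

theorem const_mul (hh : Bd C h) {a : ℝ} (ha : 0 ≤ a) : Bd (a * C) fun Y => a * h Y :=
  ⟨hh.meas.const_mul a, fun Y => by
    rw [abs_mul, abs_of_nonneg ha]; exact mul_le_mul_of_nonneg_left (hh.bound Y) ha, by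
    have : (fun Y => a * h Y) = a • h := rfl
    rw [this, eLpNorm_const_smul, ENNReal.ofReal_mul ha, Real.enorm_eq_ofReal ha]
    gcongr; exact hh.l2⟩

theorem abs (hh : Bd C h) : Bd C fun Y => |h Y| := hh.of_le hh.meas.abs fun Y => by simp

theorem integrable_exp_mul (hh : Bd C h) {α : ℝ} (hα : 0 < α) (Y : ℝ) :
    Integrable fun x => Real.exp (-α * |Y - x|) * h x :=
  (integrable_exp_neg_mul_abs_sub hα Y).mul_bdd hh.meas.aestronglyMeasurable
    (ae_of_all _ hh.bound)

theorem expConv {α : ℝ} (hα : 0 < α) (hh : Bd C h) :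
    Bd (expMass α * C) (expConv α h) := by
  have hmass : ∀ Y, ∫ x, Real.exp (-α * |Y - x|) = expMass α := fun Y =>
    integral_sub_left_eq_self (fun x => Real.exp (-α * |x|)) volume Y
  refine ⟨?_, fun Y => ?_, ?_⟩
  · refine (StronglyMeasurable.integral_prod_right (f := fun Y x => Real.exp (-α * |Y - x|) * h x)
      ?_).measurable
    have := hh.meas
    apply Measurable.stronglyMeasurable
    unfold Function.uncurry
    fun_prop
  · unfold LambdaFamily.expConv
    rw [← hmass Y, ← integral_mul_const]
    rw [← Real.norm_eq_abs]
    refine norm_integral_le_of_norm_le ((integrable_exp_neg_mul_abs_sub hα Y).mul_const C)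
      (ae_of_all _ fun x => ?_)
    rw [norm_mul, Real.norm_of_nonneg (Real.exp_pos _).le]
    exact mul_le_mul_of_nonneg_left (hh.bound x) (Real.exp_pos _).le
  · set k : ℝ → ℝ≥0∞ := fun x => ENNReal.ofReal (Real.exp (-α * |x|)) with hk
    have hkm : Measurable k := by fun_prop
    have hHm : Measurable fun x => ‖h x‖ₑ := hh.meas.enorm
    have hkmass : ∫⁻ x, k x = ENNReal.ofReal (expMass α) :=
      (ofReal_integral_eq_lintegral_ofReal (integrable_exp_neg_mul_abs hα)
        (ae_of_all _ fun x => (Real.exp_pos _).le)).symm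
    have h1 : ∀ Y, ‖LambdaFamily.expConv α h Y‖ₑ ≤ ∫⁻ x, k (Y - x) * ‖h x‖ₑ := fun Y => by
      refine (enorm_integral_le_lintegral_enorm _).trans_eq ?_
      refine lintegral_congr fun x => ?_
      rw [enorm_mul, Real.enorm_eq_ofReal (Real.exp_pos _).le]
    have h2 : ∀ Y, ‖LambdaFamily.expConv α h Y‖ₑ ^ 2 ≤
        ENNReal.ofReal (expMass α) * ∫⁻ x, k (Y - x) * ‖h x‖ₑ ^ 2 := fun Y => by
      refine (pow_le_pow_left' (h1 Y) 2).trans ?_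
      refine (sq_lintegral_mul_le (hkm.comp (measurable_const.sub measurable_id)) hHm).trans_eq ?_
      simp only [Function.comp_apply, Pi.sub_apply, id]
      rw [lintegral_sub_left_eq_self (fun x => k x) Y, hkmass]
    have h3 : ∫⁻ Y, ‖LambdaFamily.expConv α h Y‖ₑ ^ 2 ≤
        ENNReal.ofReal (expMass α) ^ 2 * ∫⁻ x, ‖h x‖ₑ ^ 2 := by
      calc ∫⁻ Y, ‖LambdaFamily.expConv α h Y‖ₑ ^ 2
          ≤ ∫⁻ Y, ENNReal.ofReal (expMass α) * ∫⁻ x, k (Y - x) * ‖h x‖ₑ ^ 2 := lintegral_mono h2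
        _ = ENNReal.ofReal (expMass α) * ∫⁻ x, ∫⁻ Y, k (Y - x) * ‖h x‖ₑ ^ 2 := by
            rw [lintegral_const_mul' _ _ ENNReal.ofReal_ne_top, lintegral_lintegral_swap]
            have := hh.meas
            unfold Function.uncurry
            fun_prop
        _ = ENNReal.ofReal (expMass α) ^ 2 * ∫⁻ x, ‖h x‖ₑ ^ 2 := by
            have : ∀ x, ∫⁻ Y, k (Y - x) * ‖h x‖ₑ ^ 2 =
                ENNReal.ofReal (expMass α) * ‖h x‖ₑ ^ 2 := fun x => by
              rw [lintegral_mul_const _ (by fun_prop),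
                lintegral_sub_right_eq_self (fun y => k y) x, hkmass]
            simp_rw [this]
            rw [lintegral_const_mul' _ _ ENNReal.ofReal_ne_top, sq, mul_assoc]
    have h4 : ∀ g : ℝ → ℝ, eLpNorm g 2 volume = (∫⁻ x, ‖g x‖ₑ ^ 2) ^ (1 / 2 : ℝ) := fun g => by
      rw [eLpNorm_eq_lintegral_rpow_enorm_toReal (by norm_num) (by norm_num)]
      simp
    rw [ENNReal.ofReal_mul (expMass_nonneg α)]
    refine le_trans ?_ (mul_le_mul_right hh.l2 _)
    rw [h4, h4]
    refine (ENNReal.rpow_le_rpow h3 (by norm_num)).trans_eq ?_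
    rw [ENNReal.mul_rpow_of_nonneg _ _ (by norm_num), ← ENNReal.rpow_natCast, ← ENNReal.rpow_mul]
    norm_num

end Bd

theorem expConv_mono {α C D : ℝ} (hα : 0 < α) {h k : ℝ → ℝ} (hh : Bd C h) (hk : Bd D k)
    (hle : ∀ Y, h Y ≤ k Y) (Y : ℝ) : expConv α h Y ≤ expConv α k Y :=
  integral_mono (hh.integrable_exp_mul hα Y) (hk.integrable_exp_mul hα Y) fun x =>
    mul_le_mul_of_nonneg_left (hle x) (Real.exp_pos _).le

theorem expConv_nonneg {α : ℝ} {h : ℝ → ℝ} (hh : ∀ Y, 0 ≤ h Y) (Y : ℝ) : 0 ≤ expConv α h Y :=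
  integral_nonneg fun x => mul_nonneg (Real.exp_pos _).le (hh x)

theorem expConv_const_mul (α a : ℝ) (h : ℝ → ℝ) (Y : ℝ) :
    expConv α (fun x => a * h x) Y = a * expConv α h Y := by
  unfold expConv
  rw [← integral_const_mul]
  congr 1; ext x; ring

/-! ### The exponential kernel of a weight -/

/-- `exp (-|∫_Y^{Y'} c|)`. -/
def ker (c : ℝ → ℝ) (Y Y' : ℝ) : ℝ := Real.exp (-|∫ s in Y..Y', c s|)

/-- The part of the potential of `f` that comes from the right. -/
def potR (c f : ℝ → ℝ) (Y : ℝ) : ℝ := ∫ Y' in Ioi Y, ker c Y Y' * f Y'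

/-- The part of the potential of `f` that comes from the left. -/
def potL (c f : ℝ → ℝ) (Y : ℝ) : ℝ := ∫ Y' in Iic Y, ker c Y Y' * f Y'

/-- A bounded nonnegative weight whose kernel decays exponentially. -/
structure Weight (K α : ℝ) (c : ℝ → ℝ) : Prop where
  meas : Measurable c
  nonneg : ∀ Y, 0 ≤ c Y
  le : ∀ Y, c Y ≤ K
  ker_le : ∀ Y Y', ker c Y Y' ≤ K * Real.exp (-α * |Y - Y'|)

theorem measurable_ker {c : ℝ → ℝ} (hc : LocallyIntegrable c volume) :
    Measurable (Function.uncurry (ker c)) := by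
  have h1 : ∀ Y Y', ∫ s in Y..Y', c s = (∫ s in (0:ℝ)..Y', c s) - ∫ s in (0:ℝ)..Y, c s :=
    fun Y Y' => (intervalIntegral.integral_interval_sub_left
      (LocallyIntegrable.ii hc 0 Y') (LocallyIntegrable.ii hc 0 Y)).symm
  have h2 : Measurable fun x => ∫ s in (0:ℝ)..x, c s :=
    (IsPrim.of_integral hc 0).continuous.measurable
  have h3 : Function.uncurry (ker c) = fun p : ℝ × ℝ =>
      Real.exp (-|(∫ s in (0:ℝ)..p.2, c s) - ∫ s in (0:ℝ)..p.1, c s|) := by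
    ext p
    unfold Function.uncurry ker
    rw [h1 p.1]
  rw [h3]
  exact (((h2.comp measurable_snd).sub (h2.comp measurable_fst)).abs.neg).exp

theorem ker_pos (c : ℝ → ℝ) (Y Y' : ℝ) : 0 < ker c Y Y' := Real.exp_pos _

theorem measurable_potR {c f : ℝ → ℝ} (hc : LocallyIntegrable c volume) (hf : Measurable f) :
    Measurable (potR c f) := by
  have h0 : ∀ Y, potR c f Y =
      ∫ Y', ({p : ℝ × ℝ | p.1 < p.2}.indicator (fun p => ker c p.1 p.2 * f p.2)) (Y, Y') :=
    fun Y => by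
      unfold potR
      rw [← integral_indicator measurableSet_Ioi]
      rfl
  have : potR c f = fun Y => _ := funext h0
  rw [this]
  refine (StronglyMeasurable.integral_prod_right' (f := fun p : ℝ × ℝ => _) ?_).measurable
  apply Measurable.stronglyMeasurable
  exact ((measurable_ker hc).mul (hf.comp measurable_snd)).indicator
    (measurableSet_lt measurable_fst measurable_snd)

theorem measurable_potL {c f : ℝ → ℝ} (hc : LocallyIntegrable c volume) (hf : Measurable f) :
    Measurable (potL c f) := by
  have h0 : ∀ Y, potL c f Y =
      ∫ Y', ({p : ℝ × ℝ | p.2 ≤ p.1}.indicator (fun p => ker c p.1 p.2 * f p.2)) (Y, Y') :=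
    fun Y => by
      unfold potL
      rw [← integral_indicator measurableSet_Iic]
      rfl
  have : potL c f = fun Y => _ := funext h0
  rw [this]
  refine (StronglyMeasurable.integral_prod_right' (f := fun p : ℝ × ℝ => _) ?_).measurable
  apply Measurable.stronglyMeasurable
  exact ((measurable_ker hc).mul (hf.comp measurable_snd)).indicator
    (measurableSet_le measurable_snd measurable_fst)

theorem locallyIntegrable_of_bdd {f : ℝ → ℝ} {C : ℝ} (hf : Measurable f) (h : ∀ Y, |f Y| ≤ C) :
    LocallyIntegrable f volume :=
  (locallyIntegrable_const C).mono hf.aestronglyMeasurable (ae_of_all _ fun Y =>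
    (h Y).trans (le_abs_self C))

namespace Weight

variable {K α : ℝ} {c : ℝ → ℝ}

theorem locInt (h : Weight K α c) : LocallyIntegrable c volume :=
  locallyIntegrable_of_bdd h.meas fun Y => by rw [abs_of_nonneg (h.nonneg Y)]; exact h.le Y

theorem K_nonneg (h : Weight K α c) : 0 ≤ K := (h.nonneg 0).trans (h.le 0)

theorem integrable_ker_mul (h : Weight K α c) (hα : 0 < α) {f : ℝ → ℝ} {C : ℝ}
    (hf : Measurable f) (hfC : ∀ Y, |f Y| ≤ C) (Y : ℝ) :
    Integrable fun Y' => ker c Y Y' * f Y' := by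
  have h1 : Integrable fun Y' => ker c Y Y' := by
    refine ((integrable_exp_neg_mul_abs_sub hα Y).const_mul K).mono'
      ((measurable_ker h.locInt).comp measurable_prodMk_left).aestronglyMeasurable
      (ae_of_all _ fun Y' => ?_)
    rw [Real.norm_of_nonneg (ker_pos _ _ _).le]
    exact h.ker_le Y Y'
  exact h1.mul_bdd hf.aestronglyMeasurable (ae_of_all _ hfC)

theorem potR_add_potL (h : Weight K α c) (hα : 0 < α) {f : ℝ → ℝ} {C : ℝ}
    (hf : Measurable f) (hfC : ∀ Y, |f Y| ≤ C) (Y : ℝ) :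
    ∫ Y', ker c Y Y' * f Y' = potR c f Y + potL c f Y := by
  have := integral_add_compl (measurableSet_Ioi (a := Y)) (h.integrable_ker_mul hα hf hfC Y)
  rw [compl_Ioi] at this
  exact this.symm

end Weight

theorem IsPrim.comp_contDiff {G c φ : ℝ → ℝ} {K : ℝ} (hG : IsPrim G c) (hc : Measurable c)
    (hcK : ∀ Y, |c Y| ≤ K) (hφ : ContDiff ℝ 1 φ) :
    IsPrim (fun Y => φ (G Y)) (fun Y => deriv φ (G Y) * c Y) := by
  have hK : 0 ≤ K := (abs_nonneg _).trans (hcK 0)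
  have hGL : LipschitzWith K.toNNReal G := by
    refine LipschitzWith.of_dist_le_mul fun x y => ?_
    rw [Real.dist_eq, Real.dist_eq, hG.sub_eq y x, Real.coe_toNNReal K hK]
    exact intervalIntegral.norm_integral_le_of_norm_le_const (f := c) (C := K) fun z _ => hcK z
  refine IsPrim.of_ac (fun a b => ?_) ?_ ?_
  · obtain ⟨M, hM⟩ := (isCompact_uIcc (a := a) (b := b)).exists_bound_of_continuousOn
      hG.continuous.continuousOn
    obtain ⟨L, hL⟩ := (hφ.contDiffOn (s := Icc (-M) M)).exists_lipschitzOnWith (by decide)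
      (convex_Icc _ _) isCompact_Icc
    exact (hL.comp hGL.lipschitzOnWith fun x hx => abs_le.mp (hM x hx)).absolutelyContinuousOnInterval
  · exact locallyIntegrable_iff.2 fun S hS =>
      ((locallyIntegrable_of_bdd hc hcK).integrableOn_isCompact hS).continuousOn_mul
        ((hφ.continuous_deriv le_rfl).comp hG.continuous).continuousOn hS
  · filter_upwards [hG.ae_hasDerivAt] with x hx
    exact ((hφ.differentiable one_ne_zero _).hasDerivAt).comp x hx

namespace Weight

variable {K α C : ℝ} {c f : ℝ → ℝ}

theorem isPrim_exp (h : Weight K α c) (σ : ℝ) :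
    IsPrim (fun Y => Real.exp (σ * ∫ s in (0:ℝ)..Y, c s))
      (fun Y => σ * c Y * Real.exp (σ * ∫ s in (0:ℝ)..Y, c s)) := by
  have h1 : ContDiff ℝ 1 fun x : ℝ => Real.exp (σ * x) := by fun_prop
  have h2 := (IsPrim.of_integral h.locInt 0).comp_contDiff h.meas
    (fun Y => by rw [abs_of_nonneg (h.nonneg Y)]; exact h.le Y) h1
  convert h2 using 2 with Y
  have : HasDerivAt (fun x : ℝ => Real.exp (σ * x)) _ (∫ s in (0:ℝ)..Y, c s) :=
    ((hasDerivAt_id _).const_mul σ).exp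
  rw [this.deriv]
  simp; ring

theorem ker_eq_of_le (h : Weight K α c) {Y Y' : ℝ} (hY : Y ≤ Y') :
    ker c Y Y' = Real.exp (1 * ∫ s in (0:ℝ)..Y, c s) * Real.exp (-1 * ∫ s in (0:ℝ)..Y', c s) := by
  unfold ker
  rw [abs_of_nonneg (intervalIntegral.integral_nonneg hY fun x _ => h.nonneg x), ← Real.exp_add,
    ← (IsPrim.of_integral h.locInt 0).sub_eq]
  ring_nf

theorem ker_eq_of_ge (h : Weight K α c) {Y Y' : ℝ} (hY : Y' ≤ Y) :
    ker c Y Y' = Real.exp (-1 * ∫ s in (0:ℝ)..Y, c s) * Real.exp (1 * ∫ s in (0:ℝ)..Y', c s) := by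
  have := h.ker_eq_of_le hY
  unfold ker at *
  rw [intervalIntegral.integral_symm, abs_neg, this, mul_comm]

theorem isPrim_potR (h : Weight K α c) (hα : 0 < α) (hf : Measurable f) (hfC : ∀ Y, |f Y| ≤ C) :
    IsPrim (potR c f) (fun Y => c Y * potR c f Y - f Y) := by
  set k : ℝ → ℝ := fun Y => Real.exp (-1 * ∫ s in (0:ℝ)..Y, c s) * f Y with hk
  have hki : ∀ Y, IntegrableOn k (Ioi Y) := fun Y => by
    have h1 := ((h.integrable_ker_mul hα hf hfC Y).const_mul
      (Real.exp (-1 * ∫ s in (0:ℝ)..Y, c s))).integrableOn (s := Ioi Y)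
    refine h1.congr_fun (fun Y' hY' => ?_) measurableSet_Ioi
    simp only [hk]
    rw [h.ker_eq_of_le (le_of_lt hY'), ← mul_assoc, ← mul_assoc, ← Real.exp_add]
    simp
  have hkl : LocallyIntegrable k volume := locallyIntegrable_iff.2 fun S hS =>
      ((locallyIntegrable_of_bdd hf hfC).integrableOn_isCompact hS).continuousOn_mul
        (h.isPrim_exp (-1)).continuous.continuousOn hS
  have hH : IsPrim (fun Y => ∫ Y' in Ioi Y, k Y') (fun Y => (-1) * k Y) := by
    refine ⟨hkl.smul (-1 : ℝ), fun a b => ?_⟩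
    rw [intervalIntegral.integral_const_mul,
      ← intervalIntegral.integral_Ioi_sub_Ioi' (hki a) (hki b)]
    ring
  have hpot : potR c f = fun Y => Real.exp (1 * ∫ s in (0:ℝ)..Y, c s) * ∫ Y' in Ioi Y, k Y' := by
    ext Y
    unfold potR
    rw [← integral_const_mul]
    refine setIntegral_congr_fun measurableSet_Ioi fun Y' hY' => ?_
    simp only [hk]
    rw [h.ker_eq_of_le (le_of_lt hY')]
    ring
  have hm := (h.isPrim_exp 1).mul hH
  rw [← hpot] at hm
  convert hm using 2 with Y
  rw [hpot]
  simp only [hk]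
  have : Real.exp (1 * ∫ s in (0:ℝ)..Y, c s) * Real.exp (-1 * ∫ s in (0:ℝ)..Y, c s) = 1 := by
    rw [← Real.exp_add]; simp
  linear_combination f Y * this

theorem isPrim_potL (h : Weight K α c) (hα : 0 < α) (hf : Measurable f) (hfC : ∀ Y, |f Y| ≤ C) :
    IsPrim (potL c f) (fun Y => f Y - c Y * potL c f Y) := by
  set k : ℝ → ℝ := fun Y => Real.exp (1 * ∫ s in (0:ℝ)..Y, c s) * f Y with hk
  have hki : ∀ Y, IntegrableOn k (Iic Y) := fun Y => by
    have h1 := ((h.integrable_ker_mul hα hf hfC Y).const_mul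
      (Real.exp (1 * ∫ s in (0:ℝ)..Y, c s))).integrableOn (s := Iic Y)
    refine h1.congr_fun (fun Y' hY' => ?_) measurableSet_Iic
    simp only [hk]
    rw [h.ker_eq_of_ge hY', ← mul_assoc, ← mul_assoc, ← Real.exp_add]
    simp
  have hkl : LocallyIntegrable k volume := locallyIntegrable_iff.2 fun S hS =>
      ((locallyIntegrable_of_bdd hf hfC).integrableOn_isCompact hS).continuousOn_mul
        (h.isPrim_exp 1).continuous.continuousOn hS
  have hH : IsPrim (fun Y => ∫ Y' in Iic Y, k Y') k :=
    ⟨hkl, fun a b => intervalIntegral.integral_Iic_sub_Iic (hki a) (hki b)⟩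
  have hpot : potL c f = fun Y => Real.exp (-1 * ∫ s in (0:ℝ)..Y, c s) * ∫ Y' in Iic Y, k Y' := by
    ext Y
    unfold potL
    rw [← integral_const_mul]
    refine setIntegral_congr_fun measurableSet_Iic fun Y' hY' => ?_
    simp only [hk]
    rw [h.ker_eq_of_ge hY']
    ring
  have hm := (h.isPrim_exp (-1)).mul hH
  rw [← hpot] at hm
  convert hm using 2 with Y
  rw [hpot]
  simp only [hk]
  have : Real.exp (1 * ∫ s in (0:ℝ)..Y, c s) * Real.exp (-1 * ∫ s in (0:ℝ)..Y, c s) = 1 := by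
    rw [← Real.exp_add]; simp
  linear_combination (-f Y) * this

theorem abs_setIntegral_le (h : Weight K α c) (hα : 0 < α)
    {m : ℝ → ℝ} {B : ℝ} (hm : Bd B m) (hfm : ∀ Y, |f Y| ≤ m Y) (S : Set ℝ) (Y : ℝ) :
    |∫ Y' in S, ker c Y Y' * f Y'| ≤ K * expConv α m Y := by
  have hm0 : ∀ Y, 0 ≤ m Y := fun Y => (abs_nonneg _).trans (hfm Y)
  unfold expConv
  rw [← integral_const_mul, ← Real.norm_eq_abs]
  have hi := (hm.integrable_exp_mul hα Y).const_mul K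
  refine (norm_integral_le_of_norm_le hi.integrableOn (ae_of_all _ fun x => ?_)).trans
    (setIntegral_le_integral hi (ae_of_all _ fun x =>
      mul_nonneg h.K_nonneg (mul_nonneg (Real.exp_pos _).le (hm0 x))))
  rw [norm_mul, Real.norm_of_nonneg (ker_pos _ _ _).le, Real.norm_eq_abs, ← mul_assoc]
  exact mul_le_mul (h.ker_le Y x) (hfm x) (abs_nonneg _)
    (mul_nonneg h.K_nonneg (Real.exp_pos _).le)

theorem abs_ker_sub_ker_le {c₁ c₂ : ℝ → ℝ} (h₁ : Weight K α c₁) (h₂ : Weight K α c₂) (hα : 0 < α)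
    {D : ℝ} (hD : ∀ Y, |c₁ Y - c₂ Y| ≤ D) (Y Y' : ℝ) :
    |ker c₁ Y Y' - ker c₂ Y Y'| ≤ 2 * K / α * D * Real.exp (-(α / 2) * |Y - Y'|) := by
  have hD0 : 0 ≤ D := (abs_nonneg _).trans (hD 0)
  set I₁ := |∫ s in Y..Y', c₁ s| with hI₁
  set I₂ := |∫ s in Y..Y', c₂ s| with hI₂
  have hI : |I₁ - I₂| ≤ D * |Y - Y'| := by
    refine (abs_abs_sub_abs_le_abs_sub _ _).trans ?_
    rw [← intervalIntegral.integral_sub (LocallyIntegrable.ii h₁.locInt _ _)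
      (LocallyIntegrable.ii h₂.locInt _ _), abs_sub_comm Y Y', ← Real.norm_eq_abs]
    exact intervalIntegral.norm_integral_le_of_norm_le_const fun z _ => hD z
  have gen : ∀ a b M : ℝ, Real.exp (-a) ≤ M → Real.exp (-b) ≤ M →
      |Real.exp (-a) - Real.exp (-b)| ≤ M * |a - b| := by
    have one : ∀ a b M : ℝ, Real.exp (-a) ≤ M → Real.exp (-b) ≤ M →
        Real.exp (-a) - Real.exp (-b) ≤ M * |a - b| := fun a b M ha hb => by
      have e : Real.exp (-b) = Real.exp (-a) * Real.exp (a - b) := by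
        rw [← Real.exp_add]; ring_nf
      have i1 := Real.add_one_le_exp (a - b)
      have i2 := Real.exp_pos (-a)
      calc Real.exp (-a) - Real.exp (-b) ≤ Real.exp (-a) * (-(a - b)) := by rw [e]; nlinarith
        _ ≤ Real.exp (-a) * |a - b| := mul_le_mul_of_nonneg_left (neg_le_abs _) i2.le
        _ ≤ M * |a - b| := mul_le_mul_of_nonneg_right ha (abs_nonneg _)
    intro a b M ha hb
    rw [abs_le']
    refine ⟨one a b M ha hb, ?_⟩
    have := one b a M hb ha
    rw [abs_sub_comm] at this
    linarith
  have h3 := gen I₁ I₂ _ (h₁.ker_le Y Y') (h₂.ker_le Y Y')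
  refine h3.trans ?_
  have hr : |Y - Y'| ≤ 2 / α * Real.exp (α / 2 * |Y - Y'|) := by
    have := Real.add_one_le_exp (α / 2 * |Y - Y'|)
    have h5 : α / 2 * |Y - Y'| ≤ Real.exp (α / 2 * |Y - Y'|) := by linarith
    calc |Y - Y'| = 2 / α * (α / 2 * |Y - Y'|) := by field_simp
      _ ≤ _ := mul_le_mul_of_nonneg_left h5 (by positivity)
  have hK := h₁.K_nonneg
  calc K * Real.exp (-α * |Y - Y'|) * |I₁ - I₂|
      ≤ K * Real.exp (-α * |Y - Y'|) * (D * (2 / α * Real.exp (α / 2 * |Y - Y'|))) := by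
        gcongr
        exact hI.trans (mul_le_mul_of_nonneg_left hr hD0)
    _ = 2 * K / α * D * (Real.exp (-α * |Y - Y'|) * Real.exp (α / 2 * |Y - Y'|)) := by ring
    _ = _ := by rw [← Real.exp_add]; ring_nf

theorem abs_setIntegral_sub_le {c₁ c₂ f₁ f₂ m : ℝ → ℝ} (h₁ : Weight K α c₁) (h₂ : Weight K α c₂)
    (hα : 0 < α) {D C₁ C₂ B A : ℝ} (hD : ∀ Y, |c₁ Y - c₂ Y| ≤ D)
    (hf₁ : Measurable f₁) (hf₂ : Measurable f₂) (hb₁ : ∀ Y, |f₁ Y| ≤ C₁) (hb₂ : ∀ Y, |f₂ Y| ≤ C₂)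
    (hm : Bd B m) (hfm : ∀ Y, |f₁ Y - f₂ Y| ≤ A * m Y) (hfD : ∀ Y, D * |f₁ Y| ≤ A * m Y)
    (S : Set ℝ) (Y : ℝ) :
    |(∫ Y' in S, ker c₁ Y Y' * f₁ Y') - ∫ Y' in S, ker c₂ Y Y' * f₂ Y'| ≤
      (K + 2 * K / α) * A * expConv (α / 2) m Y := by
  have hm0 : ∀ Y, 0 ≤ A * m Y := fun Y => (abs_nonneg _).trans (hfm Y)
  have hK := h₁.K_nonneg
  rw [← integral_sub (h₁.integrable_ker_mul hα hf₁ hb₁ Y).integrableOn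
    (h₂.integrable_ker_mul hα hf₂ hb₂ Y).integrableOn]
  unfold expConv
  rw [← integral_const_mul, ← Real.norm_eq_abs]
  have hi := (hm.integrable_exp_mul (half_pos hα) Y).const_mul ((K + 2 * K / α) * A)
  have e : ∀ x, (K + 2 * K / α) * A * (Real.exp (-(α / 2) * |Y - x|) * m x) =
      (K + 2 * K / α) * (Real.exp (-(α / 2) * |Y - x|) * (A * m x)) := fun x => by ring
  refine (norm_integral_le_of_norm_le hi.integrableOn (ae_of_all _ fun x => ?_)).trans
    (setIntegral_le_integral hi (ae_of_all _ fun x => by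
      simp only [e, Pi.zero_apply]
      exact mul_nonneg (by positivity) (mul_nonneg (Real.exp_pos _).le (hm0 x))))
  rw [e]
  have e2 : ker c₁ Y x * f₁ x - ker c₂ Y x * f₂ x =
      (ker c₁ Y x - ker c₂ Y x) * f₁ x + ker c₂ Y x * (f₁ x - f₂ x) := by ring
  rw [e2, Real.norm_eq_abs]
  refine (abs_add_le _ _).trans ?_
  rw [abs_mul, abs_mul, abs_of_pos (ker_pos _ _ _)]
  have i1 := mul_le_mul_of_nonneg_right (h₁.abs_ker_sub_ker_le h₂ hα hD Y x) (abs_nonneg (f₁ x))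
  have i2 : 2 * K / α * Real.exp (-(α / 2) * |Y - x|) * (D * |f₁ x|) ≤
      2 * K / α * Real.exp (-(α / 2) * |Y - x|) * (A * m x) :=
    mul_le_mul_of_nonneg_left (hfD x) (by positivity)
  have i3 : Real.exp (-α * |Y - x|) ≤ Real.exp (-(α / 2) * |Y - x|) := by
    apply Real.exp_le_exp.2
    nlinarith [abs_nonneg (Y - x)]
  have i4 := (h₂.ker_le Y x).trans (mul_le_mul_of_nonneg_left i3 hK)
  have i5 := mul_le_mul i4 (hfm x) (abs_nonneg _) (mul_nonneg hK (Real.exp_pos _).le)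
  linarith

end Weight

/-- A nonnegative weight that is bounded below off a set of finite measure has a kernel with
exponential decay. -/
theorem ker_le_exp {c : ℝ → ℝ} {K c₀ M : ℝ} (hc : Measurable c) (hc0 : ∀ Y, 0 ≤ c Y)
    (hcK : ∀ Y, c Y ≤ K) (h0 : 0 < c₀) (hM : 0 ≤ M) {S : Set ℝ} (hS : MeasurableSet S)
    (hvol : volume S ≤ ENNReal.ofReal M) (hcS : ∀ Y ∉ S, c₀ ≤ c Y) (Y Y' : ℝ) :
    ker c Y Y' ≤ Real.exp (c₀ * M) * Real.exp (-c₀ * |Y - Y'|) := by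
  have hl : LocallyIntegrable c volume :=
    locallyIntegrable_of_bdd hc fun Y => by rw [abs_of_nonneg (hc0 Y)]; exact hcK Y
  have key : ∀ a b, a ≤ b → c₀ * (b - a - M) ≤ ∫ s in a..b, c s := fun a b hab => by
    rw [intervalIntegral.integral_of_le hab]
    have hSf : volume S ≠ ⊤ := (hvol.trans_lt ENNReal.ofReal_lt_top).ne
    have hind : IntegrableOn (S.indicator fun _ => c₀) (Ioc a b) :=
      ((integrable_indicator_iff hS).2 (integrableOn_const hSf)).integrableOn
    have h1 : ∫ s in Ioc a b, (c₀ - S.indicator (fun _ => c₀) s) ≤ ∫ s in Ioc a b, c s := by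
      refine setIntegral_mono (integrableOn_const (by simp) |>.sub hind)
        (LocallyIntegrable.ii hl a b).1 fun s => ?_
      by_cases hs : s ∈ S
      · simpa [hs] using hc0 s
      · simpa [hs] using hcS s hs
    have h2 : ∫ s in Ioc a b, S.indicator (fun _ => c₀) s ≤ c₀ * M := by
      calc ∫ s in Ioc a b, S.indicator (fun _ => c₀) s ≤ ∫ s, S.indicator (fun _ => c₀) s :=
            setIntegral_le_integral ((integrable_indicator_iff hS).2 (integrableOn_const hSf))
              (ae_of_all _ fun s => indicator_nonneg (fun _ _ => h0.le) s)
        _ = c₀ * (volume S).toReal := by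
            rw [integral_indicator hS, setIntegral_const, smul_eq_mul, mul_comm]; rfl
        _ ≤ c₀ * M := by
            gcongr; exact ENNReal.toReal_le_of_le_ofReal hM hvol
    have hcon : IntegrableOn (fun _ : ℝ => c₀) (Ioc a b) := integrableOn_const (by simp)
    rw [integral_sub hcon hind, setIntegral_const] at h1
    simp only [smul_eq_mul, measureReal_def, Real.volume_Ioc,
      ENNReal.toReal_ofReal (sub_nonneg.2 hab)] at h1
    linarith
  unfold ker
  rw [← Real.exp_add]
  apply Real.exp_le_exp.2
  rcases le_total Y Y' with h | h
  · rw [abs_sub_comm, abs_of_nonneg (sub_nonneg.2 h)]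
    have := (key Y Y' h).trans (le_abs_self _)
    linarith
  · rw [abs_of_nonneg (sub_nonneg.2 h), intervalIntegral.integral_symm, abs_neg]
    have := (key Y' Y h).trans (le_abs_self _)
    linarith

/-! ### Estimates for the right-hand side -/

/-- The triple `(u, v, ξ)` as a function of `Y`. -/
def trip (u v ξ : ℝ → ℝ) (Y : ℝ) : ℝ × ℝ × ℝ := (u Y, v Y, ξ Y)

/-- Measurable states with quantitative bounds that make the kernel decay. -/
structure Adm (R : ℝ) (u v ξ : ℝ → ℝ) : Prop where
  meas_u : Measurable u
  meas_v : Measurable v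
  meas_xi : Measurable ξ
  u_le : ∀ Y, |u Y| ≤ R
  v_le : ∀ Y, |v Y| ≤ R
  xi_le : ∀ Y, ξ Y ≤ R
  le_xi : ∀ Y, 1 / R ≤ ξ Y
  bad : volume {Y | Real.cos (v Y / 2) ^ 2 < 1 / 2} ≤ ENNReal.ofReal R

theorem even_expK (l : ℕ) : Even (expK l) := ⟨l + 1, by unfold expK; ring⟩

/-- Right-hand side of the equation for the derivative `u_Y`. -/
def rhsW (l : ℕ) (u v ξ : ℝ → ℝ) (Y : ℝ) : ℝ :=
  densP l u v ξ Y - Real.cos (v Y / 2) ^ expK l * ξ Y * (P l u v ξ Y + Qx l u v ξ Y)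

theorem IsM.measurable_comp {a : ℝ × ℝ × ℝ → ℝ} (ha : Measurable a) {u v ξ : ℝ → ℝ}
    (hu : Measurable u) (hv : Measurable v) (hξ : Measurable ξ) :
    Measurable fun Y => a (trip u v ξ Y) :=
  ha.comp (hu.prodMk (hv.prodMk hξ))

theorem measurable_weightF (l : ℕ) : Measurable (weightF l) := by unfold weightF; fun_prop

theorem measurable_densPF (l : ℕ) : Measurable (densPF l) := by unfold densPF; fun_prop

theorem measurable_densQF (l : ℕ) : Measurable (densQF l) := by unfold densQF; fun_prop

theorem measurable_pots (l : ℕ) {u v ξ : ℝ → ℝ} {R : ℝ} (hu : Measurable u) (hv : Measurable v)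
    (hξ : Measurable ξ) (hb : ∀ Y, |ξ Y| ≤ R) :
    Measurable (P l u v ξ) ∧ Measurable (Px l u v ξ) ∧ Measurable (Q l u v ξ) ∧
      Measurable (Qx l u v ξ) := by
  have hwm : Measurable fun Y => weightF l (trip u v ξ Y) :=
    IsM.measurable_comp (measurable_weightF l) hu hv hξ
  have hw : LocallyIntegrable (fun Y => weightF l (trip u v ξ Y)) volume := by
    refine locallyIntegrable_of_bdd hwm (C := R) fun Y => ?_
    unfold weightF trip
    rw [abs_mul, abs_pow]
    have h1 : |Real.cos (v Y / 2)| ^ expK l ≤ 1 :=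
      pow_le_one₀ (abs_nonneg _) (Real.abs_cos_le_one _)
    exact (mul_le_of_le_one_left (abs_nonneg _) h1).trans (hb Y)
  have hP : Measurable (densP l u v ξ) := IsM.measurable_comp (measurable_densPF l) hu hv hξ
  have hQ : Measurable (densQ l u v ξ) := IsM.measurable_comp (measurable_densQF l) hu hv hξ
  have full : ∀ f : ℝ → ℝ, Measurable f → Measurable fun Y => ∫ Y', kern l v ξ Y Y' * f Y' :=
    fun f hf => by
      refine (StronglyMeasurable.integral_prod_right'
        (f := fun p : ℝ × ℝ => kern l v ξ p.1 p.2 * f p.2) ?_).measurable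
      exact ((measurable_ker hw).mul (hf.comp measurable_snd)).stronglyMeasurable
  exact ⟨(full _ hP).const_mul _,
    ((measurable_potR hw hP).sub (measurable_potL hw hP)).const_mul _,
    (full _ hQ).const_mul _, ((measurable_potR hw hQ).sub (measurable_potL hw hQ)).const_mul _⟩

theorem measurable_rhs (l : ℕ) {u v ξ : ℝ → ℝ} {R : ℝ} (hu : Measurable u) (hv : Measurable v)
    (hξ : Measurable ξ) (hb : ∀ Y, |ξ Y| ≤ R) :
    Measurable (rhsU l u v ξ) ∧ Measurable (rhsV l u v ξ) ∧ Measurable (rhsXi l u v ξ) ∧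
      Measurable (rhsW l u v ξ) := by
  obtain ⟨h1, h2, h3, h4⟩ := measurable_pots l hu hv hξ hb
  unfold rhsU rhsV rhsXi rhsW densP
  refine ⟨?_, ?_, ?_, ?_⟩ <;> fun_prop

namespace Adm

variable {R : ℝ} {u v ξ : ℝ → ℝ}

theorem mem_box (h : Adm R u v ξ) (hR : 0 < R) (Y : ℝ) : trip u v ξ Y ∈ Box R :=
  ⟨h.u_le Y, h.v_le Y, abs_le.2 ⟨by
    have := h.le_xi Y
    have : 0 < 1 / R := by positivity
    simp only [trip]; linarith, h.xi_le Y⟩⟩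

theorem xi_pos (h : Adm R u v ξ) (hR : 0 < R) (Y : ℝ) : 0 < ξ Y :=
  (by positivity : 0 < 1 / R).trans_le (h.le_xi Y)

theorem abs_xi_le (h : Adm R u v ξ) (hR : 0 < R) (Y : ℝ) : |ξ Y| ≤ R := (h.mem_box hR Y).2.2

theorem meas_trip (h : Adm R u v ξ) {a : ℝ × ℝ × ℝ → ℝ} (ha : Measurable a) :
    Measurable fun Y => a (trip u v ξ Y) :=
  IsM.measurable_comp ha h.meas_u h.meas_v h.meas_xi

end Adm

theorem exists_weight (l : ℕ) {R : ℝ} (hR : 0 < R) : ∃ K α : ℝ, 0 < α ∧ ∀ u v ξ, Adm R u v ξ →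
    Weight K α fun Y => weightF l (trip u v ξ Y) := by
  set c₀ : ℝ := (1 / 2) ^ (l + 1) * (1 / R) with hc₀
  have h0 : 0 < c₀ := by positivity
  refine ⟨max R (Real.exp (c₀ * R)), c₀, h0, fun u v ξ h => ?_⟩
  have hm := h.meas_trip (measurable_weightF l)
  have hn : ∀ Y, 0 ≤ weightF l (trip u v ξ Y) := fun Y =>
    mul_nonneg ((even_expK l).pow_nonneg _) (h.xi_pos hR Y).le
  have hle : ∀ Y, weightF l (trip u v ξ Y) ≤ R := fun Y => by
    have h1 : Real.cos (v Y / 2) ^ expK l ≤ 1 := by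
      rw [← (even_expK l).pow_abs]
      exact pow_le_one₀ (abs_nonneg _) (Real.abs_cos_le_one _)
    exact (mul_le_of_le_one_left (h.xi_pos hR Y).le h1).trans (h.xi_le Y)
  refine ⟨hm, hn, fun Y => (hle Y).trans (le_max_left _ _), fun Y Y' => ?_⟩
  have hS : MeasurableSet {Y | Real.cos (v Y / 2) ^ 2 < 1 / 2} := by
    have := h.meas_v
    exact measurableSet_lt (by fun_prop) measurable_const
  refine (ker_le_exp hm hn hle h0 hR.le hS h.bad (fun Z hZ => ?_) Y Y').trans
    (mul_le_mul_of_nonneg_right (le_max_right _ _) (Real.exp_pos _).le)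
  simp only [mem_ofPred_eq, not_lt] at hZ
  have e : weightF l (trip u v ξ Z) = (Real.cos (v Z / 2) ^ 2) ^ (l + 1) * ξ Z := by
    unfold weightF trip expK; rw [pow_mul]
  rw [e, hc₀]
  have := h.le_xi Z
  gcongr

/-- The four nonlocal terms satisfy a pointwise predicate. -/
def AllPots (l : ℕ) (p : (ℝ → ℝ) → Prop) (u₁ v₁ ξ₁ u₂ v₂ ξ₂ : ℝ → ℝ) : Prop :=
  p (fun Y => P l u₁ v₁ ξ₁ Y - P l u₂ v₂ ξ₂ Y) ∧ p (fun Y => Px l u₁ v₁ ξ₁ Y - Px l u₂ v₂ ξ₂ Y) ∧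
  p (fun Y => Q l u₁ v₁ ξ₁ Y - Q l u₂ v₂ ξ₂ Y) ∧ p (fun Y => Qx l u₁ v₁ ξ₁ Y - Qx l u₂ v₂ ξ₂ Y)

theorem exists_pots_bound (l : ℕ) {R : ℝ} (hR : 0 < R) : ∃ C α : ℝ, 0 ≤ C ∧ 0 < α ∧
    (∀ u v ξ, Adm R u v ξ → ∀ B, Bd B (fun Y => siz (trip u v ξ Y)) → ∀ Y,
      |P l u v ξ Y| ≤ C * expConv α (fun Y => siz (trip u v ξ Y)) Y ∧
      |Px l u v ξ Y| ≤ C * expConv α (fun Y => siz (trip u v ξ Y)) Y ∧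
      |Q l u v ξ Y| ≤ C * expConv α (fun Y => siz (trip u v ξ Y)) Y ∧
      |Qx l u v ξ Y| ≤ C * expConv α (fun Y => siz (trip u v ξ Y)) Y) ∧
    (∀ u₁ v₁ ξ₁ u₂ v₂ ξ₂, Adm R u₁ v₁ ξ₁ → Adm R u₂ v₂ ξ₂ → ∀ δ,
      (∀ Y, Near δ (trip u₁ v₁ ξ₁ Y) (trip u₂ v₂ ξ₂ Y)) → ∀ B,
      Bd B (fun Y => gap δ (trip u₁ v₁ ξ₁ Y) (trip u₂ v₂ ξ₂ Y)) → ∀ Y,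
      AllPots l (fun h => |h Y| ≤
        C * expConv α (fun Y => gap δ (trip u₁ v₁ ξ₁ Y) (trip u₂ v₂ ξ₂ Y)) Y)
        u₁ v₁ ξ₁ u₂ v₂ ξ₂) := by
  obtain ⟨K, α, hα, hW⟩ := exists_weight l hR
  obtain ⟨Cw, hCw, hw⟩ := isM_weightF l R
  obtain ⟨CP, hCP, hP⟩ := isS_densPF l R
  obtain ⟨CQ, hCQ, hQ⟩ := isS_densQF l R
  obtain ⟨CP', hCP', hP'⟩ := (isS_densPF l).isM R
  obtain ⟨CQ', hCQ', hQ'⟩ := (isS_densQF l).isM R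
  set A : ℝ := CP + CQ + Cw * CP + Cw * CQ with hA
  have hA0 : 0 ≤ A := by positivity
  set C₀ : ℝ := (|K| + 2 * |K| / α) * A with hC₀
  have hC₀0 : 0 ≤ C₀ := by positivity
  have l0 : (0 : ℝ) ≤ l := Nat.cast_nonneg l
  have comb : ∀ a b M : ℝ, |a| ≤ C₀ * M → |b| ≤ C₀ * M → 0 ≤ M →
      (|1 / 2 * (a + b)| ≤ C₀ * (l + 1) * M ∧ |1 / 2 * (a - b)| ≤ C₀ * (l + 1) * M) ∧
      |(l : ℝ) / 4 * (a + b)| ≤ C₀ * (l + 1) * M ∧ |(l : ℝ) / 4 * (a - b)| ≤ C₀ * (l + 1) * M := by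
    intro a b M ha hb hM
    have s1 := abs_add_le a b
    have s2 := abs_sub a b
    have s3 : 0 ≤ C₀ * M := mul_nonneg hC₀0 hM
    have s4 : 0 ≤ l * (C₀ * M) := mul_nonneg l0 s3
    have t1 : |a + b| ≤ 2 * (C₀ * M) := by linarith
    have t2 : |a - b| ≤ 2 * (C₀ * M) := by linarith
    have m1 := mul_le_mul_of_nonneg_left t1 l0
    have m2 := mul_le_mul_of_nonneg_left t2 l0
    simp only [abs_mul, abs_of_nonneg (show (0:ℝ) ≤ l / 4 by positivity),
      abs_of_nonneg (show (0:ℝ) ≤ 1 / 2 by positivity)]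
    refine ⟨⟨?_, ?_⟩, ?_, ?_⟩ <;> nlinarith
  have comb' : ∀ a₁ a₂ b₁ b₂ M : ℝ, |a₁ - a₂| ≤ C₀ * M → |b₁ - b₂| ≤ C₀ * M → 0 ≤ M →
      (|1 / 2 * (a₁ + b₁) - 1 / 2 * (a₂ + b₂)| ≤ C₀ * (l + 1) * M ∧
        |1 / 2 * (a₁ - b₁) - 1 / 2 * (a₂ - b₂)| ≤ C₀ * (l + 1) * M) ∧
      |(l : ℝ) / 4 * (a₁ + b₁) - (l : ℝ) / 4 * (a₂ + b₂)| ≤ C₀ * (l + 1) * M ∧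
        |(l : ℝ) / 4 * (a₁ - b₁) - (l : ℝ) / 4 * (a₂ - b₂)| ≤ C₀ * (l + 1) * M := by
    intro a₁ a₂ b₁ b₂ M ha hb hM
    have := comb _ _ _ ha hb hM
    rw [← mul_sub, ← mul_sub, ← mul_sub, ← mul_sub, add_sub_add_comm, sub_sub_sub_comm]
    exact this
  refine ⟨C₀ * (l + 1), α / 2, by positivity, half_pos hα, ?_, ?_⟩
  · intro u v ξ h B hB Y
    have hw1 := hW u v ξ h
    have hK : |K| = K := abs_of_nonneg hw1.K_nonneg
    have hKK : K ≤ K + 2 * K / α := by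
      have := hw1.K_nonneg; have : 0 ≤ 2 * K / α := by positivity
      linarith
    have hs0 : ∀ Y, 0 ≤ siz (trip u v ξ Y) := fun Y => siz_nonneg _
    have hE : 0 ≤ expConv (α / 2) (fun Y => siz (trip u v ξ Y)) Y := expConv_nonneg hs0 Y
    have base : ∀ (f : ℝ × ℝ × ℝ → ℝ) (Cf : ℝ), Measurable f → 0 ≤ Cf → Cf ≤ A →
        (∀ Y, |f (trip u v ξ Y)| ≤ Cf * siz (trip u v ξ Y)) → ∀ S : Set ℝ,
        |∫ Y' in S, kern l v ξ Y Y' * f (trip u v ξ Y')| ≤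
          C₀ * expConv (α / 2) (fun Y => siz (trip u v ξ Y)) Y := by
      intro f Cf hf hCf hCfA hle S
      have := hw1.abs_setIntegral_le hα (hB.const_mul hCf) hle S Y
      refine this.trans ?_
      rw [expConv_const_mul, hC₀, hK, ← mul_assoc]
      have e1 : expConv α (fun Y => siz (trip u v ξ Y)) Y ≤
          expConv (α / 2) (fun Y => siz (trip u v ξ Y)) Y := by
        refine integral_mono (hB.integrable_exp_mul hα Y)
          (hB.integrable_exp_mul (half_pos hα) Y) fun x => ?_
        refine mul_le_mul_of_nonneg_right (Real.exp_le_exp.2 ?_) (hs0 x)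
        nlinarith [abs_nonneg (Y - x)]
      have := hw1.K_nonneg
      have := expConv_nonneg (α := α) hs0 Y
      gcongr
    have bP := base (densPF l) CP (measurable_densPF l) hCP
      (by rw [hA]; linarith [mul_nonneg hCw hCP, mul_nonneg hCw hCQ])
      (fun Y => (hP _ (h.mem_box hR Y)).1)
    have bQ := base (densQF l) CQ (measurable_densQF l) hCQ
      (by rw [hA]; linarith [mul_nonneg hCw hCP, mul_nonneg hCw hCQ])
      (fun Y => (hQ _ (h.mem_box hR Y)).1)
    have cP := comb _ _ _ (bP (Ioi Y)) (bP (Iic Y)) hE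
    have cQ := comb _ _ _ (bQ (Ioi Y)) (bQ (Iic Y)) hE
    have sP := hw1.potR_add_potL hα (h.meas_trip (measurable_densPF l))
      (fun Y => (hP' _ (h.mem_box hR Y)).1) Y
    have sQ := hw1.potR_add_potL hα (h.meas_trip (measurable_densQF l))
      (fun Y => (hQ' _ (h.mem_box hR Y)).1) Y
    refine ⟨?_, cP.1.2, ?_, cQ.2.2⟩
    · have := cP.1.1
      have e : P l u v ξ Y = 1 / 2 * (_ + _) := congrArg (1 / 2 * ·) sP
      rw [e]; exact this
    · have := cQ.2.1
      have e : Q l u v ξ Y = (l : ℝ) / 4 * (_ + _) := congrArg ((l : ℝ) / 4 * ·) sQ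
      rw [e]; exact this
  · intro u₁ v₁ ξ₁ u₂ v₂ ξ₂ h₁ h₂ δ hδ B hB Y
    have hw1 := hW _ _ _ h₁
    have hw2 := hW _ _ _ h₂
    have hδ0 : 0 ≤ δ := (hδ 0).nonneg
    have hK : |K| = K := abs_of_nonneg hw1.K_nonneg
    set m : ℝ → ℝ := fun Y => gap δ (trip u₁ v₁ ξ₁ Y) (trip u₂ v₂ ξ₂ Y) with hm
    have hm0 : ∀ Y, 0 ≤ m Y := fun Y => gap_nonneg hδ0 _ _
    have hE : 0 ≤ expConv (α / 2) m Y := expConv_nonneg hm0 Y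
    have hD : ∀ Y, |weightF l (trip u₁ v₁ ξ₁ Y) - weightF l (trip u₂ v₂ ξ₂ Y)| ≤ Cw * δ :=
      fun Y => (hw _ (h₁.mem_box hR Y)).2 _ (h₂.mem_box hR Y) δ (hδ Y)
    have base : ∀ (f : ℝ × ℝ × ℝ → ℝ) (Cf Cf' : ℝ), Measurable f → 0 ≤ Cf → Cf ≤ A → Cw * Cf ≤ A →
        (∀ p ∈ Box R, |f p| ≤ Cf * siz p ∧
          ∀ q ∈ Box R, ∀ δ, Near δ p q → |f p - f q| ≤ Cf * gap δ p q) →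
        (∀ p ∈ Box R, |f p| ≤ Cf') → ∀ S : Set ℝ,
        |(∫ Y' in S, kern l v₁ ξ₁ Y Y' * f (trip u₁ v₁ ξ₁ Y')) -
          ∫ Y' in S, kern l v₂ ξ₂ Y Y' * f (trip u₂ v₂ ξ₂ Y')| ≤ C₀ * expConv (α / 2) m Y := by
      intro f Cf Cf' hf hCf hCA hCA' hS hb S
      have := hw1.abs_setIntegral_sub_le hw2 hα hD (h₁.meas_trip hf) (h₂.meas_trip hf)
        (fun Y => hb _ (h₁.mem_box hR Y)) (fun Y => hb _ (h₂.mem_box hR Y)) hB (A := A)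
        (fun Y => ((hS _ (h₁.mem_box hR Y)).2 _ (h₂.mem_box hR Y) δ (hδ Y)).trans
          (mul_le_mul_of_nonneg_right hCA (hm0 Y)))
        (fun Y => by
          have i1 := (hS _ (h₁.mem_box hR Y)).1
          have i2 := mul_siz_le_gap δ (trip u₁ v₁ ξ₁ Y) (trip u₂ v₂ ξ₂ Y)
          calc Cw * δ * |f (trip u₁ v₁ ξ₁ Y)| ≤ Cw * δ * (Cf * siz (trip u₁ v₁ ξ₁ Y)) := by gcongr
            _ = Cw * Cf * (δ * siz (trip u₁ v₁ ξ₁ Y)) := by ring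
            _ ≤ Cw * Cf * m Y := by gcongr
            _ ≤ A * m Y := mul_le_mul_of_nonneg_right hCA' (hm0 Y)) S Y
      rw [hC₀, hK]
      exact this
    have bP := base (densPF l) CP CP' (measurable_densPF l) hCP
      (by rw [hA]; linarith [mul_nonneg hCw hCP, mul_nonneg hCw hCQ])
      (by rw [hA]; linarith [mul_nonneg hCw hCP, mul_nonneg hCw hCQ]) hP (fun p hp => (hP' p hp).1)
    have bQ := base (densQF l) CQ CQ' (measurable_densQF l) hCQ
      (by rw [hA]; linarith [mul_nonneg hCw hCP, mul_nonneg hCw hCQ])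
      (by rw [hA]; linarith [mul_nonneg hCw hCP, mul_nonneg hCw hCQ]) hQ (fun p hp => (hQ' p hp).1)
    have cP := comb' _ _ _ _ _ (bP (Ioi Y)) (bP (Iic Y)) hE
    have cQ := comb' _ _ _ _ _ (bQ (Ioi Y)) (bQ (Iic Y)) hE
    have sP1 := hw1.potR_add_potL hα (h₁.meas_trip (measurable_densPF l))
      (fun Y => (hP' _ (h₁.mem_box hR Y)).1) Y
    have sQ1 := hw1.potR_add_potL hα (h₁.meas_trip (measurable_densQF l))
      (fun Y => (hQ' _ (h₁.mem_box hR Y)).1) Y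
    have sP2 := hw2.potR_add_potL hα (h₂.meas_trip (measurable_densPF l))
      (fun Y => (hP' _ (h₂.mem_box hR Y)).1) Y
    have sQ2 := hw2.potR_add_potL hα (h₂.meas_trip (measurable_densQF l))
      (fun Y => (hQ' _ (h₂.mem_box hR Y)).1) Y
    have eP1 : P l u₁ v₁ ξ₁ Y = 1 / 2 * (_ + _) := congrArg (1 / 2 * ·) sP1
    have eP2 : P l u₂ v₂ ξ₂ Y = 1 / 2 * (_ + _) := congrArg (1 / 2 * ·) sP2
    have eQ1 : Q l u₁ v₁ ξ₁ Y = (l : ℝ) / 4 * (_ + _) := congrArg ((l : ℝ) / 4 * ·) sQ1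
    have eQ2 : Q l u₂ v₂ ξ₂ Y = (l : ℝ) / 4 * (_ + _) := congrArg ((l : ℝ) / 4 * ·) sQ2
    refine ⟨?_, cP.1.2, ?_, cQ.2.2⟩
    · simp only [eP1, eP2]
      exact cP.1.1
    · simp only [eQ1, eQ2]
      exact cQ.2.1

/-- The four components of the right-hand side satisfy a pointwise predicate. -/
def AllRhs (l : ℕ) (p : (ℝ → ℝ) → Prop) (u v ξ : ℝ → ℝ) : Prop :=
  p (rhsU l u v ξ) ∧ p (rhsV l u v ξ) ∧ p (rhsXi l u v ξ) ∧ p (rhsW l u v ξ)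

/-- The four components of the difference of right-hand sides satisfy a pointwise predicate. -/
def AllRhsSub (l : ℕ) (p : (ℝ → ℝ) → Prop) (u₁ v₁ ξ₁ u₂ v₂ ξ₂ : ℝ → ℝ) : Prop :=
  p (fun Y => rhsU l u₁ v₁ ξ₁ Y - rhsU l u₂ v₂ ξ₂ Y) ∧
  p (fun Y => rhsV l u₁ v₁ ξ₁ Y - rhsV l u₂ v₂ ξ₂ Y) ∧
  p (fun Y => rhsXi l u₁ v₁ ξ₁ Y - rhsXi l u₂ v₂ ξ₂ Y) ∧
  p (fun Y => rhsW l u₁ v₁ ξ₁ Y - rhsW l u₂ v₂ ξ₂ Y)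

theorem exists_rhs_bound (l : ℕ) {R : ℝ} (hR : 0 < R) : ∃ C α : ℝ, 0 ≤ C ∧ 0 < α ∧
    (∀ u v ξ, Adm R u v ξ → ∀ B, Bd B (fun Y => siz (trip u v ξ Y)) → ∀ Y,
      AllRhs l (fun h => |h Y| ≤
        C * (siz (trip u v ξ Y) + expConv α (fun Y => siz (trip u v ξ Y)) Y)) u v ξ) ∧
    (∀ u₁ v₁ ξ₁ u₂ v₂ ξ₂, Adm R u₁ v₁ ξ₁ → Adm R u₂ v₂ ξ₂ → ∀ δ,
      (∀ Y, Near δ (trip u₁ v₁ ξ₁ Y) (trip u₂ v₂ ξ₂ Y)) → ∀ B,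
      Bd B (fun Y => siz (trip u₁ v₁ ξ₁ Y)) →
      Bd B (fun Y => gap δ (trip u₁ v₁ ξ₁ Y) (trip u₂ v₂ ξ₂ Y)) → ∀ Y,
      AllRhsSub l (fun h => |h Y| ≤ C * (gap δ (trip u₁ v₁ ξ₁ Y) (trip u₂ v₂ ξ₂ Y) +
        expConv α (fun Y => gap δ (trip u₁ v₁ ξ₁ Y) (trip u₂ v₂ ξ₂ Y)) Y))
        u₁ v₁ ξ₁ u₂ v₂ ξ₂) := by
  obtain ⟨C₀, α, hC₀, hα, hb, hd⟩ := exists_pots_bound l hR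
  obtain ⟨Ca, hCa, ha⟩ := isS_localVF l R
  obtain ⟨Cb, hCb, hb'⟩ := isS_localXiF l R
  obtain ⟨Cc, hCc, hc⟩ := isS_densPF l R
  obtain ⟨Da, hDa, da⟩ := isM_coefVF R
  obtain ⟨Db, hDb, db⟩ := (isS_coefXiF l).isM R
  obtain ⟨Dc, hDc, dc⟩ := isM_weightF l R
  set C : ℝ := Ca + Cb + Cc + 4 * C₀ * (1 + Da + Db + Dc) with hC
  have hC0 : 0 ≤ C := by positivity
  have p1 := mul_nonneg hC₀ hDa
  have p2 := mul_nonneg hC₀ hDb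
  have p3 := mul_nonneg hC₀ hDc
  refine ⟨C, α, hC0, hα, ?_, ?_⟩
  · intro u v ξ h B hB Y
    obtain ⟨b1, b2, b3, b4⟩ := hb u v ξ h B hB Y
    set E := expConv α (fun Y => siz (trip u v ξ Y)) Y with hE
    have hE0 : 0 ≤ E := expConv_nonneg (fun Y => siz_nonneg _) Y
    have hs := siz_nonneg (trip u v ξ Y)
    have hW : |P l u v ξ Y + Qx l u v ξ Y| ≤ 2 * C₀ * E := by
      refine (abs_add_le _ _).trans ?_; linarith
    have gen : ∀ (a b : ℝ × ℝ × ℝ → ℝ) (A D : ℝ), 0 ≤ A → 0 ≤ D → A ≤ C → 2 * C₀ * D ≤ C →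
        |a (trip u v ξ Y)| ≤ A * siz (trip u v ξ Y) → |b (trip u v ξ Y)| ≤ D →
        |a (trip u v ξ Y) - b (trip u v ξ Y) * (P l u v ξ Y + Qx l u v ξ Y)| ≤
          C * (siz (trip u v ξ Y) + E) := by
      intro a b A D hA hD hAC hDC h1 h2
      refine (abs_sub _ _).trans ?_
      rw [abs_mul]
      have i1 := mul_le_mul h2 hW (abs_nonneg _) hD
      have i2 := mul_le_mul_of_nonneg_right hAC hs
      have i3 := mul_le_mul_of_nonneg_right hDC hE0
      linarith
    have hm := h.mem_box hR Y
    refine ⟨?_, ?_, ?_, ?_⟩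
    · have : |rhsU l u v ξ Y| ≤ 2 * C₀ * E := by
        unfold rhsU
        refine (abs_sub _ _).trans ?_
        rw [abs_neg]; linarith
      have i1 : 2 * C₀ * E ≤ C * E := mul_le_mul_of_nonneg_right (by rw [hC]; linarith) hE0
      have i2 := mul_nonneg hC0 hs
      linarith
    · exact gen _ _ Ca Da hCa hDa (by rw [hC]; linarith) (by rw [hC]; linarith) (ha _ hm).1 (da _ hm).1
    · exact gen _ _ Cb Db hCb hDb (by rw [hC]; linarith) (by rw [hC]; linarith) (hb' _ hm).1 (db _ hm).1
    · exact gen _ _ Cc Dc hCc hDc (by rw [hC]; linarith) (by rw [hC]; linarith) (hc _ hm).1 (dc _ hm).1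
  · intro u₁ v₁ ξ₁ u₂ v₂ ξ₂ h₁ h₂ δ hδ B hBs hB Y
    obtain ⟨b1, b2, b3, b4⟩ := hb _ _ _ h₁ B hBs Y
    obtain ⟨d1, d2, d3, d4⟩ := hd _ _ _ _ _ _ h₁ h₂ δ hδ B hB Y
    have hδ0 : 0 ≤ δ := (hδ 0).nonneg
    set E := expConv α (fun Y => gap δ (trip u₁ v₁ ξ₁ Y) (trip u₂ v₂ ξ₂ Y)) Y with hE
    have hE0 : 0 ≤ E := expConv_nonneg (fun Y => gap_nonneg hδ0 _ _) Y
    have hs := gap_nonneg hδ0 (trip u₁ v₁ ξ₁ Y) (trip u₂ v₂ ξ₂ Y)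
    have hW : |P l u₁ v₁ ξ₁ Y + Qx l u₁ v₁ ξ₁ Y - (P l u₂ v₂ ξ₂ Y + Qx l u₂ v₂ ξ₂ Y)| ≤
        2 * C₀ * E := by
      rw [add_sub_add_comm]
      refine (abs_add_le _ _).trans ?_; linarith
    have hδE : δ * expConv α (fun Y => siz (trip u₁ v₁ ξ₁ Y)) Y ≤ E := by
      rw [← expConv_const_mul]
      exact expConv_mono hα (hBs.const_mul hδ0) hB (fun Y => mul_siz_le_gap _ _ _) Y
    have hW1 : δ * |P l u₁ v₁ ξ₁ Y + Qx l u₁ v₁ ξ₁ Y| ≤ 2 * C₀ * E := by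
      calc δ * |P l u₁ v₁ ξ₁ Y + Qx l u₁ v₁ ξ₁ Y|
          ≤ δ * (2 * C₀ * expConv α (fun Y => siz (trip u₁ v₁ ξ₁ Y)) Y) := by
            refine mul_le_mul_of_nonneg_left ((abs_add_le _ _).trans ?_) hδ0
            linarith
        _ = 2 * C₀ * (δ * expConv α (fun Y => siz (trip u₁ v₁ ξ₁ Y)) Y) := by ring
        _ ≤ _ := by gcongr
    have gen : ∀ (a b : ℝ × ℝ × ℝ → ℝ) (A D : ℝ), 0 ≤ A → 0 ≤ D → A ≤ C → 4 * C₀ * D ≤ C →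
        |a (trip u₁ v₁ ξ₁ Y) - a (trip u₂ v₂ ξ₂ Y)| ≤
          A * gap δ (trip u₁ v₁ ξ₁ Y) (trip u₂ v₂ ξ₂ Y) →
        |b (trip u₂ v₂ ξ₂ Y)| ≤ D → |b (trip u₁ v₁ ξ₁ Y) - b (trip u₂ v₂ ξ₂ Y)| ≤ D * δ →
        |(a (trip u₁ v₁ ξ₁ Y) - b (trip u₁ v₁ ξ₁ Y) * (P l u₁ v₁ ξ₁ Y + Qx l u₁ v₁ ξ₁ Y)) -
          (a (trip u₂ v₂ ξ₂ Y) - b (trip u₂ v₂ ξ₂ Y) * (P l u₂ v₂ ξ₂ Y + Qx l u₂ v₂ ξ₂ Y))| ≤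
          C * (gap δ (trip u₁ v₁ ξ₁ Y) (trip u₂ v₂ ξ₂ Y) + E) := by
      intro a b A D hA hD hAC hDC h1 h2 h3
      have e : (a (trip u₁ v₁ ξ₁ Y) - b (trip u₁ v₁ ξ₁ Y) * (P l u₁ v₁ ξ₁ Y + Qx l u₁ v₁ ξ₁ Y)) -
          (a (trip u₂ v₂ ξ₂ Y) - b (trip u₂ v₂ ξ₂ Y) * (P l u₂ v₂ ξ₂ Y + Qx l u₂ v₂ ξ₂ Y)) =
          (a (trip u₁ v₁ ξ₁ Y) - a (trip u₂ v₂ ξ₂ Y)) -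
          ((b (trip u₁ v₁ ξ₁ Y) - b (trip u₂ v₂ ξ₂ Y)) * (P l u₁ v₁ ξ₁ Y + Qx l u₁ v₁ ξ₁ Y) +
          b (trip u₂ v₂ ξ₂ Y) * (P l u₁ v₁ ξ₁ Y + Qx l u₁ v₁ ξ₁ Y -
            (P l u₂ v₂ ξ₂ Y + Qx l u₂ v₂ ξ₂ Y))) := by ring
      rw [e]
      refine (abs_sub _ _).trans ?_
      have i0 := abs_add_le ((b (trip u₁ v₁ ξ₁ Y) - b (trip u₂ v₂ ξ₂ Y)) *
        (P l u₁ v₁ ξ₁ Y + Qx l u₁ v₁ ξ₁ Y)) (b (trip u₂ v₂ ξ₂ Y) *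
          (P l u₁ v₁ ξ₁ Y + Qx l u₁ v₁ ξ₁ Y - (P l u₂ v₂ ξ₂ Y + Qx l u₂ v₂ ξ₂ Y)))
      rw [abs_mul, abs_mul] at i0
      have i1 := mul_le_mul h2 hW (abs_nonneg _) hD
      have i2 := mul_le_mul_of_nonneg_right hAC hs
      have i3 := mul_le_mul_of_nonneg_right hDC hE0
      have i4 := mul_le_mul_of_nonneg_right h3 (abs_nonneg (P l u₁ v₁ ξ₁ Y + Qx l u₁ v₁ ξ₁ Y))
      have i5 := mul_le_mul_of_nonneg_left hW1 hD
      linarith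
    have m1 := h₁.mem_box hR Y
    have m2 := h₂.mem_box hR Y
    refine ⟨?_, ?_, ?_, ?_⟩
    · have : |rhsU l u₁ v₁ ξ₁ Y - rhsU l u₂ v₂ ξ₂ Y| ≤ 2 * C₀ * E := by
        unfold rhsU
        have e : -Px l u₁ v₁ ξ₁ Y - Q l u₁ v₁ ξ₁ Y - (-Px l u₂ v₂ ξ₂ Y - Q l u₂ v₂ ξ₂ Y) =
          -(Px l u₁ v₁ ξ₁ Y - Px l u₂ v₂ ξ₂ Y) - (Q l u₁ v₁ ξ₁ Y - Q l u₂ v₂ ξ₂ Y) := by ring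
        rw [e]
        refine (abs_sub _ _).trans ?_
        rw [abs_neg]; linarith
      have i1 : 2 * C₀ * E ≤ C * E := mul_le_mul_of_nonneg_right (by rw [hC]; linarith) hE0
      have i2 := mul_nonneg hC0 hs
      linarith
    · exact gen _ _ Ca Da hCa hDa (by rw [hC]; linarith) (by rw [hC]; linarith)
        ((ha _ m1).2 _ m2 δ (hδ Y)) (da _ m2).1 ((da _ m1).2 _ m2 δ (hδ Y))
    · exact gen _ _ Cb Db hCb hDb (by rw [hC]; linarith) (by rw [hC]; linarith)
        ((hb' _ m1).2 _ m2 δ (hδ Y)) (db _ m2).1 ((db _ m1).2 _ m2 δ (hδ Y))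
    · exact gen _ _ Cc Dc hCc hDc (by rw [hC]; linarith) (by rw [hC]; linarith)
        ((hc _ m1).2 _ m2 δ (hδ Y)) (dc _ m2).1 ((dc _ m1).2 _ m2 δ (hδ Y))

theorem Bd.siz {D : ℝ} {u v : ℝ → ℝ} (hu : Bd D u) (hv : Bd D v) (ξ : ℝ → ℝ) :
    Bd (2 * D) fun Y => siz (trip u v ξ Y) :=
  (hu.abs.add hv.abs).mono (by linarith)

theorem Bd.gap {D δ : ℝ} {u₁ v₁ ξ₁ u₂ v₂ ξ₂ : ℝ → ℝ} (hu : Bd D u₁) (hv : Bd D v₁)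
    (hδ : 0 ≤ δ) (hdu : Bd δ fun Y => u₁ Y - u₂ Y) (hdv : Bd δ fun Y => v₁ Y - v₂ Y) :
    Bd (2 * δ * (1 + D)) fun Y => gap δ (trip u₁ v₁ ξ₁ Y) (trip u₂ v₂ ξ₂ Y) :=
  ((hdu.abs.add hdv.abs).add ((hu.siz hv ξ₁).const_mul hδ)).mono (by linarith)

theorem exists_rhs_Bd (l : ℕ) {R : ℝ} (hR : 0 < R) : ∃ C : ℝ, 0 ≤ C ∧
    (∀ u v ξ, Adm R u v ξ → ∀ D, Bd D u → Bd D v → AllRhs l (Bd (C * D)) u v ξ) ∧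
    (∀ u₁ v₁ ξ₁ u₂ v₂ ξ₂, Adm R u₁ v₁ ξ₁ → Adm R u₂ v₂ ξ₂ → ∀ δ D,
      (∀ Y, Near δ (trip u₁ v₁ ξ₁ Y) (trip u₂ v₂ ξ₂ Y)) → Bd D u₁ → Bd D v₁ →
      (Bd δ fun Y => u₁ Y - u₂ Y) → (Bd δ fun Y => v₁ Y - v₂ Y) →
      AllRhsSub l (Bd (C * (δ * (1 + D)))) u₁ v₁ ξ₁ u₂ v₂ ξ₂) := by
  obtain ⟨C, α, hC, hα, hb, hd⟩ := exists_rhs_bound l hR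
  have hM := expMass_nonneg α
  refine ⟨C * (2 * (1 + expMass α)), by positivity, ?_, ?_⟩
  · intro u v ξ h D hu hv
    have hs := hu.siz hv ξ
    have key : Bd (C * (2 * (1 + expMass α)) * D)
        fun Y => C * (siz (trip u v ξ Y) + expConv α (fun Y => siz (trip u v ξ Y)) Y) :=
      ((hs.add (hs.expConv hα)).const_mul hC).mono (le_of_eq (by ring))
    obtain ⟨m1, m2, m3, m4⟩ := measurable_rhs l h.meas_u h.meas_v h.meas_xi (h.abs_xi_le hR)
    have := hb u v ξ h _ hs
    exact ⟨key.of_le m1 fun Y => ((this Y).1).trans (le_abs_self _),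
      key.of_le m2 fun Y => ((this Y).2.1).trans (le_abs_self _),
      key.of_le m3 fun Y => ((this Y).2.2.1).trans (le_abs_self _),
      key.of_le m4 fun Y => ((this Y).2.2.2).trans (le_abs_self _)⟩
  · intro u₁ v₁ ξ₁ u₂ v₂ ξ₂ h₁ h₂ δ D hδ hu hv hdu hdv
    have hδ0 : 0 ≤ δ := (hδ 0).nonneg
    have hs := hu.siz hv ξ₁
    have hg := hu.gap hv hδ0 hdu hdv (ξ₁ := ξ₁) (ξ₂ := ξ₂)
    have key : Bd (C * (2 * (1 + expMass α)) * (δ * (1 + D)))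
        fun Y => C * (gap δ (trip u₁ v₁ ξ₁ Y) (trip u₂ v₂ ξ₂ Y) +
          expConv α (fun Y => gap δ (trip u₁ v₁ ξ₁ Y) (trip u₂ v₂ ξ₂ Y)) Y) :=
      ((hg.add (hg.expConv hα)).const_mul hC).mono (le_of_eq (by ring))
    obtain ⟨m1, m2, m3, m4⟩ := measurable_rhs l h₁.meas_u h₁.meas_v h₁.meas_xi (h₁.abs_xi_le hR)
    obtain ⟨n1, n2, n3, n4⟩ := measurable_rhs l h₂.meas_u h₂.meas_v h₂.meas_xi (h₂.abs_xi_le hR)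
    have := hd _ _ _ _ _ _ h₁ h₂ δ hδ _ (hs.mono (le_max_left _ _)) (hg.mono (le_max_right _ _))
    exact ⟨key.of_le (m1.sub n1) fun Y => ((this Y).1).trans (le_abs_self _),
      key.of_le (m2.sub n2) fun Y => ((this Y).2.1).trans (le_abs_self _),
      key.of_le (m3.sub n3) fun Y => ((this Y).2.2.1).trans (le_abs_self _),
      key.of_le (m4.sub n4) fun Y => ((this Y).2.2.2).trans (le_abs_self _)⟩

/-! ### The Banach space of bounded measurable square-integrable functions -/

/-- Bounded measurable square-integrable functions, as pairs of a bounded function and its class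
in `L²`. -/
def boundedL2 : Submodule ℝ (lp (fun _ : ℝ => ℝ) ∞ × Lp ℝ 2 (volume : Measure ℝ)) where
  carrier := {p | Measurable (fun Y => p.1 Y) ∧ (p.2 : ℝ → ℝ) =ᵐ[volume] fun Y => p.1 Y}
  add_mem' := by
    rintro p q ⟨hp, hp'⟩ ⟨hq, hq'⟩
    refine ⟨hp.add hq, ?_⟩
    filter_upwards [Lp.coeFn_add p.2 q.2, hp', hq'] with Y h1 h2 h3
    rw [Prod.snd_add, h1, Pi.add_apply, h2, h3]
    rfl
  zero_mem' := ⟨measurable_const, Lp.coeFn_zero _ _ _⟩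
  smul_mem' := by
    rintro c p ⟨hp, hp'⟩
    refine ⟨hp.const_mul c, ?_⟩
    filter_upwards [Lp.coeFn_smul c p.2, hp'] with Y h1 h2
    rw [Prod.smul_snd, h1, Pi.smul_apply, h2]
    rfl

theorem isClosed_boundedL2 :
    IsClosed (boundedL2 : Set (lp (fun _ : ℝ => ℝ) ∞ × Lp ℝ 2 (volume : Measure ℝ))) := by
  refine IsSeqClosed.isClosed fun p q hp hpq => ?_
  have h1 : Tendsto (fun n => (p n).1) atTop (𝓝 q.1) := (continuous_fst.tendsto _).comp hpq
  have h2 : Tendsto (fun n => (p n).2) atTop (𝓝 q.2) := (continuous_snd.tendsto _).comp hpq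
  have h3 : ∀ Y, Tendsto (fun n => (p n).1 Y) atTop (𝓝 (q.1 Y)) := fun Y => by
    rw [tendsto_iff_norm_sub_tendsto_zero] at h1 ⊢
    refine squeeze_zero (fun n => norm_nonneg _) (fun n => ?_) h1
    exact lp.norm_apply_le_norm (by simp) ((p n).1 - q.1) Y
  refine ⟨measurable_of_tendsto_metrizable (fun n => (hp n).1) (tendsto_pi_nhds.2 h3), ?_⟩
  obtain ⟨ns, hns, hae⟩ := (tendstoInMeasure_of_tendsto_Lp h2).exists_seq_tendsto_ae
  have h4 : ∀ᵐ Y, ∀ n, (p n).2 Y = (p n).1 Y := ae_all_iff.2 fun n => (hp n).2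
  filter_upwards [hae, h4] with Y hY h5
  simp_rw [h5] at hY
  exact tendsto_nhds_unique hY ((h3 Y).comp hns.tendsto_atTop)

/-- The Banach space of bounded measurable square-integrable functions. -/
abbrev BS : Type := boundedL2

instance : CompleteSpace BS := isClosed_boundedL2.completeSpace_coe

namespace BS

/-- The underlying function. -/
def fn (f : BS) (Y : ℝ) : ℝ := f.1.1 Y

@[simp] theorem fn_sub (f g : BS) (Y : ℝ) : (f - g).fn Y = f.fn Y - g.fn Y := rfl

@[simp] theorem fn_add (f g : BS) (Y : ℝ) : (f + g).fn Y = f.fn Y + g.fn Y := rfl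

theorem bd (f : BS) : Bd ‖f‖ f.fn := by
  refine ⟨f.2.1, fun Y => ?_, ?_⟩
  · exact (lp.norm_apply_le_norm (by simp) f.1.1 Y).trans (norm_fst_le f.1)
  · have h1 : eLpNorm f.fn 2 volume = ENNReal.ofReal ‖f.1.2‖ := by
      have h2 : eLpNorm f.fn 2 volume = eLpNorm f.1.2 2 volume := (eLpNorm_congr_ae f.2.2).symm
      rw [h2, Lp.norm_def, ENNReal.ofReal_toReal (Lp.eLpNorm_ne_top _)]
    rw [h1]
    exact ENNReal.ofReal_le_ofReal (norm_snd_le f.1)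

theorem norm_le {f : BS} {C : ℝ} (h : Bd C f.fn) : ‖f‖ ≤ C := by
  have h1 : ‖f.1.1‖ ≤ C := lp.norm_le_of_forall_le h.nonneg h.bound
  have h2 : ‖f.1.2‖ ≤ C := by
    rw [Lp.norm_def]
    refine ENNReal.toReal_le_of_le_ofReal h.nonneg ?_
    rw [eLpNorm_congr_ae f.2.2]
    exact h.l2
  exact max_le h1 h2

theorem exists_fn_eq {h : ℝ → ℝ} {C : ℝ} (hb : Bd C h) : ∃ f : BS, f.fn = h := by
  have hm : Memℓp h ∞ := memℓp_infty ⟨C, by rintro _ ⟨Y, rfl⟩; exact hb.bound Y⟩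
  exact ⟨⟨(⟨h, hm⟩, hb.memLp.toLp h), hb.meas, hb.memLp.coeFn_toLp⟩, rfl⟩

open Classical in
/-- The element with a given underlying function, or zero if there is none. -/
def mk (h : ℝ → ℝ) : BS := if hb : ∃ f : BS, f.fn = h then hb.choose else 0

theorem fn_mk {h : ℝ → ℝ} {C : ℝ} (hb : Bd C h) : (mk h).fn = h := by
  have := exists_fn_eq hb
  unfold mk
  rw [dif_pos this]
  exact this.choose_spec

/-- Evaluation at a point. -/
def evL (Y : ℝ) : BS →L[ℝ] ℝ :=
  LinearMap.mkContinuous { toFun := fun f => f.fn Y, map_add' := fun _ _ => rfl,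
                           map_smul' := fun _ _ => rfl } 1
    fun f => by rw [one_mul]; exact f.bd.bound Y

@[simp] theorem evL_apply (Y : ℝ) (f : BS) : evL Y f = f.fn Y := rfl

/-- Integration over a bounded interval. -/
def intL (a b : ℝ) : BS →L[ℝ] ℝ :=
  LinearMap.mkContinuous
    { toFun := fun f => ∫ Y in a..b, f.fn Y
      map_add' := fun f g => intervalIntegral.integral_add
        (LocallyIntegrable.ii (locallyIntegrable_of_bdd f.bd.meas f.bd.bound) a b)
        (LocallyIntegrable.ii (locallyIntegrable_of_bdd g.bd.meas g.bd.bound) a b)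
      map_smul' := fun c f => intervalIntegral.integral_const_mul c _ } |b - a|
    fun f => by
      rw [mul_comm]
      exact intervalIntegral.norm_integral_le_of_norm_le_const fun Y _ => f.bd.bound Y

@[simp] theorem intL_apply (a b : ℝ) (f : BS) : intL a b f = ∫ Y in a..b, f.fn Y := rfl

/-- The pointwise absolute value. -/
def absF (f : BS) : BS := mk fun Y => |f.fn Y|

@[simp] theorem fn_absF (f : BS) (Y : ℝ) : f.absF.fn Y = |f.fn Y| :=
  congrFun (fn_mk f.bd.abs) Y

theorem continuous_absF : Continuous absF := by
  refine LipschitzWith.continuous (K := 1) (LipschitzWith.of_dist_le_mul fun f g => ?_)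
  rw [dist_eq_norm, dist_eq_norm, NNReal.coe_one, one_mul]
  refine norm_le ((f - g).bd.of_le (f.absF - g.absF).bd.meas fun Y => ?_)
  simpa using abs_abs_sub_abs_le_abs_sub (f.fn Y) (g.fn Y)

end BS

/-! ### Global solutions of differential equations from a priori bounds -/

section AbstractODE

variable {E : Type*} [NormedAddCommGroup E] [NormedSpace ℝ E]

/-- A solution of `z' = F z` on `[0, T]` with initial value `x₀` that stays in one of the sets
`G R`. -/
structure IsSol (F : E → E) (G : ℝ → Set E) (x₀ : E) (T : ℝ) (z : ℝ → E) : Prop where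
  init : z 0 = x₀
  deriv : ∀ t ∈ Icc 0 T, HasDerivWithinAt z (F (z t)) (Icc 0 T) t
  mem : ∃ R, 0 < R ∧ ∀ t ∈ Icc 0 T, z t ∈ G R

variable {F : E → E} {G : ℝ → Set E} {x₀ : E}

theorem IsSol.restrict {T T' : ℝ} {z : ℝ → E} (h : IsSol F G x₀ T z) (hT : T' ≤ T) :
    IsSol F G x₀ T' z := by
  obtain ⟨R, hR, hm⟩ := h.mem
  exact ⟨h.init, fun t ht => (h.deriv t ⟨ht.1, ht.2.trans hT⟩).mono (Icc_subset_Icc_right hT),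
    R, hR, fun t ht => hm t ⟨ht.1, ht.2.trans hT⟩⟩

theorem IsSol.continuousOn {T : ℝ} {z : ℝ → E} (h : IsSol F G x₀ T z) :
    ContinuousOn z (Icc 0 T) := fun t ht => (h.deriv t ht).continuousWithinAt

theorem IsSol.eqOn (hmono : ∀ R R', 0 < R → R ≤ R' → G R ⊆ G R')
    (hLip : ∀ R, 0 < R → ∃ K, LipschitzOnWith K F (G R))
    {T : ℝ} {z z' : ℝ → E} (h : IsSol F G x₀ T z) (h' : IsSol F G x₀ T z') :
    EqOn z z' (Icc 0 T) := by
  obtain ⟨R, hR, hm⟩ := h.mem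
  obtain ⟨R', hR', hm'⟩ := h'.mem
  obtain ⟨K, hK⟩ := hLip (max R R') (lt_max_of_lt_left hR)
  have right : ∀ {y : ℝ → E}, IsSol F G x₀ T y → ∀ t ∈ Ico 0 T,
      HasDerivWithinAt y (F (y t)) (Ici t) t := fun hy t ht =>
    (hy.deriv t ⟨ht.1, ht.2.le⟩).mono_of_mem_nhdsWithin
      (mem_of_superset (Icc_mem_nhdsGE ht.2) (Icc_subset_Icc_left ht.1))
  exact ODE_solution_unique_of_mem_Icc_right (v := fun _ => F) (s := fun _ => G (max R R'))
    (fun _ _ => hK) h.continuousOn (right h)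
    (fun t ht => hmono _ _ hR (le_max_left _ _) (hm t ⟨ht.1, ht.2.le⟩)) h'.continuousOn (right h')
    (fun t ht => hmono _ _ hR' (le_max_right _ _) (hm' t ⟨ht.1, ht.2.le⟩)) (h.init.trans h'.init.symm)

theorem exists_local_solution [CompleteSpace E]
    (hLip : ∀ R, 0 < R → ∃ K, LipschitzOnWith K F (G R))
    (hbd : ∀ R, 0 < R → ∃ L, ∀ x ∈ G R, ‖F x‖ ≤ L)
    (hball : ∀ R, 0 < R → ∃ R' r, 0 < R' ∧ 0 < r ∧ ∀ x ∈ G R, Metric.closedBall x r ⊆ G R')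
    {R : ℝ} (hR : 0 < R) : ∃ δ R', 0 < δ ∧ 0 < R' ∧ ∀ x ∈ G R, ∃ α : ℝ → E, α 0 = x ∧
      ∀ t ∈ Icc 0 δ, HasDerivWithinAt α (F (α t)) (Icc 0 δ) t ∧ α t ∈ G R' := by
  obtain ⟨R', r, hR', hr, hsub⟩ := hball R hR
  obtain ⟨K, hK⟩ := hLip R' hR'
  obtain ⟨L, hL⟩ := hbd R' hR'
  set L' : NNReal := L.toNNReal with hL'
  have hδ : 0 < r / (L' + 1 : ℝ) := by positivity
  refine ⟨r / (L' + 1 : ℝ), R', hδ, hR', fun x hx => ?_⟩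
  set δ := r / (L' + 1 : ℝ) with hδd
  have hr' : ((r.toNNReal : NNReal) : ℝ) = r := Real.coe_toNNReal r hr.le
  have hpl : IsPicardLindelof (fun _ => F) (tmin := 0) (tmax := δ) ⟨0, left_mem_Icc.2 hδ.le⟩ x
      r.toNNReal 0 L' K := by
    refine IsPicardLindelof.of_time_independent (fun y hy => ?_) (hK.mono ?_) ?_
    · rw [hr'] at hy
      exact (hL y (hsub x hx hy)).trans (Real.le_coe_toNNReal L)
    · rw [hr']; exact hsub x hx
    · simp only [sub_zero, sub_self, hr', NNReal.coe_zero]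
      rw [max_eq_left hδ.le, hδd, mul_div_assoc', div_le_iff₀ (by positivity)]
      nlinarith [L'.coe_nonneg]
  have hxx : x ∈ Metric.closedBall x ((0 : NNReal) : ℝ) := Metric.mem_closedBall_self le_rfl
  obtain ⟨α, hα⟩ := ODE.FunSpace.exists_isFixedPt_next hpl hxx
  have hstay : ∀ t, α.compProj t ∈ Metric.closedBall x (r.toNNReal : ℝ) := fun t =>
    α.compProj_mem_closedBall hpl.mul_max_le
  refine ⟨α.compProj, ?_, fun t ht => ⟨?_, hsub x hx (by rw [← hr']; exact hstay t)⟩⟩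
  · have := ODE.FunSpace.compProj_val (α := α) (t := ⟨0, left_mem_Icc.2 hδ.le⟩)
    rw [this, ← hα, ODE.FunSpace.next_apply₀]
  · exact (ODE.hasDerivWithinAt_picard_Icc (left_mem_Icc.2 hδ.le) hpl.continuousOn_uncurry
      α.continuous_compProj.continuousOn (fun _ _ => hstay _) x ht).congr_of_mem
      (fun t' ht' => by
        nth_rw 1 [← hα]
        rw [ODE.FunSpace.compProj_of_mem ht', ODE.FunSpace.next_apply]) ht

theorem IsSol.extend (hmono : ∀ R R', 0 < R → R ≤ R' → G R ⊆ G R') {T δ R' : ℝ}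
    {z α : ℝ → E} (h : IsSol F G x₀ T z) (hT : 0 ≤ T) (hδ : 0 < δ) (hR' : 0 < R') (h0 : α 0 = z T)
    (hα : ∀ t ∈ Icc 0 δ, HasDerivWithinAt α (F (α t)) (Icc 0 δ) t ∧ α t ∈ G R') :
    ∃ z', IsSol F G x₀ (T + δ) z' := by
  obtain ⟨R, hR, hm⟩ := h.mem
  set z' : ℝ → E := fun t => if t ≤ T then z t else α (t - T) with hz'
  have e1 : ∀ t ∈ Icc 0 T, z' t = z t := fun t ht => if_pos ht.2
  have e2 : ∀ t ∈ Icc T (T + δ), z' t = α (t - T) := fun t ht => by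
    rcases eq_or_lt_of_le ht.1 with rfl | hlt
    · simp [hz', h0]
    · exact if_neg (not_le.2 hlt)
  have hU : Icc 0 (T + δ) = Icc 0 T ∪ Icc T (T + δ) :=
    (Icc_union_Icc_eq_Icc hT (by linarith)).symm
  have d1 : ∀ t ∈ Icc 0 T, HasDerivWithinAt z' (F (z' t)) (Icc 0 T) t := fun t ht => by
    rw [e1 t ht]; exact (h.deriv t ht).congr_of_mem e1 ht
  have d2 : ∀ t ∈ Icc T (T + δ), HasDerivWithinAt z' (F (z' t)) (Icc T (T + δ)) t := fun t ht => by
    rw [e2 t ht]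
    have h1 := (hα (t - T) ⟨by linarith [ht.1], by linarith [ht.2]⟩).1
    have h2 : HasDerivWithinAt (fun s : ℝ => s - T) 1 (Icc T (T + δ)) t :=
      ((hasDerivAt_id t).sub_const T).hasDerivWithinAt
    have h3 := h1.scomp t h2 (fun s (hs : s ∈ Icc T (T + δ)) =>
      (⟨by linarith [hs.1], by linarith [hs.2]⟩ : s - T ∈ Icc 0 δ))
    rw [one_smul] at h3
    exact h3.congr_of_mem e2 ht
  refine ⟨z', (e1 0 ⟨le_rfl, hT⟩).trans h.init, fun t ht => ?_, max R R', lt_max_of_lt_left hR,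
    fun t ht => ?_⟩
  · rw [hU]
    rcases lt_trichotomy t T with hlt | rfl | hlt
    · refine (d1 t ⟨ht.1, hlt.le⟩).mono_of_mem_nhdsWithin ?_
      refine mem_of_superset (inter_mem_nhdsWithin _ (Iio_mem_nhds hlt)) ?_
      rintro s ⟨hs | hs, hs'⟩
      · exact hs
      · exact absurd hs.1 (not_le.2 hs')
    · exact (d1 t ⟨ht.1, le_rfl⟩).union (d2 t ⟨le_rfl, ht.2⟩)
    · refine (d2 t ⟨hlt.le, ht.2⟩).mono_of_mem_nhdsWithin ?_
      refine mem_of_superset (inter_mem_nhdsWithin _ (Ioi_mem_nhds hlt)) ?_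
      rintro s ⟨hs | hs, hs'⟩
      · exact absurd hs.2 (not_le.2 hs')
      · exact hs
  · rcases le_total t T with hle | hle
    · rw [e1 t ⟨ht.1, hle⟩]
      exact hmono _ _ hR (le_max_left _ _) (hm t ⟨ht.1, hle⟩)
    · rw [e2 t ⟨hle, ht.2⟩]
      exact hmono _ _ hR' (le_max_right _ _) (hα _ ⟨by linarith, by linarith [ht.2]⟩).2

theorem exists_global_solution [CompleteSpace E]
    (hmono : ∀ R R', 0 < R → R ≤ R' → G R ⊆ G R')
    (hLip : ∀ R, 0 < R → ∃ K, LipschitzOnWith K F (G R))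
    (hbd : ∀ R, 0 < R → ∃ L, ∀ x ∈ G R, ‖F x‖ ≤ L)
    (hball : ∀ R, 0 < R → ∃ R' r, 0 < R' ∧ 0 < r ∧ ∀ x ∈ G R, Metric.closedBall x r ⊆ G R')
    (hx₀ : ∃ R, 0 < R ∧ x₀ ∈ G R)
    (apriori : ∀ T₁, 0 ≤ T₁ → ∃ R, 0 < R ∧ ∀ T ∈ Icc 0 T₁, ∀ z, IsSol F G x₀ T z →
      ∀ t ∈ Icc 0 T, z t ∈ G R) :
    ∃ z : ℝ → E, z 0 = x₀ ∧ (∀ t, 0 ≤ t → HasDerivWithinAt z (F (z t)) (Ici 0) t) ∧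
      ∀ T, 0 ≤ T → IsSol F G x₀ T z := by
  have step : ∀ T₁, 0 ≤ T₁ → ∃ z, IsSol F G x₀ T₁ z := by
    intro T₁ hT₁
    obtain ⟨R, hR, hap⟩ := apriori T₁ hT₁
    obtain ⟨δ, R', hδ, hR', hloc⟩ := exists_local_solution hLip hbd hball hR
    have ind : ∀ n : ℕ, ∃ z, IsSol F G x₀ (min (n * δ) T₁) z := by
      intro n
      induction n with
      | zero =>
        obtain ⟨R₀, hR₀, hm⟩ := hx₀
        refine ⟨fun _ => x₀, rfl, fun t ht => ?_, R₀, hR₀, fun _ _ => hm⟩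
        have ht0 : t = 0 := le_antisymm (by simpa using ht.2.trans (min_le_left _ _)) ht.1
        have hs : Icc 0 (min (((0 : ℕ) : ℝ) * δ) T₁) \ {t} = ∅ := by
          rw [ht0]; simp [hT₁]
        rw [← hasDerivWithinAt_sdiff_singleton, hs]
        simp [hasDerivWithinAt_iff_tendsto_slope]
      | succ n ih =>
        obtain ⟨z, hz⟩ := ih
        have hn : 0 ≤ min ((n : ℝ) * δ) T₁ := le_min (by positivity) hT₁
        have hmem := hap _ ⟨hn, min_le_right _ _⟩ z hz _ (right_mem_Icc.2 hn)
        obtain ⟨α, h0, hα⟩ := hloc _ hmem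
        obtain ⟨z', hz'⟩ := hz.extend hmono hn hδ hR' h0 hα
        refine ⟨z', hz'.restrict ?_⟩
        push_cast
        rcases le_total ((n : ℝ) * δ) T₁ with h | h
        · rw [min_eq_left h]; exact (min_le_left _ _).trans (by linarith)
        · rw [min_eq_right h]; exact (min_le_right _ _).trans (by linarith)
    obtain ⟨n, hn⟩ := exists_nat_ge (T₁ / δ)
    obtain ⟨z, hz⟩ := ind n
    rw [min_eq_right ((div_le_iff₀ hδ).1 hn)] at hz
    exact ⟨z, hz⟩
  choose Z hZ using fun n : ℕ => step (n + 1) (by positivity)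
  have hagree : ∀ (n : ℕ) (t : ℝ), 0 ≤ t → t ≤ n + 1 → Z ⌈t⌉₊ t = Z n t := fun n t h0 ht => by
    have hc : t ≤ (⌈t⌉₊ : ℝ) + 1 := (Nat.le_ceil t).trans (by linarith)
    exact ((hZ ⌈t⌉₊).restrict hc).eqOn hmono hLip ((hZ n).restrict ht) (right_mem_Icc.2 h0)
  have hd : ∀ (n : ℕ), ∀ t ∈ Icc (0 : ℝ) (n + 1), HasDerivWithinAt (fun t => Z ⌈t⌉₊ t)
      (F (Z ⌈t⌉₊ t)) (Icc 0 (n + 1)) t := fun n t ht => by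
    rw [hagree n t ht.1 ht.2]
    exact ((hZ n).deriv t ht).congr_of_mem (fun s hs => hagree n s hs.1 hs.2) ht
  have hinit : Z ⌈(0 : ℝ)⌉₊ 0 = x₀ := (hZ _).init
  refine ⟨fun t => Z ⌈t⌉₊ t, hinit, fun t ht => ?_, fun T hT => ?_⟩
  · refine (hd ⌈t⌉₊ t ⟨ht, (Nat.le_ceil t).trans (by linarith)⟩).mono_of_mem_nhdsWithin ?_
    have hlt : t < (⌈t⌉₊ : ℝ) + 1 := (Nat.le_ceil t).trans_lt (by linarith)
    exact mem_of_superset (inter_mem_nhdsWithin _ (Iio_mem_nhds hlt)) fun s hs => ⟨hs.1, hs.2.le⟩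
  · have hTc : T ≤ (⌈T⌉₊ : ℝ) + 1 := (Nat.le_ceil T).trans (by linarith)
    obtain ⟨R, hR, hm⟩ := (hZ ⌈T⌉₊).mem
    have : IsSol F G x₀ ((⌈T⌉₊ : ℝ) + 1) fun t => Z ⌈t⌉₊ t :=
      ⟨hinit, hd _, R, hR, fun t ht => by rw [hagree ⌈T⌉₊ t ht.1 ht.2]; exact hm t ht⟩
    exact this.restrict hTc

end AbstractODE

/-! ### The vector field -/

/-- States `(u, v, ξ - 1, w)`, where `w` will be the derivative of `u`. -/
abbrev St : Type := BS × BS × BS × BS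

namespace St

def u (z : St) : ℝ → ℝ := z.1.fn
def v (z : St) : ℝ → ℝ := z.2.1.fn
def xi (z : St) (Y : ℝ) : ℝ := 1 + z.2.2.1.fn Y
def w (z : St) : ℝ → ℝ := z.2.2.2.fn

theorem norm_u (z : St) : ‖z.1‖ ≤ ‖z‖ := norm_fst_le z
theorem norm_v (z : St) : ‖z.2.1‖ ≤ ‖z‖ := (norm_fst_le z.2).trans (norm_snd_le z)
theorem norm_eta (z : St) : ‖z.2.2.1‖ ≤ ‖z‖ :=
  (norm_fst_le z.2.2).trans ((norm_snd_le z.2).trans (norm_snd_le z))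
theorem norm_w (z : St) : ‖z.2.2.2‖ ≤ ‖z‖ :=
  (norm_snd_le z.2.2).trans ((norm_snd_le z.2).trans (norm_snd_le z))

theorem norm_le {z : St} {C : ℝ} (h1 : ‖z.1‖ ≤ C) (h2 : ‖z.2.1‖ ≤ C) (h3 : ‖z.2.2.1‖ ≤ C)
    (h4 : ‖z.2.2.2‖ ≤ C) : ‖z‖ ≤ C :=
  max_le h1 (max_le h2 (max_le h3 h4))

theorem bd_u (z : St) : Bd ‖z‖ z.u := z.1.bd.mono z.norm_u
theorem bd_v (z : St) : Bd ‖z‖ z.v := z.2.1.bd.mono z.norm_v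
theorem bd_w (z : St) : Bd ‖z‖ z.w := z.2.2.2.bd.mono z.norm_w
theorem bd_eta (z : St) : Bd ‖z‖ fun Y => z.xi Y - 1 := by
  have : (fun Y => z.xi Y - 1) = z.2.2.1.fn := by ext Y; simp [xi]
  rw [this]; exact z.2.2.1.bd.mono z.norm_eta

/-- States of norm at most `R` with `ξ ≥ 1 / R`. -/
def good (R : ℝ) : Set St := {z | ‖z‖ ≤ R ∧ ∀ Y, 1 / R ≤ z.xi Y}

theorem good_mono (R R' : ℝ) (hR : 0 < R) (h : R ≤ R') : good R ⊆ good R' := fun _ hz =>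
  ⟨hz.1.trans h, fun Y => (one_div_le_one_div_of_le hR h).trans (hz.2 Y)⟩

theorem good_ball (R : ℝ) (hR : 0 < R) : ∃ R' r, 0 < R' ∧ 0 < r ∧
    ∀ z ∈ good R, Metric.closedBall z r ⊆ good R' := by
  refine ⟨2 * R + 1 / (2 * R), 1 / (2 * R), by positivity, by positivity, fun z hz y hy => ?_⟩
  rw [Metric.mem_closedBall, dist_eq_norm] at hy
  refine ⟨?_, fun Y => ?_⟩
  · have := norm_add_le (y - z) z
    rw [sub_add_cancel] at this
    linarith [hz.1]
  · have h1 := ((y - z).bd_eta).bound Y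
    have h2 : (y - z).xi Y - 1 = y.xi Y - z.xi Y := by
      show 1 + (y.2.2.1 - z.2.2.1).fn Y - 1 = _
      simp [xi]
    rw [h2] at h1
    have h3 := (abs_le.1 (h1.trans hy)).1
    have h4 : 1 / (2 * R + 1 / (2 * R)) ≤ 1 / (2 * R) :=
      one_div_le_one_div_of_le (by positivity) (le_add_of_nonneg_right (by positivity))
    have h5 : 1 / R = 1 / (2 * R) + 1 / (2 * R) := by field_simp; norm_num
    linarith [hz.2 Y]

end St

theorem volume_bad_le {v : ℝ → ℝ} {D : ℝ} (hv : Bd D v) :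
    volume {Y | Real.cos (v Y / 2) ^ 2 < 1 / 2} ≤ ENNReal.ofReal (D ^ 2) := by
  have hsub : {Y | Real.cos (v Y / 2) ^ 2 < 1 / 2} ⊆ {Y | (1 : ℝ≥0∞) ≤ ‖v Y‖ₑ} := by
    intro Y hY
    simp only [mem_ofPred_eq] at hY ⊢
    have h1 := Real.sin_sq_add_cos_sq (v Y / 2)
    have h2 : Real.sin (v Y / 2) ^ 2 ≤ (v Y / 2) ^ 2 := sq_le_sq.2 Real.abs_sin_le_abs
    have h3 : 1 ≤ |v Y| := by
      by_contra h
      push Not at h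
      have := (sq_lt_one_iff_abs_lt_one (v Y)).2 h
      nlinarith
    rw [Real.enorm_eq_ofReal_abs, ← ENNReal.ofReal_one]
    exact ENNReal.ofReal_le_ofReal h3
  refine (measure_mono hsub).trans ?_
  refine (meas_ge_le_mul_pow_eLpNorm_enorm volume two_ne_zero ENNReal.ofNat_ne_top
    hv.meas.aestronglyMeasurable one_ne_zero (by simp)).trans ?_
  simp only [inv_one, ENNReal.toReal_ofNat, ENNReal.one_rpow, one_mul]
  rw [ENNReal.ofReal_pow hv.nonneg]
  have := ENNReal.rpow_le_rpow hv.l2 (show (0 : ℝ) ≤ 2 by norm_num)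
  simpa using this

theorem St.adm {R : ℝ} (hR : 0 < R) {z : St} (hz : z ∈ St.good R) :
    Adm (1 + R + R ^ 2) z.u z.v z.xi := by
  have h2 : 0 < R ^ 2 := by positivity
  refine ⟨z.bd_u.meas, z.bd_v.meas, measurable_const.add z.2.2.1.bd.meas,
    fun Y => ((z.bd_u.bound Y).trans hz.1).trans (by linarith),
    fun Y => ((z.bd_v.bound Y).trans hz.1).trans (by linarith), fun Y => ?_,
    fun Y => (one_div_le_one_div_of_le hR (by linarith)).trans (hz.2 Y), ?_⟩
  · have := (abs_le.1 ((z.bd_eta.bound Y).trans hz.1)).2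
    linarith
  · refine (volume_bad_le (z.bd_v.mono hz.1)).trans (ENNReal.ofReal_le_ofReal (by linarith))

/-- The vector field of the extended system. -/
def field (l : ℕ) (z : St) : St :=
  (BS.mk (rhsU l z.u z.v z.xi), BS.mk (rhsV l z.u z.v z.xi), BS.mk (rhsXi l z.u z.v z.xi),
    BS.mk (rhsW l z.u z.v z.xi))

theorem field_fn (l : ℕ) {R : ℝ} (hR : 0 < R) {z : St} (hz : z ∈ St.good R) :
    (field l z).1.fn = rhsU l z.u z.v z.xi ∧ (field l z).2.1.fn = rhsV l z.u z.v z.xi ∧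
    (field l z).2.2.1.fn = rhsXi l z.u z.v z.xi ∧ (field l z).2.2.2.fn = rhsW l z.u z.v z.xi := by
  obtain ⟨C, -, h, -⟩ := exists_rhs_Bd l (show 0 < 1 + R + R ^ 2 by positivity)
  obtain ⟨h1, h2, h3, h4⟩ := h _ _ _ (St.adm hR hz) _ z.bd_u z.bd_v
  exact ⟨BS.fn_mk h1, BS.fn_mk h2, BS.fn_mk h3, BS.fn_mk h4⟩

theorem field_bounded (l : ℕ) (R : ℝ) (hR : 0 < R) :
    ∃ L, ∀ z ∈ St.good R, ‖field l z‖ ≤ L := by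
  obtain ⟨C, hC, h, -⟩ := exists_rhs_Bd l (show 0 < 1 + R + R ^ 2 by positivity)
  refine ⟨C * R, fun z hz => ?_⟩
  obtain ⟨h1, h2, h3, h4⟩ := h _ _ _ (St.adm hR hz) _ (z.bd_u.mono hz.1) (z.bd_v.mono hz.1)
  obtain ⟨e1, e2, e3, e4⟩ := field_fn l hR hz
  exact St.norm_le (BS.norm_le (by rwa [e1])) (BS.norm_le (by rwa [e2]))
    (BS.norm_le (by rwa [e3])) (BS.norm_le (by rwa [e4]))

theorem St.near (y z : St) (Y : ℝ) :
    Near ‖y - z‖ (trip y.u y.v y.xi Y) (trip z.u z.v z.xi Y) := by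
  refine ⟨(y - z).bd_u.bound Y, (y - z).bd_v.bound Y, ?_⟩
  have := (y - z).bd_eta.bound Y
  have e : (y - z).xi Y - 1 = y.xi Y - z.xi Y := by
    show 1 + (y.2.2.1 - z.2.2.1).fn Y - 1 = _
    simp [St.xi]
  rwa [e] at this

theorem field_lipschitz (l : ℕ) (R : ℝ) (hR : 0 < R) :
    ∃ K, LipschitzOnWith K (field l) (St.good R) := by
  obtain ⟨C, hC, -, h⟩ := exists_rhs_Bd l (show 0 < 1 + R + R ^ 2 by positivity)
  refine ⟨(C * (1 + R)).toNNReal, LipschitzOnWith.of_dist_le_mul fun y hy z hz => ?_⟩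
  rw [dist_eq_norm, dist_eq_norm, Real.coe_toNNReal _ (by positivity)]
  obtain ⟨h1, h2, h3, h4⟩ := h _ _ _ _ _ _ (St.adm hR hy) (St.adm hR hz) ‖y - z‖ R
    (St.near y z) (y.bd_u.mono hy.1) (y.bd_v.mono hy.1) (y - z).bd_u (y - z).bd_v
  obtain ⟨e1, e2, e3, e4⟩ := field_fn l hR hy
  obtain ⟨f1, f2, f3, f4⟩ := field_fn l hR hz
  have e : C * (‖y - z‖ * (1 + R)) = C * (1 + R) * ‖y - z‖ := by ring
  rw [e] at h1 h2 h3 h4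
  rw [← e1, ← f1] at h1
  rw [← e2, ← f2] at h2
  rw [← e3, ← f3] at h3
  rw [← e4, ← f4] at h4
  exact St.norm_le (BS.norm_le h1) (BS.norm_le h2) (BS.norm_le h3) (BS.norm_le h4)

/-! ### Differentiation of integrals along a solution -/

theorem BS.exists_dominating {x x' : ℝ → BS} {T : ℝ} (hT : 0 ≤ T)
    (hx : ∀ t ∈ Icc 0 T, HasDerivWithinAt x (x' t) (Icc 0 T) t)
    (hc : ContinuousOn x' (Icc 0 T)) :
    ∃ M : BS, ∀ t ∈ Icc 0 T, ∀ Y, |(x t).fn Y| ≤ M.fn Y := by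
  have hca : ContinuousOn (fun s => (x' s).absF) (Icc 0 T) :=
    BS.continuous_absF.comp_continuousOn hc
  have hia : IntervalIntegrable (fun s => (x' s).absF) volume 0 T := by
    apply ContinuousOn.intervalIntegrable; rwa [uIcc_of_le hT]
  refine ⟨(x 0).absF + ∫ s in (0:ℝ)..T, (x' s).absF, fun t ht Y => ?_⟩
  have hev : (∫ s in (0:ℝ)..T, (x' s).absF).fn Y = ∫ s in (0:ℝ)..T, |(x' s).fn Y| := by
    rw [← BS.evL_apply, ← (BS.evL Y).intervalIntegral_comp_comm hia]
    simp
  rw [BS.fn_add, BS.fn_absF, hev]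
  have hcY : ContinuousOn (fun s => (x' s).fn Y) (Icc 0 T) :=
    (BS.evL Y).continuous.comp_continuousOn hc
  have hcY' : ContinuousOn (fun s => (x' s).fn Y) (Icc 0 t) :=
    hcY.mono (Icc_subset_Icc_right ht.2)
  have hii : IntervalIntegrable (fun s => (x' s).fn Y) volume 0 t := by
    apply ContinuousOn.intervalIntegrable; rwa [uIcc_of_le ht.1]
  have hii2 : IntervalIntegrable (fun s => |(x' s).fn Y|) volume 0 T := by
    apply ContinuousOn.intervalIntegrable; rw [uIcc_of_le hT]; exact hcY.abs
  have hdY : ∀ s ∈ Icc 0 T, HasDerivWithinAt (fun s => (x s).fn Y) ((x' s).fn Y) (Icc 0 T) s :=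
    fun s hs => (BS.evL Y).hasFDerivAt.comp_hasDerivWithinAt s (hx s hs)
  have ftc := intervalIntegral.integral_eq_sub_of_hasDeriv_right_of_le ht.1
    (f := fun s => (x s).fn Y) (f' := fun s => (x' s).fn Y)
    (fun s hs => ((hdY s ⟨hs.1, hs.2.trans ht.2⟩).continuousWithinAt).mono
      (Icc_subset_Icc_right ht.2))
    (fun s hs => ((hdY s ⟨hs.1.le, hs.2.le.trans ht.2⟩).mono_of_mem_nhdsWithin
      (mem_of_superset (Ioc_mem_nhdsGT (hs.2.trans_le ht.2)) fun r hr =>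
        ⟨hs.1.le.trans hr.1.le, hr.2⟩))) hii
  have h1 : (x t).fn Y = (x 0).fn Y + ∫ s in (0:ℝ)..t, (x' s).fn Y := by rw [ftc]; ring
  have h2 : |∫ s in (0:ℝ)..t, (x' s).fn Y| ≤ ∫ s in (0:ℝ)..t, |(x' s).fn Y| :=
    intervalIntegral.abs_integral_le_integral_abs ht.1
  have h3 : ∫ s in (0:ℝ)..t, |(x' s).fn Y| ≤ ∫ s in (0:ℝ)..T, |(x' s).fn Y| :=
    intervalIntegral.integral_mono_interval le_rfl ht.1 ht.2 (ae_of_all _ fun _ => abs_nonneg _) hii2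
  rw [h1]
  exact (abs_add_le _ _).trans (by linarith)

theorem hasDerivWithinAt_integral {f : ℝ → ℝ → ℝ} {f' L : ℝ → ℝ} {I : Set ℝ} {t : ℝ}
    (hf : ∀ s ∈ I, Integrable (f s)) (ht : t ∈ I) (hne : (𝓝[I \ {t}] t).NeBot)
    (hL : Integrable L) (hle : ∀ s ∈ I, ∀ Y, |f s Y - f t Y| ≤ L Y * |s - t|)
    (hd : ∀ Y, HasDerivWithinAt (fun s => f s Y) (f' Y) I t) :
    Integrable f' ∧ HasDerivWithinAt (fun s => ∫ Y, f s Y) (∫ Y, f' Y) I t := by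
  have hslope : ∀ Y, Tendsto (fun s => slope (fun s => f s Y) t s) (𝓝[I \ {t}] t) (𝓝 (f' Y)) :=
    fun Y => hasDerivWithinAt_iff_tendsto_slope.1 (hd Y)
  have hmem : ∀ᶠ s in 𝓝[I \ {t}] t, s ∈ I \ {t} := self_mem_nhdsWithin
  have hint : ∀ s ∈ I, Integrable fun Y => slope (fun s => f s Y) t s := fun s hs => by
    simp only [slope_def_field]
    exact ((hf s hs).sub (hf t ht)).div_const _
  have hbound : ∀ s ∈ I \ {t}, ∀ Y, ‖slope (fun s => f s Y) t s‖ ≤ L Y := fun s hs Y => by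
    have hst : 0 < |s - t| := abs_pos.2 (sub_ne_zero.2 hs.2)
    rw [slope_def_field, Real.norm_eq_abs, abs_div, div_le_iff₀ hst]
    exact hle s hs.1 Y
  have hmeas : AEStronglyMeasurable f' volume := by
    obtain ⟨ns, hns⟩ := exists_seq_tendsto (𝓝[I \ {t}] t)
    obtain ⟨N, hN⟩ := eventually_atTop.1 (hns.eventually hmem)
    refine aestronglyMeasurable_of_tendsto_ae atTop
      (f := fun n Y => slope (fun s => f s Y) t (ns (n + N)))
      (fun n => (hint _ (hN _ (Nat.le_add_left _ _)).1).aestronglyMeasurable)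
      (ae_of_all _ fun Y => ?_)
    exact (hslope Y).comp (hns.comp (tendsto_add_atTop_nat N))
  refine ⟨hL.mono' hmeas (ae_of_all _ fun Y => ?_), ?_⟩
  · exact le_of_tendsto (hslope Y).norm (hmem.mono fun s hs => hbound s hs Y)
  · rw [hasDerivWithinAt_iff_tendsto_slope]
    have h1 := tendsto_integral_filter_of_dominated_convergence (μ := volume) L
      (F := fun s Y => slope (fun s => f s Y) t s) (f := f') (l := 𝓝[I \ {t}] t)
      (hmem.mono fun s hs => (hint s hs.1).aestronglyMeasurable)
      (hmem.mono fun s hs => ae_of_all _ fun Y => hbound s hs Y) hL (ae_of_all _ hslope)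
    refine h1.congr' (hmem.mono fun s hs => ?_)
    simp only [slope_def_field]
    rw [integral_div, integral_sub (hf s hs.1) (hf t ht)]

/-- Functions on boxes that are quadratically small where `u = v = 0`. -/
def IsQ (φ : ℝ × ℝ × ℝ → ℝ) : Prop :=
  Measurable φ ∧ ∀ R, ∃ C, 0 ≤ C ∧ ∀ p ∈ Box R, |φ p| ≤ C * siz p ^ 2 ∧
    ∀ q ∈ Box R, ∀ δ, Near δ p q → |φ p - φ q| ≤ C * (siz p + siz q) * δ

theorem IsQ.mul {a b : ℝ × ℝ × ℝ → ℝ} (ha : IsS a) (hb : IsS b) (hma : Measurable a)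
    (hmb : Measurable b) : IsQ fun p => a p * b p := by
  refine ⟨hma.mul hmb, fun R => ?_⟩
  obtain ⟨A, hA, ha1⟩ := ha R
  obtain ⟨B, hB, hb1⟩ := hb R
  obtain ⟨A', hA', ha2⟩ := ha.isM R
  obtain ⟨B', hB', hb2⟩ := hb.isM R
  refine ⟨A * B + A * B' + B * A', by positivity, fun p hp => ⟨?_, fun q hq δ h => ?_⟩⟩
  · rw [abs_mul]
    have hs := siz_nonneg p
    have i1 := mul_le_mul (ha1 p hp).1 (hb1 p hp).1 (abs_nonneg _) (mul_nonneg hA hs)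
    have i2 : 0 ≤ (A * B' + B * A') * siz p ^ 2 := by positivity
    nlinarith
  · have hs := siz_nonneg p
    have hs' := siz_nonneg q
    have hδ := h.nonneg
    have e : a p * b p - a q * b q = a p * (b p - b q) + b q * (a p - a q) := by ring
    rw [e]
    refine (abs_add_le _ _).trans ?_
    rw [abs_mul, abs_mul]
    have i1 := mul_le_mul (ha1 p hp).1 ((hb2 p hp).2 q hq δ h) (abs_nonneg _) (mul_nonneg hA hs)
    have i2 := mul_le_mul (hb1 q hq).1 ((ha2 p hp).2 q hq δ h) (abs_nonneg _) (mul_nonneg hB hs')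
    have i3 : 0 ≤ A * B * (siz p + siz q) * δ := by positivity
    have i4 : 0 ≤ A * B' * siz q * δ := by positivity
    have i5 : 0 ≤ B * A' * siz p * δ := by positivity
    nlinarith

theorem IsQ.add {φ ψ : ℝ × ℝ × ℝ → ℝ} (hφ : IsQ φ) (hψ : IsQ ψ) : IsQ fun p => φ p + ψ p := by
  refine ⟨hφ.1.add hψ.1, fun R => ?_⟩
  obtain ⟨A, hA, h1⟩ := hφ.2 R
  obtain ⟨B, hB, h2⟩ := hψ.2 R
  refine ⟨A + B, by positivity, fun p hp => ⟨?_, fun q hq δ h => ?_⟩⟩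
  · refine (abs_add_le _ _).trans ?_
    linarith [(h1 p hp).1, (h2 p hp).1]
  · rw [add_sub_add_comm]
    refine (abs_add_le _ _).trans ?_
    have := (h1 p hp).2 q hq δ h
    have := (h2 p hp).2 q hq δ h
    nlinarith

section Solution

variable {l : ℕ} {z₀ : St} {T : ℝ} {z : ℝ → St}

/-- The value of `(u, v, ξ)`. -/
def St.tr (z : St) : ℝ → ℝ × ℝ × ℝ := trip z.u z.v z.xi

theorem IsSol.deriv_fn (h : IsSol (field l) St.good z₀ T z) {t : ℝ} (ht : t ∈ Icc 0 T) (Y : ℝ) :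
    HasDerivWithinAt (fun s => (z s).u Y) (rhsU l (z t).u (z t).v (z t).xi Y) (Icc 0 T) t ∧
    HasDerivWithinAt (fun s => (z s).v Y) (rhsV l (z t).u (z t).v (z t).xi Y) (Icc 0 T) t ∧
    HasDerivWithinAt (fun s => (z s).xi Y) (rhsXi l (z t).u (z t).v (z t).xi Y) (Icc 0 T) t ∧
    HasDerivWithinAt (fun s => (z s).w Y) (rhsW l (z t).u (z t).v (z t).xi Y) (Icc 0 T) t := by
  obtain ⟨R, hR, hm⟩ := h.mem
  obtain ⟨e1, e2, e3, e4⟩ := field_fn l hR (hm t ht)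
  have hd := h.deriv t ht
  have f1 := hd.fst
  have f2 := hd.snd.fst
  have f3 := hd.snd.snd.fst
  have f4 := hd.snd.snd.snd
  have g1 := (BS.evL Y).hasFDerivAt.comp_hasDerivWithinAt t f1
  have g2 := (BS.evL Y).hasFDerivAt.comp_hasDerivWithinAt t f2
  have g3 := ((BS.evL Y).hasFDerivAt.comp_hasDerivWithinAt t f3).const_add 1
  have g4 := (BS.evL Y).hasFDerivAt.comp_hasDerivWithinAt t f4
  rw [BS.evL_apply, e1] at g1
  rw [BS.evL_apply, e2] at g2
  rw [BS.evL_apply, e3] at g3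
  rw [BS.evL_apply, e4] at g4
  exact ⟨g1, g2, g3, g4⟩

theorem IsSol.exists_dominating (h : IsSol (field l) St.good z₀ T z) (hT : 0 ≤ T) :
    ∃ (B : ℝ) (D : ℝ → ℝ), Bd B D ∧ ∀ t ∈ Icc 0 T, ∀ Y, siz ((z t).tr Y) ≤ D Y ∧
      |rhsU l (z t).u (z t).v (z t).xi Y| ≤ D Y ∧ |rhsV l (z t).u (z t).v (z t).xi Y| ≤ D Y ∧
      |rhsXi l (z t).u (z t).v (z t).xi Y| ≤ D Y := by
  obtain ⟨R, hR, hm⟩ := h.mem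
  obtain ⟨K, hK⟩ := field_lipschitz l R hR
  have hc : ContinuousOn (fun t => field l (z t)) (Icc 0 T) :=
    hK.continuousOn.comp h.continuousOn hm
  obtain ⟨M₁, h1⟩ := BS.exists_dominating hT (x := fun t => (z t).1)
    (fun t ht => (h.deriv t ht).fst) (continuous_fst.comp_continuousOn hc)
  obtain ⟨M₂, h2⟩ := BS.exists_dominating hT (x := fun t => (z t).2.1)
    (fun t ht => (h.deriv t ht).snd.fst) ((continuous_fst.comp continuous_snd).comp_continuousOn hc)
  set M : ℝ → ℝ := fun Y => M₁.fn Y + M₂.fn Y with hMd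
  have hM : Bd (‖M₁‖ + ‖M₂‖) M := M₁.bd.add M₂.bd
  have hsM : ∀ t ∈ Icc 0 T, ∀ Y, siz ((z t).tr Y) ≤ M Y := fun t ht Y =>
    add_le_add (h1 t ht Y) (h2 t ht Y)
  obtain ⟨C, α, hC, hα, hb, -⟩ := exists_rhs_bound l (show 0 < 1 + R + R ^ 2 by positivity)
  have hbd : Bd ((‖M₁‖ + ‖M₂‖) + C * (‖M₁‖ + ‖M₂‖ + expMass α * (‖M₁‖ + ‖M₂‖)))
      fun Y => M Y + C * (M Y + expConv α M Y) := hM.add ((hM.add (hM.expConv hα)).const_mul hC)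
  have h0T : (0 : ℝ) ∈ Icc 0 T := ⟨le_rfl, hT⟩
  have hM0 : ∀ Y, 0 ≤ M Y := fun Y => (siz_nonneg _).trans (hsM 0 h0T Y)
  have hE0 : ∀ Y, 0 ≤ expConv α M Y := fun Y => expConv_nonneg hM0 Y
  refine ⟨_, _, hbd, fun t ht Y => ?_⟩
  have hadm := St.adm hR (hm t ht)
  have hs := (z t).bd_u.siz (z t).bd_v (z t).xi
  have hle : C * (siz ((z t).tr Y) + expConv α (fun Y => siz ((z t).tr Y)) Y) ≤
      M Y + C * (M Y + expConv α M Y) := by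
    have i1 := hsM t ht Y
    have i2 := expConv_mono hα hs hM (fun Y => hsM t ht Y) Y
    have i3 := mul_le_mul_of_nonneg_left (add_le_add i1 i2) hC
    have i4 := hM0 Y
    exact i3.trans (by linarith)
  obtain ⟨a1, a2, a3, -⟩ := hb _ _ _ hadm _ hs Y
  exact ⟨(hsM t ht Y).trans (le_add_of_nonneg_right (mul_nonneg hC (add_nonneg (hM0 Y) (hE0 Y)))),
    a1.trans hle, a2.trans hle, a3.trans hle⟩

theorem abs_sub_le_of_deriv_le {f f' : ℝ → ℝ} {T C : ℝ}
    (hd : ∀ t ∈ Icc 0 T, HasDerivWithinAt f (f' t) (Icc 0 T) t) (hC : ∀ t ∈ Icc 0 T, |f' t| ≤ C)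
    {s t : ℝ} (hs : s ∈ Icc 0 T) (ht : t ∈ Icc 0 T) : |f s - f t| ≤ C * |s - t| :=
  Convex.norm_image_sub_le_of_norm_hasDerivWithin_le hd hC (convex_Icc 0 T) ht hs

theorem IsQ.integrable {φ : ℝ × ℝ × ℝ → ℝ} (hφ : IsQ φ) {R : ℝ} (hR : 0 < R) {y : St}
    (hy : y ∈ St.good R) : Integrable fun Y => φ (y.tr Y) := by
  have hadm := St.adm hR hy
  have hR' : 0 < 1 + R + R ^ 2 := by positivity
  obtain ⟨C, hC, h⟩ := hφ.2 (1 + R + R ^ 2)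
  have hs := y.bd_u.siz y.bd_v y.xi
  have hi := (hs.memLp.integrable_sq).const_mul C
  exact hi.mono' (hadm.meas_trip hφ.1).aestronglyMeasurable
    (ae_of_all _ fun Y => (h _ (hadm.mem_box hR' Y)).1)

theorem IsSol.hasDerivWithinAt_integral (h : IsSol (field l) St.good z₀ T z) (hT : 0 < T)
    {φ : ℝ × ℝ × ℝ → ℝ} (hφ : IsQ φ) {φ' : ℝ → ℝ → ℝ}
    (hd : ∀ t ∈ Icc 0 T, ∀ Y, HasDerivWithinAt (fun s => φ ((z s).tr Y)) (φ' t Y) (Icc 0 T) t)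
    {t : ℝ} (ht : t ∈ Icc 0 T) :
    Integrable (φ' t) ∧
      HasDerivWithinAt (fun s => ∫ Y, φ ((z s).tr Y)) (∫ Y, φ' t Y) (Icc 0 T) t := by
  obtain ⟨R, hR, hm⟩ := h.mem
  have hR' : 0 < 1 + R + R ^ 2 := by positivity
  obtain ⟨B, D, hD, hdom⟩ := h.exists_dominating hT.le
  obtain ⟨C, hC, hφ'⟩ := hφ.2 (1 + R + R ^ 2)
  have hne : (𝓝[Icc 0 T \ {t}] t).NeBot := by
    have h1 : AccPt t (𝓟 (Icc 0 T)) :=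
      (uniqueDiffOn_Icc hT t ht).accPt
    rw [accPt_principal_iff_nhdsWithin] at h1
    exact h1
  refine LambdaFamily.hasDerivWithinAt_integral (L := fun Y => C * 2 * D Y ^ 2)
    (fun s hs => hφ.integrable hR (hm s hs)) ht hne ((hD.memLp.integrable_sq).const_mul (C * 2))
    (fun s hs Y => ?_) (fun Y => hd t ht Y)
  have hDY : 0 ≤ D Y := (siz_nonneg _).trans (hdom t ht Y).1
  have hnear : Near (D Y * |s - t|) ((z s).tr Y) ((z t).tr Y) :=
    ⟨abs_sub_le_of_deriv_le (fun r hr => (h.deriv_fn hr Y).1) (fun r hr => (hdom r hr Y).2.1) hs ht,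
     abs_sub_le_of_deriv_le (fun r hr => (h.deriv_fn hr Y).2.1) (fun r hr => (hdom r hr Y).2.2.1)
      hs ht,
     abs_sub_le_of_deriv_le (fun r hr => (h.deriv_fn hr Y).2.2.1) (fun r hr => (hdom r hr Y).2.2.2)
      hs ht⟩
  have h1 := (hφ' _ ((St.adm hR (hm s hs)).mem_box hR' Y)).2 _
    ((St.adm hR (hm t ht)).mem_box hR' Y) _ hnear
  refine h1.trans ?_
  have h2 : siz ((z s).tr Y) + siz ((z t).tr Y) ≤ 2 * D Y := by
    linarith [(hdom s hs Y).1, (hdom t ht Y).1]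
  calc C * (siz ((z s).tr Y) + siz ((z t).tr Y)) * (D Y * |s - t|)
      ≤ C * (2 * D Y) * (D Y * |s - t|) := by gcongr
    _ = _ := by ring

end Solution

/-! ### Identities preserved by the flow -/

/-- The derivative `u_Y = sin (v/2) cos^{k-1} (v/2) ξ`. -/
def slopeF (l : ℕ) (p : ℝ × ℝ × ℝ) : ℝ :=
  Real.sin (p.2.1 / 2) * Real.cos (p.2.1 / 2) ^ (2 * l + 1) * p.2.2

section Pots

variable {R : ℝ} {u v ξ : ℝ → ℝ}

theorem Adm.isPrim_pots (l : ℕ) (h : Adm R u v ξ) (hR : 0 < R) :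
    IsPrim (P l u v ξ) (fun Y => weightF l (trip u v ξ Y) * Px l u v ξ Y) ∧
    IsPrim (Px l u v ξ) (fun Y => weightF l (trip u v ξ Y) * P l u v ξ Y - densP l u v ξ Y) ∧
    IsPrim (Q l u v ξ) (fun Y => weightF l (trip u v ξ Y) * Qx l u v ξ Y) ∧
    IsPrim (Qx l u v ξ)
      (fun Y => weightF l (trip u v ξ Y) * Q l u v ξ Y - (l : ℝ) / 2 * densQ l u v ξ Y) := by
  obtain ⟨K, α, hα, hW⟩ := exists_weight l hR
  have hw := hW u v ξ h
  obtain ⟨CP, -, hP⟩ := (isS_densPF l).isM R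
  obtain ⟨CQ, -, hQ⟩ := (isS_densQF l).isM R
  have mP := h.meas_trip (measurable_densPF l)
  have mQ := h.meas_trip (measurable_densQF l)
  have bP : ∀ Y, |densPF l (trip u v ξ Y)| ≤ CP := fun Y => (hP _ (h.mem_box hR Y)).1
  have bQ : ∀ Y, |densQF l (trip u v ξ Y)| ≤ CQ := fun Y => (hQ _ (h.mem_box hR Y)).1
  set c : ℝ → ℝ := fun Y => weightF l (trip u v ξ Y)
  set f : ℝ → ℝ := fun Y => densPF l (trip u v ξ Y)
  set q : ℝ → ℝ := fun Y => densQF l (trip u v ξ Y)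
  have eP : P l u v ξ = fun Y => 1 / 2 * (potR c f Y + potL c f Y) := funext fun Y =>
    congrArg (1 / 2 * ·) (hw.potR_add_potL hα mP bP Y)
  have eQ : Q l u v ξ = fun Y => (l : ℝ) / 4 * (potR c q Y + potL c q Y) := funext fun Y =>
    congrArg ((l : ℝ) / 4 * ·) (hw.potR_add_potL hα mQ bQ Y)
  have ePx : Px l u v ξ = fun Y => 1 / 2 * (potR c f Y - potL c f Y) := rfl
  have eQx : Qx l u v ξ = fun Y => (l : ℝ) / 4 * (potR c q Y - potL c q Y) := rfl
  have rP := hw.isPrim_potR hα mP bP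
  have lP := hw.isPrim_potL hα mP bP
  have rQ := hw.isPrim_potR hα mQ bQ
  have lQ := hw.isPrim_potL hα mQ bQ
  have edP : densP l u v ξ = f := rfl
  have edQ : densQ l u v ξ = q := rfl
  rw [eP, ePx, eQ, eQx, edP, edQ]
  refine ⟨?_, ?_, ?_, ?_⟩
  · convert! (rP.add lP).const_mul (1 / 2) using 2; ring
  · convert! (rP.sub lP).const_mul (1 / 2) using 2; ring
  · convert! (rQ.add lQ).const_mul ((l : ℝ) / 4) using 2; ring
  · convert! (rQ.sub lQ).const_mul ((l : ℝ) / 4) using 2; ring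

theorem Adm.isPrim_rhsU (l : ℕ) (h : Adm R u v ξ) (hR : 0 < R) :
    IsPrim (rhsU l u v ξ) (rhsW l u v ξ) := by
  obtain ⟨-, h2, h3, -⟩ := h.isPrim_pots l hR
  convert! ((h2.add h3).const_mul (-1)) using 2 with Y Y
  · unfold rhsU; ring
  · unfold rhsW weightF trip; ring

end Pots

section Solution

variable {l : ℕ} {z₀ : St} {T : ℝ} {z : ℝ → St}

theorem eq_of_deriv_zero {f : ℝ → ℝ} {T : ℝ}
    (hd : ∀ t ∈ Icc 0 T, HasDerivWithinAt f 0 (Icc 0 T) t) {t : ℝ} (ht : t ∈ Icc 0 T) :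
    f t = f 0 := by
  have := abs_sub_le_of_deriv_le hd (C := 0) (by simp) ht ⟨le_rfl, ht.1.trans ht.2⟩
  rw [zero_mul] at this
  exact sub_eq_zero.1 (abs_eq_zero.1 (le_antisymm this (abs_nonneg _)))

theorem IsSol.deriv_trig (h : IsSol (field l) St.good z₀ T z) {t : ℝ} (ht : t ∈ Icc 0 T) (Y : ℝ) :
    HasDerivWithinAt (fun s => Real.sin ((z s).v Y / 2))
      (Real.cos ((z t).v Y / 2) * (rhsV l (z t).u (z t).v (z t).xi Y / 2)) (Icc 0 T) t ∧
    HasDerivWithinAt (fun s => Real.cos ((z s).v Y / 2))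
      (-Real.sin ((z t).v Y / 2) * (rhsV l (z t).u (z t).v (z t).xi Y / 2)) (Icc 0 T) t :=
  ⟨((h.deriv_fn ht Y).2.1.div_const 2).sin, ((h.deriv_fn ht Y).2.1.div_const 2).cos⟩

theorem sin_eq_half (x : ℝ) : Real.sin x = 2 * Real.sin (x / 2) * Real.cos (x / 2) := by
  rw [← Real.sin_two_mul]; ring_nf

theorem expK_eq (l : ℕ) : expK l = 2 * l + 2 := by unfold expK; ring

theorem IsSol.w_eq (h : IsSol (field l) St.good z₀ T z)
    (h0 : ∀ Y, z₀.w Y = slopeF l (z₀.tr Y)) {t : ℝ} (ht : t ∈ Icc 0 T) (Y : ℝ) :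
    (z t).w Y = slopeF l ((z t).tr Y) := by
  have key : ∀ t ∈ Icc 0 T,
      HasDerivWithinAt (fun s => (z s).w Y - slopeF l ((z s).tr Y)) 0 (Icc 0 T) t := fun t ht => by
    obtain ⟨d1, d2, d3, d4⟩ := h.deriv_fn ht Y
    obtain ⟨dS, dC⟩ := h.deriv_trig ht Y
    have hd := d4.sub ((dS.mul (dC.pow (2 * l + 1))).mul d3)
    convert! hd using 1
    have hsc := Real.sin_sq_add_cos_sq ((z t).v Y / 2)
    unfold rhsW rhsV rhsXi densP
    rw [sin_eq_half ((z t).v Y)]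
    simp only [Pi.mul_apply, Pi.pow_apply, expK_eq, Nat.add_sub_cancel]
    set S := Real.sin ((z t).v Y / 2)
    set C := Real.cos ((z t).v Y / 2)
    set B := P l (z t).u (z t).v (z t).xi Y + Qx l (z t).u (z t).v (z t).xi Y
    simp only [pow_succ C, pow_succ ((z t).u Y)]
    push_cast
    set X := C ^ (2 * l)
    set U := (z t).u Y ^ l
    set x := (z t).xi Y
    set uu := (z t).u Y
    linear_combination (x * U * S ^ 2 * X * ((l : ℝ) + 1 / 2)
      + x * X * C ^ 2 * (U * uu ^ 2 - B)) * hsc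
  have := eq_of_deriv_zero key ht
  rw [h.init, h0 Y, sub_self] at this
  exact sub_eq_zero.1 this

theorem IsSol.isPrim_u (h : IsSol (field l) St.good z₀ T z) (h0 : IsPrim z₀.u z₀.w)
    {t : ℝ} (ht : t ∈ Icc 0 T) : IsPrim (z t).u (z t).w := by
  refine ⟨locallyIntegrable_of_bdd (z t).bd_w.meas (z t).bd_w.bound, fun a b => ?_⟩
  have key : ∀ t ∈ Icc 0 T, HasDerivWithinAt
      (fun s => (z s).u b - (z s).u a - ∫ Y in a..b, (z s).w Y) 0 (Icc 0 T) t := fun t ht => by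
    obtain ⟨R, hR, hm⟩ := h.mem
    have hR' : 0 < 1 + R + R ^ 2 := by positivity
    have h1 := (h.deriv_fn ht b).1.sub (h.deriv_fn ht a).1
    have h2 := (BS.intL a b).hasFDerivAt.comp_hasDerivWithinAt t (h.deriv t ht).snd.snd.snd
    rw [BS.intL_apply, (field_fn l hR (hm t ht)).2.2.2] at h2
    have h3 := h1.sub h2
    rw [((St.adm hR (hm t ht)).isPrim_rhsU l hR').sub_eq a b, sub_self] at h3
    exact h3
  have := eq_of_deriv_zero key ht
  rw [h.init, h0.sub_eq a b, sub_self] at this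
  exact sub_eq_zero.1 this

end Solution

/-! ### The energy -/

/-- The energy density `(u² cos^k (v/2) + sin² (v/2) cos^{k-2} (v/2)) ξ`. -/
def energyF (l : ℕ) (p : ℝ × ℝ × ℝ) : ℝ :=
  p.1 * (p.1 * (Real.cos (p.2.1 / 2) ^ (2 * l + 2) * p.2.2))
    + Real.sin (p.2.1 / 2) * (Real.sin (p.2.1 / 2) * (Real.cos (p.2.1 / 2) ^ (2 * l) * p.2.2))

theorem isQ_energyF (l : ℕ) : IsQ (energyF l) :=
  (IsQ.mul IsS.fst (IsS.fst.mul ((IsM.cos_half.pow (2 * l + 2)).mul IsM.thd))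
    (by fun_prop) (by fun_prop)).add
  (IsQ.mul IsS.sin_half (IsS.sin_half.mul ((IsM.cos_half.pow (2 * l)).mul IsM.thd))
    (by fun_prop) (by fun_prop))

theorem St.Bd_pots (l : ℕ) {R : ℝ} (hR : 0 < R) {y : St} (hy : y ∈ St.good R) :
    ∃ B, Bd B (P l y.u y.v y.xi) ∧ Bd B (Qx l y.u y.v y.xi) := by
  have hR' : 0 < 1 + R + R ^ 2 := by positivity
  have hadm := St.adm hR hy
  obtain ⟨C, α, hC, hα, h, -⟩ := exists_pots_bound l hR'
  have hs := y.bd_u.siz y.bd_v y.xi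
  have hb := (hs.expConv hα).const_mul hC
  obtain ⟨m1, -, -, m4⟩ := measurable_pots l hadm.meas_u hadm.meas_v hadm.meas_xi
    (hadm.abs_xi_le hR')
  exact ⟨_, hb.of_le m1 fun Y => ((h _ _ _ hadm _ hs Y).1).trans (le_abs_self _),
    hb.of_le m4 fun Y => ((h _ _ _ hadm _ hs Y).2.2.2).trans (le_abs_self _)⟩

theorem Bd.integrable_mul {f g : ℝ → ℝ} {C D : ℝ} (hf : Bd C f) (hg : Bd D g) :
    Integrable fun Y => f Y * g Y :=
  hf.memLp.integrable_mul hg.memLp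

section Solution

variable {l : ℕ} {z₀ : St} {T : ℝ} {z : ℝ → St}

theorem IsSol.deriv_energyF (hl : 1 ≤ l) (h : IsSol (field l) St.good z₀ T z) {t : ℝ}
    (ht : t ∈ Icc 0 T) (Y : ℝ) :
    HasDerivWithinAt (fun s => energyF l ((z s).tr Y))
      (((l : ℝ) + 3) * (z t).u Y ^ (l + 2) * slopeF l ((z t).tr Y)
        - 2 * (slopeF l ((z t).tr Y) * (P l (z t).u (z t).v (z t).xi Y + Qx l (z t).u (z t).v (z t).xi Y)
          + (z t).u Y * (weightF l ((z t).tr Y) * Px l (z t).u (z t).v (z t).xi Y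
            + (weightF l ((z t).tr Y) * Q l (z t).u (z t).v (z t).xi Y
              - (l : ℝ) / 2 * densQ l (z t).u (z t).v (z t).xi Y))))
      (Icc 0 T) t := by
  obtain ⟨d1, d2, d3, -⟩ := h.deriv_fn ht Y
  obtain ⟨dS, dC⟩ := h.deriv_trig ht Y
  have hd := (d1.mul (d1.mul ((dC.pow (2 * l + 2)).mul d3))).add
    (dS.mul (dS.mul ((dC.pow (2 * l)).mul d3)))
  convert! hd using 1
  obtain ⟨m, rfl⟩ : ∃ m, l = m + 1 := ⟨l - 1, by omega⟩
  have hsc := Real.sin_sq_add_cos_sq ((z t).v Y / 2)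
  unfold rhsU rhsV rhsXi densQ slopeF weightF St.tr trip
  rw [sin_eq_half ((z t).v Y)]
  have e1 : 2 * (m + 1) + 2 - 3 = 2 * m + 1 := by omega
  have e2 : 2 * (m + 1) - 1 = 2 * m + 1 := by omega
  have e3 : 2 * (m + 1) + 2 - 1 = 2 * m + 3 := by omega
  simp only [Pi.mul_apply, Pi.pow_apply, expK_eq, Nat.add_sub_cancel, e1, e2, e3]
  set S := Real.sin ((z t).v Y / 2)
  set C := Real.cos ((z t).v Y / 2)
  set P := P (m + 1) (z t).u (z t).v (z t).xi Y
  set Qx := Qx (m + 1) (z t).u (z t).v (z t).xi Y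
  set Px := Px (m + 1) (z t).u (z t).v (z t).xi Y
  set Q := Q (m + 1) (z t).u (z t).v (z t).xi Y
  set x := (z t).xi Y
  set uu := (z t).u Y
  have f1 : C ^ (2 * (m + 1) + 2) = C ^ (2 * m) * C ^ 4 := by ring
  have f2 : C ^ (2 * (m + 1) + 1) = C ^ (2 * m) * C ^ 3 := by ring
  have f3 : C ^ (2 * (m + 1)) = C ^ (2 * m) * C ^ 2 := by ring
  have f4 : C ^ (2 * m + 1) = C ^ (2 * m) * C := by ring
  have f5 : C ^ (2 * m + 3) = C ^ (2 * m) * C ^ 3 := by ring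
  have f6 : uu ^ (m + 1 + 2) = uu ^ m * uu ^ 3 := by ring
  have f7 : uu ^ (m + 1) = uu ^ m * uu := by ring
  rw [f1, f2, f3, f4, f5, f6, f7]
  push_cast
  set X := C ^ (2 * m)
  set U := uu ^ m
  linear_combination (-((m : ℝ) + 2) * S * uu ^ 3 * U * X * C ^ 3 * x
    - ((m : ℝ) + 1) * S ^ 3 * U * uu * X * C * x
    - 2 * S * C ^ 3 * X * x * (U * uu ^ 3 - P - Qx)) * hsc

theorem IsSol.energy_eq (hl : 1 ≤ l) (h : IsSol (field l) St.good z₀ T z)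
    (hw : ∀ Y, z₀.w Y = slopeF l (z₀.tr Y)) (hp : IsPrim z₀.u z₀.w) (hT : 0 < T) {t : ℝ}
    (ht : t ∈ Icc 0 T) :
    ∫ Y, energyF l ((z t).tr Y) = ∫ Y, energyF l (z₀.tr Y) := by
  rw [← h.init]
  refine eq_of_deriv_zero (f := fun t => ∫ Y, energyF l ((z t).tr Y)) (fun t ht => ?_) ht
  obtain ⟨hi, hd⟩ := h.hasDerivWithinAt_integral hT (isQ_energyF l)
    (fun t ht Y => h.deriv_energyF hl ht Y) ht
  obtain ⟨R, hR, hm⟩ := h.mem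
  have hR' : 0 < 1 + R + R ^ 2 := by positivity
  have hadm := St.adm hR (hm t ht)
  obtain ⟨p1, -, -, p4⟩ := hadm.isPrim_pots l hR'
  obtain ⟨B, b1, b4⟩ := St.Bd_pots l hR (hm t ht)
  have hu := h.isPrim_u hp ht
  have hwt : (z t).w = fun Y => slopeF l ((z t).tr Y) := funext (h.w_eq hw ht)
  rw [hwt] at hu
  have hprim := (hu.pow (l + 2)).sub ((hu.mul (p1.add p4)).const_mul 2)
  have hbu := (z t).bd_u
  have i1 : Integrable fun Y => (z t).u Y ^ (l + 2 + 1) := by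
    refine (hbu.memLp.integrable_sq.const_mul ((1 + R + R ^ 2) ^ (l + 1))).mono'
      (hbu.meas.pow_const _).aestronglyMeasurable (ae_of_all _ fun Y => ?_)
    have e : (z t).u Y ^ (l + 2 + 1) = (z t).u Y ^ (l + 1) * (z t).u Y ^ 2 := by ring
    rw [Real.norm_eq_abs, e, abs_mul, abs_pow, abs_of_nonneg (sq_nonneg ((z t).u Y))]
    exact mul_le_mul_of_nonneg_right
      (pow_le_pow_left₀ (abs_nonneg _) (hadm.u_le Y) _) (sq_nonneg _)
  have i2 := Bd.integrable_mul hbu (b1.add b4)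
  have hz := hprim.integral_eq_zero (i1.sub (i2.const_mul 2)) (by
    convert! hi using 2
    push_cast; unfold St.tr; ring)
  convert! hd using 1
  rw [← hz]
  congr 1
  funext Y
  push_cast; unfold St.tr; ring

end Solution

theorem energyF_nonneg (l : ℕ) {p : ℝ × ℝ × ℝ} (hp : 0 ≤ p.2.2) : 0 ≤ energyF l p := by
  have h1 : energyF l p = (p.1 ^ 2 * (Real.cos (p.2.1 / 2) ^ (l + 1)) ^ 2
      + Real.sin (p.2.1 / 2) ^ 2 * (Real.cos (p.2.1 / 2) ^ l) ^ 2) * p.2.2 := by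
    unfold energyF; ring
  rw [h1]; positivity

theorem abs_two_mul_slopeF_le (l : ℕ) {p : ℝ × ℝ × ℝ} (hp : 0 ≤ p.2.2) :
    |2 * p.1 * slopeF l p| ≤ energyF l p := by
  set S := Real.sin (p.2.1 / 2) with hS
  set C := Real.cos (p.2.1 / 2) with hC
  have h1 : energyF l p = (p.1 ^ 2 * C ^ 2 + S ^ 2) * (C ^ (2 * l) * p.2.2) := by
    unfold energyF; ring
  have h2 : 2 * p.1 * slopeF l p = (2 * (p.1 * C) * S) * (C ^ (2 * l) * p.2.2) := by
    unfold slopeF; ring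
  have h3 : 0 ≤ C ^ (2 * l) * p.2.2 := by rw [pow_mul]; positivity
  rw [h1, h2, abs_mul, abs_of_nonneg h3]
  refine mul_le_mul_of_nonneg_right (abs_le.2 ⟨?_, ?_⟩) h3
  · nlinarith [sq_nonneg (p.1 * C + S)]
  · nlinarith [sq_nonneg (p.1 * C - S)]

theorem St.sq_le_energy (l : ℕ) {R : ℝ} (hR : 0 < R) {y : St} (hy : y ∈ St.good R)
    (hp : IsPrim y.u fun Y => slopeF l (y.tr Y)) (Y : ℝ) :
    y.u Y ^ 2 ≤ ∫ Y, energyF l (y.tr Y) := by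
  have hR' : 0 < 1 + R + R ^ 2 := by positivity
  have hadm := St.adm hR hy
  have hx : ∀ Y, 0 ≤ (y.tr Y).2.2 := fun Y => (hadm.xi_pos hR' Y).le
  have hi := (isQ_energyF l).integrable hR hy
  have hprim := hp.pow 1
  have hle : ∀ Y, |((1 : ℕ) + 1 : ℝ) * y.u Y ^ 1 * slopeF l (y.tr Y)| ≤ energyF l (y.tr Y) :=
    fun Y => by
      have := abs_two_mul_slopeF_le l (hx Y)
      convert this using 2
      push_cast; unfold St.tr trip; ring
  have hi2 : Integrable fun Y => ((1 : ℕ) + 1 : ℝ) * y.u Y ^ 1 * slopeF l (y.tr Y) := by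
    refine hi.mono' ?_ (ae_of_all _ hle)
    have : Measurable (slopeF l) := by unfold slopeF; fun_prop
    exact (((y.bd_u.meas.pow_const 1).const_mul _).mul
      (hadm.meas_trip this)).aestronglyMeasurable
  have ht := hprim.tendsto_atBot y.bd_u.memLp.integrable_sq hi2
  have ht2 : Tendsto (fun a => y.u Y ^ (1 + 1) - y.u a ^ (1 + 1)) atBot (𝓝 (y.u Y ^ (1 + 1) - 0)) :=
    ht.const_sub _
  rw [sub_zero] at ht2
  refine le_of_tendsto ht2 ((eventually_le_atBot Y).mono fun a ha => ?_)
  rw [hprim.sub_eq a Y, intervalIntegral.integral_of_le ha]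
  calc _ ≤ ∫ x in Ioc a Y, energyF l (y.tr x) :=
        setIntegral_mono hi2.integrableOn hi.integrableOn fun x => (le_abs_self _).trans (hle x)
    _ ≤ _ := setIntegral_le_integral hi (ae_of_all _ fun x => energyF_nonneg l (hx x))

/-! ### Bounds for the nonlocal terms -/

theorem pow_mul_add_le (m : ℕ) {p q : ℝ} (hp : 0 ≤ p) (hq : 0 ≤ q) :
    p * q ^ (2 * m + 1) + p ^ (2 * m + 1) * q ≤ p ^ (2 * m + 2) + q ^ (2 * m + 2) := by
  have : 0 ≤ (p ^ (2 * m + 1) - q ^ (2 * m + 1)) * (p - q) := by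
    rcases le_total p q with h | h
    · have := pow_le_pow_left₀ hp h (2 * m + 1)
      nlinarith
    · have := pow_le_pow_left₀ hq h (2 * m + 1)
      nlinarith
  have e : (p ^ (2 * m + 1) - q ^ (2 * m + 1)) * (p - q) =
      p ^ (2 * m + 2) + q ^ (2 * m + 2) - (p * q ^ (2 * m + 1) + p ^ (2 * m + 1) * q) := by ring
  linarith

theorem mixed_moment_le (m : ℕ) {x y : ℝ} (hx : 0 ≤ x) (hy : 0 ≤ y) :
    x ^ 3 * y ^ (2 * m + 1) ≤ x ^ 2 * y ^ (2 * m + 2) + x ^ (2 * m + 4) ∧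
    x ^ (2 * m + 3) * y ≤ x ^ 2 * y ^ (2 * m + 2) + x ^ (2 * m + 4) := by
  have h := pow_mul_add_le m hx hy
  have h1 : 0 ≤ x * y ^ (2 * m + 1) := by positivity
  have h2 : 0 ≤ x ^ (2 * m + 1) * y := by positivity
  have e1 : x ^ 3 * y ^ (2 * m + 1) = x ^ 2 * (x * y ^ (2 * m + 1)) := by ring
  have e2 : x ^ (2 * m + 3) * y = x ^ 2 * (x ^ (2 * m + 1) * y) := by ring
  have e3 : x ^ 2 * y ^ (2 * m + 2) + x ^ (2 * m + 4) =
      x ^ 2 * (x ^ (2 * m + 2) + y ^ (2 * m + 2)) := by ring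
  rw [e1, e2, e3]
  exact ⟨mul_le_mul_of_nonneg_left (by linarith) (sq_nonneg x),
    mul_le_mul_of_nonneg_left (by linarith) (sq_nonneg x)⟩

theorem integral_mixed_moment_mul_le (m : ℕ) {x y ξ : ℝ → ℝ} (hx : ∀ Y, 0 ≤ x Y)
    (hy : ∀ Y, 0 ≤ y Y) (hξ : ∀ Y, 0 ≤ ξ Y)
    (ha : Integrable fun Y => x Y ^ 2 * y Y ^ (2 * m + 2) * ξ Y)
    (hb : Integrable fun Y => x Y ^ (2 * m + 4) * ξ Y)
    (hm : Integrable fun Y => x Y ^ 3 * y Y ^ (2 * m + 1) * ξ Y)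
    (hn : Integrable fun Y => x Y ^ (2 * m + 3) * y Y * ξ Y) :
    (∫ Y, x Y ^ 3 * y Y ^ (2 * m + 1) * ξ Y) * (∫ Y, x Y ^ (2 * m + 3) * y Y * ξ Y) ≤
      (∫ Y, x Y ^ 2 * y Y ^ (2 * m + 2) * ξ Y) * ∫ Y, x Y ^ (2 * m + 4) * ξ Y := by
  set a := ∫ Y, x Y ^ 2 * y Y ^ (2 * m + 2) * ξ Y with hae
  set b := ∫ Y, x Y ^ (2 * m + 4) * ξ Y with hbe
  set M := ∫ Y, x Y ^ 3 * y Y ^ (2 * m + 1) * ξ Y with hme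
  set N := ∫ Y, x Y ^ (2 * m + 3) * y Y * ξ Y with hne
  have h1 : ∀ s c : ℝ, 0 ≤ s → 0 ≤ c →
      c * s ^ (2 * m + 1) * M + c ^ (2 * m + 1) * s * N ≤ c ^ (2 * m + 2) * b + s ^ (2 * m + 2) * a := by
    intro s c hs hc
    rw [hae, hbe, hme, hne, ← integral_const_mul, ← integral_const_mul, ← integral_const_mul,
      ← integral_const_mul, ← integral_add (hm.const_mul _) (hn.const_mul _),
      ← integral_add (hb.const_mul _) (ha.const_mul _)]
    refine integral_mono ((hm.const_mul _).add (hn.const_mul _))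
      ((hb.const_mul _).add (ha.const_mul _)) fun Y => ?_
    have h := mul_le_mul_of_nonneg_left (pow_mul_add_le m (mul_nonneg (hx Y) hc)
      (mul_nonneg (hy Y) hs)) (mul_nonneg (sq_nonneg (x Y)) (hξ Y))
    simp only [mul_pow] at h
    calc _ = x Y ^ 2 * ξ Y * (x Y * c * (y Y ^ (2 * m + 1) * s ^ (2 * m + 1)) +
          x Y ^ (2 * m + 1) * c ^ (2 * m + 1) * (y Y * s)) := by ring
      _ ≤ _ := h
      _ = _ := by ring
  have h2 : (∫ Y, (M * (x Y ^ (2 * m + 3) * y Y * ξ Y) + N * (x Y ^ 3 * y Y ^ (2 * m + 1) * ξ Y))) ≤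
      ∫ Y, (b * (x Y ^ 2 * y Y ^ (2 * m + 2) * ξ Y) + a * (x Y ^ (2 * m + 4) * ξ Y)) := by
    refine integral_mono ((hn.const_mul _).add (hm.const_mul _))
      ((ha.const_mul _).add (hb.const_mul _)) fun Y => ?_
    have h := mul_le_mul_of_nonneg_left (h1 (x Y) (y Y) (hx Y) (hy Y))
      (mul_nonneg (sq_nonneg (x Y)) (hξ Y))
    calc _ = x Y ^ 2 * ξ Y * (y Y * x Y ^ (2 * m + 1) * M + y Y ^ (2 * m + 1) * x Y * N) := by ring
      _ ≤ _ := h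
      _ = _ := by ring
  rw [integral_add (hn.const_mul _) (hm.const_mul _), integral_add (ha.const_mul _) (hb.const_mul _),
    integral_const_mul, integral_const_mul, integral_const_mul, integral_const_mul] at h2
  linarith

/-- The density `sin^k (v/2) ξ`. -/
def sinF (l : ℕ) (p : ℝ × ℝ × ℝ) : ℝ :=
  Real.sin (p.2.1 / 2) * (Real.sin (p.2.1 / 2) * (Real.sin (p.2.1 / 2) ^ (2 * l) * p.2.2))

def cubicF (l : ℕ) (p : ℝ × ℝ × ℝ) : ℝ :=
  |Real.sin (p.2.1 / 2)| ^ 3 * |Real.cos (p.2.1 / 2)| ^ (2 * l - 1) * p.2.2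

def crossF (l : ℕ) (p : ℝ × ℝ × ℝ) : ℝ :=
  |Real.sin (p.2.1 / 2)| ^ (2 * l + 1) * |Real.cos (p.2.1 / 2)| * p.2.2

theorem isQ_sinF (l : ℕ) : IsQ (sinF l) :=
  IsQ.mul IsS.sin_half (IsS.sin_half.mul ((IsS.sin_half.isM.pow (2 * l)).mul IsM.thd))
    (by fun_prop) (by fun_prop)

structure PotBounds (l : ℕ) (E : ℝ) (y : St) : Prop where
  u_le : ∀ Y, |y.u Y| ≤ 1 + E
  P_le : ∀ Y, |P l y.u y.v y.xi Y| ≤ (l + 1) * (1 + E) ^ (l + 2)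
  Qx_le : ∀ Y, |Qx l y.u y.v y.xi Y| ≤ (l + 1) * (1 + E) ^ (l + 2) * ∫ Y, cubicF l (y.tr Y)
  cubic_nonneg : 0 ≤ ∫ Y, cubicF l (y.tr Y)
  cubic_le : ∫ Y, cubicF l (y.tr Y) ≤ E + ∫ Y, sinF l (y.tr Y)
  cross_int : Integrable fun Y => crossF l (y.tr Y)
  cross_le : ∫ Y, crossF l (y.tr Y) ≤ E + ∫ Y, sinF l (y.tr Y)
  mul_le : (∫ Y, cubicF l (y.tr Y)) * (∫ Y, crossF l (y.tr Y)) ≤ E * ∫ Y, sinF l (y.tr Y)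
  sin_nonneg : 0 ≤ ∫ Y, sinF l (y.tr Y)
  E_nonneg : 0 ≤ E

theorem abs_integral_le_of_le {f g : ℝ → ℝ} (hg : Integrable g) (h : ∀ Y, |f Y| ≤ g Y) (S : Set ℝ)
    (hg0 : ∀ Y, 0 ≤ g Y) : |∫ Y in S, f Y| ≤ ∫ Y, g Y := by
  rw [← Real.norm_eq_abs]
  exact (norm_integral_le_of_norm_le hg.integrableOn (ae_of_all _ h)).trans
    (setIntegral_le_integral hg (ae_of_all _ hg0))

theorem St.potBounds {l : ℕ} (hl : 1 ≤ l) {R : ℝ} (hR : 0 < R) {y : St} (hy : y ∈ St.good R)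
    (hu : ∀ Y, y.u Y ^ 2 ≤ ∫ Y, energyF l (y.tr Y)) :
    PotBounds l (∫ Y, energyF l (y.tr Y)) y := by
  have hR' : 0 < 1 + R + R ^ 2 := by positivity
  have hadm := St.adm hR hy
  have hx : ∀ Y, 0 ≤ y.xi Y := fun Y => (hadm.xi_pos hR' Y).le
  have hie := (isQ_energyF l).integrable hR hy
  have his := (isQ_sinF l).integrable hR hy
  have he0 : ∀ Y, 0 ≤ energyF l (y.tr Y) := fun Y => energyF_nonneg l (hx Y)
  set E := ∫ Y, energyF l (y.tr Y) with hE
  have hE0 : 0 ≤ E := integral_nonneg he0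
  obtain ⟨m, rfl⟩ : ∃ m, l = m + 1 := ⟨l - 1, by omega⟩
  set x : ℝ → ℝ := fun Y => |Real.sin (y.v Y / 2)| with hxd
  set c : ℝ → ℝ := fun Y => |Real.cos (y.v Y / 2)| with hcd
  have hx0 : ∀ Y, 0 ≤ x Y := fun Y => abs_nonneg _
  have hc0 : ∀ Y, 0 ≤ c Y := fun Y => abs_nonneg _
  have hx1 : ∀ Y, x Y ≤ 1 := fun Y => Real.abs_sin_le_one _
  have hc1 : ∀ Y, c Y ≤ 1 := fun Y => Real.abs_cos_le_one _
  have mv := hadm.meas_v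
  have mx := hadm.meas_xi
  have mu := hadm.meas_u
  have mxx : Measurable x := by fun_prop
  have mcc : Measurable c := by fun_prop
  have eS : ∀ Y, sinF (m + 1) (y.tr Y) = x Y ^ (2 * m + 4) * y.xi Y := fun Y => by
    have : x Y ^ (2 * m + 4) = Real.sin (y.v Y / 2) ^ (2 * m + 4) :=
      Even.pow_abs ⟨m + 2, by ring⟩ _
    rw [this]; unfold sinF St.tr trip; ring
  have eE : ∀ Y, energyF (m + 1) (y.tr Y) = y.u Y ^ 2 * c Y ^ (2 * m + 4) * y.xi Y +
      x Y ^ 2 * c Y ^ (2 * m + 2) * y.xi Y := fun Y => by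
    have h1 : c Y ^ (2 * m + 4) = Real.cos (y.v Y / 2) ^ (2 * m + 4) :=
      Even.pow_abs ⟨m + 2, by ring⟩ _
    have h2 : c Y ^ (2 * m + 2) = Real.cos (y.v Y / 2) ^ (2 * m + 2) :=
      Even.pow_abs ⟨m + 1, by ring⟩ _
    have h3 : x Y ^ 2 = Real.sin (y.v Y / 2) ^ 2 := sq_abs _
    rw [h1, h2, h3]; unfold energyF St.tr trip; ring
  have eM : ∀ Y, cubicF (m + 1) (y.tr Y) = x Y ^ 3 * c Y ^ (2 * m + 1) * y.xi Y := fun Y => rfl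
  have eN : ∀ Y, crossF (m + 1) (y.tr Y) = x Y ^ (2 * m + 3) * c Y * y.xi Y := fun Y => rfl
  have hale : ∀ Y, x Y ^ 2 * c Y ^ (2 * m + 2) * y.xi Y ≤ energyF (m + 1) (y.tr Y) := fun Y => by
    rw [eE]
    have := mul_nonneg (mul_nonneg (sq_nonneg (y.u Y)) (pow_nonneg (hc0 Y) (2 * m + 4))) (hx Y)
    linarith
  have ha0 : ∀ Y, 0 ≤ x Y ^ 2 * c Y ^ (2 * m + 2) * y.xi Y := fun Y =>
    mul_nonneg (mul_nonneg (sq_nonneg _) (pow_nonneg (hc0 Y) _)) (hx Y)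
  have hb0 : ∀ Y, 0 ≤ x Y ^ (2 * m + 4) * y.xi Y := fun Y => mul_nonneg (pow_nonneg (hx0 Y) _) (hx Y)
  have hia : Integrable fun Y => x Y ^ 2 * c Y ^ (2 * m + 2) * y.xi Y :=
    hie.mono' (by fun_prop) (ae_of_all _ fun Y => by
      rw [Real.norm_eq_abs, abs_of_nonneg (ha0 Y)]; exact hale Y)
  have hib : Integrable fun Y => x Y ^ (2 * m + 4) * y.xi Y := by
    refine his.congr (ae_of_all _ eS)
  have hab := hia.add hib
  have hM0 : ∀ Y, 0 ≤ x Y ^ 3 * c Y ^ (2 * m + 1) * y.xi Y := fun Y =>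
    mul_nonneg (mul_nonneg (pow_nonneg (hx0 Y) _) (pow_nonneg (hc0 Y) _)) (hx Y)
  have hN0 : ∀ Y, 0 ≤ x Y ^ (2 * m + 3) * c Y * y.xi Y := fun Y =>
    mul_nonneg (mul_nonneg (pow_nonneg (hx0 Y) _) (hc0 Y)) (hx Y)
  have hMle : ∀ Y, x Y ^ 3 * c Y ^ (2 * m + 1) * y.xi Y ≤
      x Y ^ 2 * c Y ^ (2 * m + 2) * y.xi Y + x Y ^ (2 * m + 4) * y.xi Y := fun Y => by
    rw [← add_mul]
    exact mul_le_mul_of_nonneg_right (mixed_moment_le m (hx0 Y) (hc0 Y)).1 (hx Y)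
  have hNle : ∀ Y, x Y ^ (2 * m + 3) * c Y * y.xi Y ≤
      x Y ^ 2 * c Y ^ (2 * m + 2) * y.xi Y + x Y ^ (2 * m + 4) * y.xi Y := fun Y => by
    rw [← add_mul]
    exact mul_le_mul_of_nonneg_right (mixed_moment_le m (hx0 Y) (hc0 Y)).2 (hx Y)
  have hiM : Integrable fun Y => x Y ^ 3 * c Y ^ (2 * m + 1) * y.xi Y :=
    hab.mono' (by fun_prop) (ae_of_all _ fun Y => by
      rw [Real.norm_eq_abs, abs_of_nonneg (hM0 Y)]; exact hMle Y)
  have hiN : Integrable fun Y => x Y ^ (2 * m + 3) * c Y * y.xi Y :=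
    hab.mono' (by fun_prop) (ae_of_all _ fun Y => by
      rw [Real.norm_eq_abs, abs_of_nonneg (hN0 Y)]; exact hNle Y)
  have hF : ∫ Y, sinF (m + 1) (y.tr Y) = ∫ Y, x Y ^ (2 * m + 4) * y.xi Y :=
    integral_congr_ae (ae_of_all _ eS)
  have haE : ∫ Y, x Y ^ 2 * c Y ^ (2 * m + 2) * y.xi Y ≤ E := integral_mono hia hie hale
  have hF0 : 0 ≤ ∫ Y, x Y ^ (2 * m + 4) * y.xi Y := integral_nonneg hb0
  have habI : ∫ Y, (x Y ^ 2 * c Y ^ (2 * m + 2) * y.xi Y + x Y ^ (2 * m + 4) * y.xi Y) ≤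
      E + ∫ Y, x Y ^ (2 * m + 4) * y.xi Y := by
    rw [integral_add hia hib]; linarith
  have huE : ∀ Y, |y.u Y| ≤ 1 + E := fun Y => by
    refine abs_le_of_sq_le_sq ?_ (by linarith)
    nlinarith [hu Y]
  have h1E : 1 ≤ 1 + E := by linarith
  have hup : ∀ n Y, |y.u Y| ^ n ≤ (1 + E) ^ n := fun n Y =>
    pow_le_pow_left₀ (abs_nonneg _) (huE Y) n
  have hm0 : (0 : ℝ) ≤ m := Nat.cast_nonneg m
  have hk : ∀ Y Y', |kern (m + 1) y.v y.xi Y Y'| ≤ 1 := fun Y Y' => by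
    unfold kern
    rw [abs_of_pos (Real.exp_pos _)]
    exact Real.exp_le_one_iff.2 (neg_nonpos.2 (abs_nonneg _))
  have hdP : ∀ Y, |densP (m + 1) y.u y.v y.xi Y| ≤
      (1 + E) ^ (m + 1) * (m + 2) * energyF (m + 1) (y.tr Y) := fun Y => by
    have e : densP (m + 1) y.u y.v y.xi Y = y.u Y ^ (m + 1) * ((m + 3 / 2) * (x Y ^ 2 *
        c Y ^ (2 * m + 2) * y.xi Y) + y.u Y ^ 2 * c Y ^ (2 * m + 4) * y.xi Y) := by
      have h1 : c Y ^ (2 * m + 4) = Real.cos (y.v Y / 2) ^ (2 * m + 4) :=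
        Even.pow_abs ⟨m + 2, by ring⟩ _
      have h2 : c Y ^ (2 * m + 2) = Real.cos (y.v Y / 2) ^ (2 * m + 2) :=
        Even.pow_abs ⟨m + 1, by ring⟩ _
      have h3 : x Y ^ 2 = Real.sin (y.v Y / 2) ^ 2 := sq_abs _
      have h4 : expK (m + 1) - 2 = 2 * m + 2 := by unfold expK; omega
      have h5 : expK (m + 1) = 2 * m + 4 := by unfold expK; omega
      rw [h1, h2, h3]; unfold densP; rw [h4, h5]; push_cast; ring
    have hq := mul_nonneg (mul_nonneg (sq_nonneg (y.u Y)) (pow_nonneg (hc0 Y) (2 * m + 4))) (hx Y)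
    have hin : 0 ≤ (m + 3 / 2) * (x Y ^ 2 * c Y ^ (2 * m + 2) * y.xi Y) +
        y.u Y ^ 2 * c Y ^ (2 * m + 4) * y.xi Y :=
      add_nonneg (mul_nonneg (by linarith) (ha0 Y)) hq
    rw [e, abs_mul, abs_pow, abs_of_nonneg hin, mul_assoc ((1 + E) ^ (m + 1))]
    refine mul_le_mul (hup _ Y) ?_ hin (by positivity)
    rw [eE]
    nlinarith [ha0 Y, mul_nonneg hm0 hq]
  have hdQ : ∀ Y, |densQ (m + 1) y.u y.v y.xi Y| ≤
      (1 + E) ^ m * (x Y ^ 3 * c Y ^ (2 * m + 1) * y.xi Y) := fun Y => by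
    have h4 : expK (m + 1) - 3 = 2 * m + 1 := by unfold expK; omega
    unfold densQ
    rw [h4, abs_mul, abs_mul, abs_mul, abs_pow, abs_pow, abs_pow, abs_of_nonneg (hx Y),
      mul_assoc, mul_assoc, ← mul_assoc (|Real.sin (y.v Y / 2)| ^ 3)]
    exact mul_le_mul_of_nonneg_right (hup m Y) (hM0 Y)
  have hkd : ∀ (f g : ℝ → ℝ) Y, (∀ Z, |f Z| ≤ g Z) → ∀ Z,
      |kern (m + 1) y.v y.xi Y Z * f Z| ≤ g Z := fun f g Y h Z => by
    rw [abs_mul]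
    exact (mul_le_of_le_one_left (abs_nonneg _) (hk Y Z)).trans (h Z)
  have hEpow : (1 + E) ^ (m + 1) * E ≤ (1 + E) ^ (m + 3) := by
    have h1 : (1 + E) ^ (m + 1) * E ≤ (1 + E) ^ (m + 1) * (1 + E) := by gcongr; linarith
    have h2 : (1 + E) ^ (m + 1) * (1 + E) ≤ (1 + E) ^ (m + 3) := by
      rw [← pow_succ]; exact pow_le_pow_right₀ h1E (by omega)
    linarith
  have hMI0 : 0 ≤ ∫ Y, x Y ^ 3 * c Y ^ (2 * m + 1) * y.xi Y := integral_nonneg hM0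
  refine ⟨huE, fun Y => ?_, fun Y => ?_, integral_nonneg fun Y => hM0 Y, ?_, hiN, ?_, ?_, ?_, hE0⟩
  · have h1 := abs_integral_le_of_le (hie.const_mul ((1 + E) ^ (m + 1) * (m + 2))) (hkd _ _ Y hdP)
      univ (fun Z => mul_nonneg (by positivity) (he0 Z))
    rw [integral_const_mul, Measure.restrict_univ] at h1
    unfold P
    rw [abs_mul, abs_of_pos (by norm_num : (0 : ℝ) < 1 / 2)]
    have h2 := mul_le_mul_of_nonneg_left hEpow (show (0 : ℝ) ≤ m + 2 by positivity)
    push_cast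
    have h3 : 0 ≤ (m + 2 : ℝ) * (1 + E) ^ (m + 3) := by positivity
    have h4 : (1 + E) ^ (m + 1) * (m + 2) * E = (m + 2) * ((1 + E) ^ (m + 1) * E) := by ring
    rw [← hE, h4] at h1
    have h5 : ((m : ℝ) + 1 + 1) * (1 + E) ^ (m + 1 + 2) = (m + 2) * (1 + E) ^ (m + 3) := by ring
    rw [h5]
    linarith
  · have hb : ∀ S : Set ℝ, _ := fun S => abs_integral_le_of_le (hiM.const_mul ((1 + E) ^ m))
      (hkd _ _ Y hdQ) S (fun Z => mul_nonneg (by positivity) (hM0 Z))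
    have h1 := hb (Ioi Y)
    have h2 := hb (Iic Y)
    rw [integral_const_mul] at h1 h2
    unfold Qx
    rw [abs_mul, abs_of_nonneg (show (0 : ℝ) ≤ ((m + 1 : ℕ) : ℝ) / 4 by positivity)]
    have h3 := (abs_sub _ _).trans (add_le_add h1 h2)
    have h4 : (1 + E) ^ m ≤ (1 + E) ^ (m + 3) := pow_le_pow_right₀ h1E (by omega)
    have h5 := mul_le_mul_of_nonneg_right h4 hMI0
    have h6 := mul_le_mul_of_nonneg_left h3 (show (0 : ℝ) ≤ ((m + 1 : ℕ) : ℝ) / 4 by positivity)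
    refine h6.trans ?_
    have h7 : 0 ≤ (1 + E) ^ (m + 3) * ∫ Y, x Y ^ 3 * c Y ^ (2 * m + 1) * y.xi Y :=
      mul_nonneg (by positivity) hMI0
    have h8 : ∫ Y, cubicF (m + 1) (y.tr Y) = ∫ Y, x Y ^ 3 * c Y ^ (2 * m + 1) * y.xi Y := rfl
    have h9 : (1 + E) ^ (m + 1 + 2) = (1 + E) ^ (m + 3) := rfl
    rw [h8, h9]
    push_cast
    nlinarith [mul_nonneg hm0 h7, mul_le_mul_of_nonneg_left h5 hm0]
  · rw [hF]
    exact (integral_mono hiM hab hMle).trans habI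
  · rw [hF]
    exact (integral_mono hiN hab hNle).trans habI
  · rw [hF]
    exact (integral_mixed_moment_mul_le m hx0 hc0 hx hia hib hiM hiN).trans
      (mul_le_mul_of_nonneg_right haE hF0)
  · rw [hF]; exact hF0

/-! ### A priori bounds -/

theorem norm_le_exp_of_deriv {E : Type*} [NormedAddCommGroup E] [NormedSpace ℝ E] {f f' : ℝ → E}
    {T K : ℝ} (hd : ∀ t ∈ Icc 0 T, HasDerivWithinAt f (f' t) (Icc 0 T) t)
    (hK : ∀ t ∈ Icc 0 T, ‖f' t‖ ≤ K * ‖f t‖) {t : ℝ} (ht : t ∈ Icc 0 T) :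
    ‖f t‖ ≤ ‖f 0‖ * Real.exp (K * t) := by
  have := norm_le_gronwallBound_of_norm_deriv_right_le (f := f) (f' := f') (δ := ‖f 0‖) (K := K)
    (ε := 0) (a := 0) (b := T) (fun t ht => (hd t ht).continuousWithinAt)
    (fun x hx => (hd x ⟨hx.1, hx.2.le⟩).mono_of_mem_nhdsWithin (Icc_mem_nhdsGE_of_mem hx)) le_rfl
    (fun x hx => by simpa using hK x ⟨hx.1, hx.2.le⟩) t ht
  rwa [gronwallBound_ε0, sub_zero] at this

theorem norm_le_exp_of_deriv' {E : Type*} [NormedAddCommGroup E] [NormedSpace ℝ E] {f f' : ℝ → E}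
    {T T₁ K : ℝ} (hd : ∀ t ∈ Icc 0 T, HasDerivWithinAt f (f' t) (Icc 0 T) t)
    (hK : ∀ t ∈ Icc 0 T, ‖f' t‖ ≤ K * ‖f t‖) (hT : T ≤ T₁) (hK0 : 0 ≤ K) {t : ℝ}
    (ht : t ∈ Icc 0 T) : ‖f t‖ ≤ ‖f 0‖ * Real.exp (K * T₁) :=
  (norm_le_exp_of_deriv hd hK ht).trans (mul_le_mul_of_nonneg_left
    (Real.exp_le_exp.2 (mul_le_mul_of_nonneg_left (ht.2.trans hT) hK0)) (norm_nonneg _))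

section Solution

variable {l : ℕ} {z₀ : St} {T : ℝ} {z : ℝ → St}

theorem IsSol.deriv_sinF (h : IsSol (field l) St.good z₀ T z) {t : ℝ}
    (ht : t ∈ Icc 0 T) (Y : ℝ) :
    HasDerivWithinAt (fun s => sinF l ((z s).tr Y))
      (2 * ((l : ℝ) + 1) * (Real.sin ((z t).v Y / 2) ^ (2 * l + 1) * Real.cos ((z t).v Y / 2)
        * (z t).xi Y) * ((z t).u Y ^ (l + 2)
          - (P l (z t).u (z t).v (z t).xi Y + Qx l (z t).u (z t).v (z t).xi Y)))
      (Icc 0 T) t := by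
  obtain ⟨-, -, d3, -⟩ := h.deriv_fn ht Y
  obtain ⟨dS, -⟩ := h.deriv_trig ht Y
  have hd := (dS.pow (2 * l + 2)).mul d3
  have e : (fun s => sinF l ((z s).tr Y)) =
      (fun s => Real.sin ((z s).v Y / 2)) ^ (2 * l + 2) * fun s => (z s).xi Y := by
    funext s
    simp only [Pi.mul_apply, Pi.pow_apply]
    unfold sinF St.tr trip; ring
  rw [e]
  convert! hd using 1
  have hsc := Real.sin_sq_add_cos_sq ((z t).v Y / 2)
  unfold rhsV rhsXi
  rw [sin_eq_half ((z t).v Y)]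
  have e2 : 2 * l + 2 - 1 = 2 * l + 1 := by omega
  simp only [Pi.pow_apply, e2]
  set S := Real.sin ((z t).v Y / 2)
  set C := Real.cos ((z t).v Y / 2)
  set B := P l (z t).u (z t).v (z t).xi Y + Qx l (z t).u (z t).v (z t).xi Y
  set x := (z t).xi Y
  set uu := (z t).u Y
  have f1 : S ^ (2 * l + 2) = S ^ (2 * l) * S ^ 2 := by ring
  have f2 : S ^ (2 * l + 1) = S ^ (2 * l) * S := by ring
  have f6 : uu ^ (l + 2) = uu ^ l * uu ^ 2 := by ring
  rw [f1, f2, f6]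
  push_cast
  set X := S ^ (2 * l)
  set U := uu ^ l
  linear_combination (-2 * ((l : ℝ) + 1) * S * X * C * x * (U * uu ^ 2 - B)) * hsc

theorem IsSol.potBounds (hl : 1 ≤ l) (h : IsSol (field l) St.good z₀ T z)
    (hw : ∀ Y, z₀.w Y = slopeF l (z₀.tr Y)) (hp : IsPrim z₀.u z₀.w) (hT : 0 < T) {t : ℝ}
    (ht : t ∈ Icc 0 T) : PotBounds l (∫ Y, energyF l (z₀.tr Y)) (z t) := by
  obtain ⟨R, hR, hm⟩ := h.mem
  have hu := h.isPrim_u hp ht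
  have hwt : (z t).w = fun Y => slopeF l ((z t).tr Y) := funext (h.w_eq hw ht)
  rw [hwt] at hu
  rw [← h.energy_eq hl hw hp hT ht]
  exact St.potBounds hl hR (hm t ht) (St.sq_le_energy l hR (hm t ht) hu)

theorem IsSol.integral_sinF_le (hl : 1 ≤ l) (h : IsSol (field l) St.good z₀ T z)
    (hw : ∀ Y, z₀.w Y = slopeF l (z₀.tr Y)) (hp : IsPrim z₀.u z₀.w) (hT : 0 < T) {E T₁ : ℝ}
    (hE : E = ∫ Y, energyF l (z₀.tr Y)) (hT₁ : T ≤ T₁) {t : ℝ} (ht : t ∈ Icc 0 T) :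
    E + ∫ Y, sinF l ((z t).tr Y) ≤ (E + ∫ Y, sinF l (z₀.tr Y)) *
      Real.exp (2 * ((l : ℝ) + 1) * ((l : ℝ) + 2) * (1 + E) ^ (l + 3) * T₁) := by
  subst hE
  set E := ∫ Y, energyF l (z₀.tr Y)
  have hpb : ∀ t ∈ Icc 0 T, PotBounds l E (z t) := fun t ht => h.potBounds hl hw hp hT ht
  have hE0 : 0 ≤ E := (hpb t ht).E_nonneg
  have hl0 : (0 : ℝ) ≤ l := Nat.cast_nonneg l
  have hd : ∀ t ∈ Icc 0 T, HasDerivWithinAt (fun t => E + ∫ Y, sinF l ((z t).tr Y)) _ (Icc 0 T) t :=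
    fun t ht => ((h.hasDerivWithinAt_integral hT (isQ_sinF l)
      (fun t ht Y => h.deriv_sinF ht Y) ht).2).const_add E
  have h0 : ∀ t ∈ Icc 0 T, ‖E + ∫ Y, sinF l ((z t).tr Y)‖ = E + ∫ Y, sinF l ((z t).tr Y) :=
    fun t ht => by
      rw [Real.norm_eq_abs, abs_of_nonneg (add_nonneg hE0 (hpb t ht).sin_nonneg)]
  have := norm_le_exp_of_deriv' hd (K := 2 * ((l : ℝ) + 1) * ((l : ℝ) + 2) * (1 + E) ^ (l + 3))
    (fun t ht => ?_) hT₁ (by positivity) ht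
  · rwa [h0 t ht, h0 0 ⟨le_rfl, ht.1.trans ht.2⟩, h.init] at this
  · rw [h0 t ht]
    have hb := hpb t ht
    set F := ∫ Y, sinF l ((z t).tr Y)
    set M := ∫ Y, cubicF l ((z t).tr Y)
    set N := ∫ Y, crossF l ((z t).tr Y)
    set W := (1 + E) ^ (l + 2) with hW
    have hW0 : 0 ≤ W := by positivity
    have hMe := hb.cubic_nonneg
    obtain ⟨R, hR, hm⟩ := h.mem
    have hxi : ∀ Y, 0 ≤ (z t).xi Y := fun Y => ((St.adm hR (hm t ht)).xi_pos (by positivity) Y).le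
    have hle : ∀ Y, ‖2 * ((l : ℝ) + 1) * (Real.sin ((z t).v Y / 2) ^ (2 * l + 1)
        * Real.cos ((z t).v Y / 2) * (z t).xi Y) * ((z t).u Y ^ (l + 2)
          - (P l (z t).u (z t).v (z t).xi Y + Qx l (z t).u (z t).v (z t).xi Y))‖ ≤
        2 * ((l : ℝ) + 1) * (((l : ℝ) + 2) * W * (1 + M)) * crossF l ((z t).tr Y) := fun Y => by
      rw [Real.norm_eq_abs, abs_mul, abs_mul (2 * ((l : ℝ) + 1)), abs_mul _ ((z t).xi Y),
        abs_mul (Real.sin _ ^ _), abs_pow, abs_of_nonneg (hxi Y),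
        abs_of_nonneg (show 0 ≤ 2 * ((l : ℝ) + 1) by positivity)]
      have i1 : |(z t).u Y ^ (l + 2)| ≤ W := by
        rw [abs_pow]; exact pow_le_pow_left₀ (abs_nonneg _) (hb.u_le Y) _
      have i2 := hb.P_le Y
      have i3 := hb.Qx_le Y
      have i4 : |(z t).u Y ^ (l + 2)
          - (P l (z t).u (z t).v (z t).xi Y + Qx l (z t).u (z t).v (z t).xi Y)| ≤
          ((l : ℝ) + 2) * W * (1 + M) := by
        refine (abs_sub _ _).trans ?_
        have := abs_add_le (P l (z t).u (z t).v (z t).xi Y) (Qx l (z t).u (z t).v (z t).xi Y)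
        have : 0 ≤ W * M := mul_nonneg hW0 hMe
        nlinarith
      have i5 : 0 ≤ crossF l ((z t).tr Y) :=
        mul_nonneg (mul_nonneg (pow_nonneg (abs_nonneg _) _) (abs_nonneg _)) (hxi Y)
      have i6 := mul_le_mul_of_nonneg_left i4 (mul_nonneg (show 0 ≤ 2 * ((l : ℝ) + 1) by positivity) i5)
      refine Eq.trans_le ?_ (i6.trans (le_of_eq ?_))
      · unfold crossF St.tr trip; ring
      · ring
    refine (norm_integral_le_of_norm_le (hb.cross_int.const_mul _) (ae_of_all _ hle)).trans ?_
    rw [integral_const_mul]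
    have j1 := hb.cross_le
    have j2 := hb.mul_le
    have j3 := hb.sin_nonneg
    have j4 : (1 + M) * N ≤ (1 + E) * (E + F) := by
      nlinarith [mul_nonneg hE0 hE0, mul_nonneg hE0 j3]
    have j5 := mul_le_mul_of_nonneg_left j4
      (show 0 ≤ 2 * ((l : ℝ) + 1) * ((l : ℝ) + 2) * W by positivity)
    have e : (1 + E) ^ (l + 3) = W * (1 + E) := by rw [hW]; ring
    rw [e]
    linarith

theorem apriori_bound (hl : 1 ≤ l) (hw : ∀ Y, z₀.w Y = slopeF l (z₀.tr Y))
    (hp : IsPrim z₀.u z₀.w) (hx : ∀ Y, z₀.xi Y = 1) (T₁ : ℝ) (hT₁ : 0 ≤ T₁) :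
    ∃ R, 0 < R ∧ ∀ T ∈ Icc 0 T₁, ∀ z, IsSol (field l) St.good z₀ T z →
      ∀ t ∈ Icc 0 T, z t ∈ St.good R := by
  have hl0 : (0 : ℝ) ≤ l := Nat.cast_nonneg l
  have hx0 : ∀ Y, 0 ≤ (z₀.tr Y).2.2 := fun Y => by
    show 0 ≤ z₀.xi Y
    rw [hx]; exact zero_le_one
  set E := ∫ Y, energyF l (z₀.tr Y) with hE
  have hE0 : 0 ≤ E := integral_nonneg fun Y => energyF_nonneg l (hx0 Y)
  set G := (E + ∫ Y, sinF l (z₀.tr Y)) *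
      Real.exp (2 * ((l : ℝ) + 1) * ((l : ℝ) + 2) * (1 + E) ^ (l + 3) * T₁) with hG
  set N := (1 + E) ^ (l + 2) with hN
  have hN1 : 1 ≤ N := one_le_pow₀ (by linarith)
  set B := ((l : ℝ) + 1) * N * (1 + |G|) with hB
  have hB0 : 0 ≤ B := by positivity
  set V := 2 * ((l : ℝ) + 1) * (2 * N + B) with hV
  have hV0 : 0 ≤ V := by positivity
  set X := Real.exp (V * T₁) with hX
  have hX1 : 1 ≤ X := Real.one_le_exp (by positivity)
  set R₁ := 1 + E + ‖z₀‖ + V * T₁ + X + 2 ^ (l + 1) * X * |G| with hR₁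
  have hR₁0 : 0 < R₁ := by positivity
  obtain ⟨C, hC, hrhs, -⟩ := exists_rhs_Bd l hR₁0
  refine ⟨‖z₀‖ * Real.exp (C * T₁) + X, by positivity, fun T hT z h t ht => ?_⟩
  have hRinv : 1 / (‖z₀‖ * Real.exp (C * T₁) + X) ≤ 1 / X :=
    one_div_le_one_div_of_le (by positivity) (le_add_of_nonneg_left (by positivity))
  rcases eq_or_lt_of_le hT.1 with hT0 | hT0
  · have ht0 : t = 0 := le_antisymm (ht.2.trans hT0.symm.le) ht.1
    rw [ht0, h.init]
    refine ⟨?_, fun Y => ?_⟩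
    · have := le_mul_of_one_le_right (norm_nonneg z₀) (Real.one_le_exp (mul_nonneg hC hT₁))
      linarith
    · rw [hx]
      refine hRinv.trans ?_
      rw [div_le_one (by positivity)]; exact hX1
  have hpb : ∀ t ∈ Icc 0 T, PotBounds l E (z t) := fun t ht => h.potBounds hl hw hp hT0 ht
  have hsin : ∀ t ∈ Icc 0 T, E + ∫ Y, sinF l ((z t).tr Y) ≤ |G| := fun t ht =>
    (h.integral_sinF_le hl hw hp hT0 hE hT.2 ht).trans (le_abs_self _)
  have hPQ : ∀ t ∈ Icc 0 T, ∀ Y,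
      |P l (z t).u (z t).v (z t).xi Y + Qx l (z t).u (z t).v (z t).xi Y| ≤ B := fun t ht Y => by
    have hb := hpb t ht
    refine (abs_add_le _ _).trans ?_
    have h1 := hb.P_le Y
    have h2 := hb.Qx_le Y
    have h3 := hb.cubic_le.trans (hsin t ht)
    have h4 := mul_le_mul_of_nonneg_left h3 (show 0 ≤ ((l : ℝ) + 1) * N by positivity)
    rw [hB]; linarith
  obtain ⟨R, hR, hm⟩ := h.mem
  have hR' : 0 < 1 + R + R ^ 2 := by positivity
  have hxp : ∀ t ∈ Icc 0 T, ∀ Y, 0 < (z t).xi Y := fun t ht Y => (St.adm hR (hm t ht)).xi_pos hR' Y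
  have hul : ∀ t ∈ Icc 0 T, ∀ Y, |(z t).u Y ^ l| ≤ N ∧ |(z t).u Y ^ (l + 2)| ≤ N :=
    fun t ht Y => by
      have hb := (hpb t ht).u_le Y
      rw [abs_pow, abs_pow]
      exact ⟨(pow_le_pow_left₀ (abs_nonneg _) hb _).trans
        (pow_le_pow_right₀ (by linarith) (by omega)), pow_le_pow_left₀ (abs_nonneg _) hb _⟩
  have hrx : ∀ t ∈ Icc 0 T, ∀ Y, |rhsXi l (z t).u (z t).v (z t).xi Y| ≤ V * (z t).xi Y :=
    fun t ht Y => by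
      obtain ⟨a1, a2⟩ := hul t ht Y
      have a3 := hPQ t ht Y
      have a4 := Real.abs_sin_le_one ((z t).v Y)
      have e : rhsXi l (z t).u (z t).v (z t).xi Y = (((l : ℝ) + 1) * Real.sin ((z t).v Y) *
          ((z t).u Y ^ l / 2 + (z t).u Y ^ (l + 2) -
          (P l (z t).u (z t).v (z t).xi Y + Qx l (z t).u (z t).v (z t).xi Y))) * (z t).xi Y := by
        unfold rhsXi; ring
      rw [e, abs_mul, abs_of_pos (hxp t ht Y), abs_mul, abs_mul,
        abs_of_nonneg (show 0 ≤ (l : ℝ) + 1 by positivity)]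
      refine mul_le_mul_of_nonneg_right ?_ (hxp t ht Y).le
      have a5 : |(z t).u Y ^ l / 2 + (z t).u Y ^ (l + 2) -
          (P l (z t).u (z t).v (z t).xi Y + Qx l (z t).u (z t).v (z t).xi Y)| ≤ 2 * (2 * N + B) := by
        rw [abs_le] at a1 a2 a3 ⊢
        constructor <;> linarith
      have a6 : |Real.sin ((z t).v Y)| * |(z t).u Y ^ l / 2 + (z t).u Y ^ (l + 2) -
          (P l (z t).u (z t).v (z t).xi Y + Qx l (z t).u (z t).v (z t).xi Y)| ≤
          1 * (2 * (2 * N + B)) := mul_le_mul a4 a5 (abs_nonneg _) zero_le_one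
      have a7 := mul_le_mul_of_nonneg_left a6 (show 0 ≤ (l : ℝ) + 1 by positivity)
      rw [hV]; linarith
  have hrv : ∀ t ∈ Icc 0 T, ∀ Y, |rhsV l (z t).u (z t).v (z t).xi Y| ≤ V := fun t ht Y => by
    obtain ⟨a1, a2⟩ := hul t ht Y
    have a3 := hPQ t ht Y
    have hsc := Real.sin_sq_add_cos_sq ((z t).v Y / 2)
    set S := Real.sin ((z t).v Y / 2) ^ 2
    set c := Real.cos ((z t).v Y / 2) ^ 2
    have e : rhsV l (z t).u (z t).v (z t).xi Y = -(S * (z t).u Y ^ l) + 2 * (c *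
        ((z t).u Y ^ (l + 2) - (P l (z t).u (z t).v (z t).xi Y + Qx l (z t).u (z t).v (z t).xi Y))) := by
      unfold rhsV; ring
    have hS : 0 ≤ S := sq_nonneg _
    have hc : 0 ≤ c := sq_nonneg _
    have b1 : |S * (z t).u Y ^ l| ≤ 1 * N := by
      rw [abs_mul, abs_of_nonneg hS]
      exact mul_le_mul (by linarith) a1 (abs_nonneg _) zero_le_one
    have b2 : |c * ((z t).u Y ^ (l + 2) -
        (P l (z t).u (z t).v (z t).xi Y + Qx l (z t).u (z t).v (z t).xi Y))| ≤ 1 * (N + B) := by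
      rw [abs_mul, abs_of_nonneg hc]
      exact mul_le_mul (by linarith) ((abs_sub _ _).trans (add_le_add a2 a3)) (abs_nonneg _) zero_le_one
    have b3 : |rhsV l (z t).u (z t).v (z t).xi Y| ≤ 2 * (2 * N + B) := by
      rw [e]
      rw [abs_le] at b1 b2 ⊢
      constructor <;> linarith
    have b4 : 0 ≤ (l : ℝ) * (2 * (2 * N + B)) := by positivity
    rw [hV]; linarith
  have hxi : ∀ t ∈ Icc 0 T, ∀ Y, (z t).xi Y ≤ X ∧ 1 / X ≤ (z t).xi Y := fun t ht Y => by
    have h0 : (0 : ℝ) ∈ Icc 0 T := ⟨le_rfl, hT.1⟩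
    have e0 : (z 0).xi Y = 1 := by rw [h.init, hx]
    constructor
    · have := norm_le_exp_of_deriv' (f := fun t => (z t).xi Y) (K := V)
        (fun t ht => (h.deriv_fn ht Y).2.2.1) (fun t ht => by
          rw [Real.norm_eq_abs, Real.norm_eq_abs, abs_of_pos (hxp t ht Y)]
          exact hrx t ht Y) hT.2 hV0 ht
      simp only [e0, norm_one, one_mul] at this
      exact (le_abs_self _).trans this
    · have := norm_le_exp_of_deriv' (f := fun t => ((z t).xi Y)⁻¹) (K := V)
        (fun t ht => (h.deriv_fn ht Y).2.2.1.inv (hxp t ht Y).ne') (fun t ht => by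
          have hp := hxp t ht Y
          rw [Real.norm_eq_abs, Real.norm_eq_abs, abs_div, abs_neg, abs_inv, abs_of_pos hp,
            abs_of_nonneg (sq_nonneg ((z t).xi Y)), div_le_iff₀ (by positivity)]
          refine (hrx t ht Y).trans (le_of_eq ?_)
          field_simp) hT.2 hV0 ht
      simp only [e0, inv_one, norm_one, one_mul] at this
      have h2 := (le_abs_self _).trans this
      rw [one_div]
      exact inv_le_of_inv_le₀ (hxp t ht Y) h2
  have hadm : ∀ t ∈ Icc 0 T, Adm R₁ (z t).u (z t).v (z t).xi := fun t ht => by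
    have ha := St.adm hR (hm t ht)
    have hXp : 0 < X := by positivity
    have hVT : 0 ≤ V * T₁ := mul_nonneg hV0 hT₁
    have h2X : 0 ≤ 2 ^ (l + 1) * X * |G| := by positivity
    have hz0 := norm_nonneg z₀
    refine ⟨ha.meas_u, ha.meas_v, ha.meas_xi, fun Y => ((hpb t ht).u_le Y).trans (by linarith),
      fun Y => ?_, fun Y => (hxi t ht Y).1.trans (by linarith),
      fun Y => (one_div_le_one_div_of_le hXp (by linarith)).trans (hxi t ht Y).2, ?_⟩
    · have h1 := abs_sub_le_of_deriv_le (fun t ht => (h.deriv_fn ht Y).2.1)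
        (fun t ht => hrv t ht Y) (s := 0) ⟨le_rfl, hT.1⟩ ht
      have h2 := z₀.bd_v.bound Y
      rw [h.init, zero_sub, abs_neg, abs_of_nonneg ht.1] at h1
      have h3 := mul_le_mul_of_nonneg_left (ht.2.trans hT.2) hV0
      rw [abs_le] at h1 h2 ⊢
      constructor <;> linarith
    · set ε : ℝ := (1 / 2) ^ (l + 1) * (1 / X) with hε
      have hε0 : 0 < ε := by positivity
      have hsub : {Y | Real.cos ((z t).v Y / 2) ^ 2 < 1 / 2} ⊆ {Y | ε ≤ sinF l ((z t).tr Y)} := by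
        intro Y hY
        simp only [mem_ofPred_eq] at hY ⊢
        have hsc := Real.sin_sq_add_cos_sq ((z t).v Y / 2)
        have e : sinF l ((z t).tr Y) =
            (Real.sin ((z t).v Y / 2) ^ 2) ^ (l + 1) * (z t).xi Y := by
          unfold sinF St.tr trip; ring
        rw [e, hε]
        have := (hxi t ht Y).2
        gcongr
        linarith
      have hi := (isQ_sinF l).integrable hR (hm t ht)
      have hs0 : ∀ Y, 0 ≤ sinF l ((z t).tr Y) := fun Y => by
        have e : sinF l ((z t).tr Y) =
            (Real.sin ((z t).v Y / 2) ^ 2) ^ (l + 1) * (z t).xi Y := by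
          unfold sinF St.tr trip; ring
        rw [e]
        have := hxp t ht Y
        positivity
      have hmk := mul_meas_ge_le_integral_of_nonneg (ae_of_all _ hs0) hi ε
      have hfin := hi.measure_ge_lt_top hε0
      refine (measure_mono hsub).trans ?_
      rw [← ENNReal.ofReal_toReal hfin.ne]
      refine ENNReal.ofReal_le_ofReal ?_
      have h1 : ∫ Y, sinF l ((z t).tr Y) ≤ |G| := by linarith [hsin t ht]
      have h2 := hmk.trans h1
      have h3 : (volume {Y | ε ≤ sinF l ((z t).tr Y)}).toReal ≤ 2 ^ (l + 1) * X * |G| := by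
        rw [mul_comm, ← le_div_iff₀ hε0] at h2
        refine h2.trans (le_of_eq ?_)
        rw [hε, one_div, inv_pow]; field_simp
      linarith
  have hnorm : ‖z t‖ ≤ ‖z₀‖ * Real.exp (C * T₁) := by
    rw [← h.init]
    refine norm_le_exp_of_deriv' h.deriv (fun t ht => ?_) hT.2 hC ht
    obtain ⟨h1, h2, h3, h4⟩ := hrhs _ _ _ (hadm t ht) _ (z t).bd_u (z t).bd_v
    obtain ⟨e1, e2, e3, e4⟩ := field_fn l hR (hm t ht)
    exact St.norm_le (BS.norm_le (by rwa [e1])) (BS.norm_le (by rwa [e2]))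
      (BS.norm_le (by rwa [e3])) (BS.norm_le (by rwa [e4]))
  exact ⟨hnorm.trans (le_add_of_nonneg_right (by positivity)), fun Y => hRinv.trans (hxi t ht Y).2⟩

/-- Global solutions of the extended system. -/
theorem exists_global_field (hl : 1 ≤ l) (hw : ∀ Y, z₀.w Y = slopeF l (z₀.tr Y))
    (hp : IsPrim z₀.u z₀.w) (hx : ∀ Y, z₀.xi Y = 1) :
    ∃ z : ℝ → St, z 0 = z₀ ∧ (∀ t, 0 ≤ t → HasDerivWithinAt z (field l (z t)) (Ici 0) t) ∧
      (∀ t, 0 ≤ t → IsPrim (z t).u (z t).w) ∧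
      ∀ T, 0 ≤ T → ∃ R, 0 < R ∧ ∀ t ∈ Icc 0 T, z t ∈ St.good R := by
  have hap := apriori_bound hl hw hp hx
  obtain ⟨z, h1, h2, h3⟩ := exists_global_solution St.good_mono (field_lipschitz l)
    (field_bounded l) St.good_ball (x₀ := z₀) ⟨1 + ‖z₀‖, by positivity, by linarith, fun Y => by
      rw [hx, div_le_one (by positivity)]; linarith [norm_nonneg z₀]⟩ hap
  refine ⟨z, h1, h2, fun t ht => (h3 t ht).isPrim_u hp ⟨ht, le_rfl⟩, fun T hT => ?_⟩
  exact (h3 T hT).mem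

end Solution

/-! ### The initial data -/

theorem IsPrim.sq_le_integral {f g : ℝ → ℝ} (h : IsPrim f g) (hf : MemLp f 2 volume)
    (hg : MemLp g 2 volume) (x : ℝ) : f x ^ 2 ≤ (∫ y, f y ^ 2) + ∫ y, g y ^ 2 := by
  have if2 := hf.integrable_sq
  have ig2 := hg.integrable_sq
  have hi2 : Integrable fun y => ((1 : ℕ) + 1 : ℝ) * f y ^ 1 * g y := by
    convert! (hf.integrable_mul hg).const_mul 2 using 2
    simp only [Pi.mul_apply]; push_cast; ring
  have hprim := h.pow 1
  have ht2 := (hprim.tendsto_atBot if2 hi2).const_sub (f x ^ (1 + 1))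
  rw [sub_zero] at ht2
  refine le_of_tendsto ht2 ((eventually_le_atBot x).mono fun a ha => ?_)
  rw [hprim.sub_eq a x, intervalIntegral.integral_of_le ha, ← integral_add if2 ig2]
  calc _ ≤ ∫ y in Ioc a x, (f y ^ 2 + g y ^ 2) :=
        setIntegral_mono hi2.integrableOn (if2.add ig2).integrableOn fun y => by
          push_cast; nlinarith [sq_nonneg (f y - g y)]
    _ ≤ _ := setIntegral_le_integral (if2.add ig2) (ae_of_all _ fun y => by positivity)

theorem abs_arctan_le_abs (x : ℝ) : |Real.arctan x| ≤ |x| := by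
  have := Convex.norm_image_sub_le_of_norm_deriv_le (f := Real.arctan) (C := 1) (s := univ)
    (fun y _ => Real.differentiable_arctan y) (fun y _ => by
      rw [Real.deriv_arctan, Real.norm_eq_abs, abs_of_nonneg (by positivity)]
      rw [div_le_one (by positivity)]
      nlinarith [sq_nonneg y]) convex_univ (mem_univ 0) (mem_univ x)
  simpa using this

theorem exists_Bd {h : ℝ → ℝ} {M : ℝ} (hm : Measurable h) (hb : ∀ Y, |h Y| ≤ M)
    (hi : Integrable fun Y => h Y ^ 2) : ∃ C, Bd C h := by
  have hL := (memLp_two_iff_integrable_sq hm.aestronglyMeasurable).2 hi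
  refine ⟨max M (eLpNorm h 2 volume).toReal, hm, fun Y => (hb Y).trans (le_max_left _ _), ?_⟩
  exact (ENNReal.ofReal_toReal hL.eLpNorm_ne_top).symm.le.trans
    (ENNReal.ofReal_le_ofReal (le_max_right _ _))

section CharCoord

variable {l : ℕ} {g : ℝ → ℝ}

/-- The Jacobian of the characteristic coordinate. -/
def charDens (l : ℕ) (g : ℝ → ℝ) (x : ℝ) : ℝ := (1 + g x ^ 2) ^ (l + 1)

theorem one_le_charDens (l : ℕ) (g : ℝ → ℝ) (x : ℝ) : 1 ≤ charDens l g x :=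
  one_le_pow₀ (by nlinarith [sq_nonneg (g x)])

theorem charDens_le (l : ℕ) (g : ℝ → ℝ) (x : ℝ) :
    charDens l g x ≤ 2 ^ (l + 1) * (1 + g x ^ expK l) := by
  have h0 : 0 ≤ g x ^ 2 := sq_nonneg _
  have e : g x ^ expK l = (g x ^ 2) ^ (l + 1) := by unfold expK; rw [pow_mul]
  rw [e]
  unfold charDens
  rcases le_total (g x ^ 2) 1 with h | h
  · have h1 : (1 + g x ^ 2) ^ (l + 1) ≤ 2 ^ (l + 1) := pow_le_pow_left₀ (by linarith) (by linarith) _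
    have : 0 ≤ (2 : ℝ) ^ (l + 1) * (g x ^ 2) ^ (l + 1) := by positivity
    linarith
  · have h1 : (1 + g x ^ 2) ^ (l + 1) ≤ (2 * g x ^ 2) ^ (l + 1) :=
      pow_le_pow_left₀ (by linarith) (by linarith) _
    rw [mul_pow] at h1
    have : 0 ≤ (2 : ℝ) ^ (l + 1) := by positivity
    linarith

theorem measurable_charDens (l : ℕ) (hg : Measurable g) : Measurable (charDens l g) := by
  unfold charDens; fun_prop

theorem integrable_pow_expK (l : ℕ) (hg : MemLp g (expK l : ℝ≥0∞) volume) :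
    Integrable fun x => g x ^ expK l := by
  have := hg.integrable_norm_pow (by unfold expK; omega)
  refine this.congr (ae_of_all _ fun x => ?_)
  exact (even_expK l).pow_abs (g x)

theorem locallyIntegrable_charDens (hg : Measurable g) (hk : MemLp g (expK l : ℝ≥0∞) volume) :
    LocallyIntegrable (charDens l g) volume := by
  have h1 : LocallyIntegrable (fun x => 2 ^ (l + 1) * (1 + g x ^ expK l)) volume :=
    ((locallyIntegrable_const (1 : ℝ)).add
      (integrable_pow_expK l hk).locallyIntegrable).smul ((2 : ℝ) ^ (l + 1))
  refine h1.mono (measurable_charDens l hg).aestronglyMeasurable (ae_of_all _ fun x => ?_)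
  rw [Real.norm_eq_abs, Real.norm_eq_abs, abs_of_nonneg (zero_le_one.trans (one_le_charDens l g x))]
  exact (charDens_le l g x).trans (le_abs_self _)

theorem charCoord_eq (l : ℕ) (g : ℝ → ℝ) (x : ℝ) :
    charCoord l g x = ∫ s in (0 : ℝ)..x, charDens l g s := by
  unfold charCoord charDens expK
  simp

theorem charCoord_congr {g' : ℝ → ℝ} (h : g =ᵐ[volume] g') : charCoord l g = charCoord l g' := by
  funext x
  exact intervalIntegral.integral_congr_ae (h.mono fun s hs _ => by rw [hs])

/-- The characteristic coordinate is an order isomorphism of the line with inverse `x0`, which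
carries Lebesgue measure to the measure with density `charDens`. -/
theorem exists_charIso (hg : Measurable g) (hk : MemLp g (expK l : ℝ≥0∞) volume) :
    ∃ e : ℝ ≃o ℝ, (⇑e.symm = x0 l g) ∧ MeasurePreserving (x0 l g) volume
      (volume.withDensity fun x => ENNReal.ofReal (charDens l g x)) := by
  have hli := locallyIntegrable_charDens hg hk
  have hprim : IsPrim (charCoord l g) (charDens l g) := by
    have := IsPrim.of_integral hli 0
    rwa [← funext (charCoord_eq l g)] at this
  have hsub : ∀ a b, a ≤ b → b - a ≤ charCoord l g b - charCoord l g a := fun a b hab => by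
    rw [hprim.sub_eq a b]
    have := intervalIntegral.integral_mono_on hab (f := fun _ => (1 : ℝ))
      intervalIntegrable_const (LocallyIntegrable.ii hli a b) fun x _ => one_le_charDens l g x
    simpa using this
  have hmono : StrictMono (charCoord l g) := fun a b hab => by
    linarith [hsub a b hab.le]
  have h0 : charCoord l g 0 = 0 := by rw [charCoord_eq]; simp
  have htop : Tendsto (charCoord l g) atTop atTop :=
    tendsto_atTop_mono' _ ((eventually_ge_atTop 0).mono fun x hx => by
      have := hsub 0 x hx; rw [h0] at this; simpa using this) tendsto_id
  have hbot : Tendsto (charCoord l g) atBot atBot :=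
    tendsto_atBot_mono' _ ((eventually_le_atBot 0).mono fun x hx => by
      have := hsub x 0 hx; rw [h0] at this
      show charCoord l g x ≤ id x
      simp only [id]; linarith) tendsto_id
  set e : ℝ ≃o ℝ := hmono.orderIsoOfSurjective _ (hprim.continuous.surjective htop hbot) with he
  have hecoe : ∀ x, e x = charCoord l g x := fun x => rfl
  have hinv : ⇑e.symm = x0 l g := by
    funext Y
    have h1 : x0 l g (charCoord l g (e.symm Y)) = e.symm Y :=
      Function.leftInverse_invFun hmono.injective _
    rw [← hecoe, e.apply_symm_apply] at h1
    exact h1.symm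
  have hdm : Measurable fun x => ENNReal.ofReal (charDens l g x) :=
    (measurable_charDens l hg).ennreal_ofReal
  have hpos : ∀ x, 0 ≤ charDens l g x := fun x => zero_le_one.trans (one_le_charDens l g x)
  have hmp : MeasurePreserving e (volume.withDensity fun x => ENNReal.ofReal (charDens l g x))
      volume := by
    refine ⟨e.continuous.measurable, Eq.symm (Real.measure_ext_Ioo_rat fun a b => ?_)⟩
    rw [Measure.map_apply e.continuous.measurable measurableSet_Ioo, OrderIso.preimage_Ioo,
      withDensity_apply _ measurableSet_Ioo, Real.volume_Ioo]
    rcases le_total (b : ℝ) a with hab | hab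
    · rw [Ioo_eq_empty (not_lt.2 (e.symm.monotone hab)), ENNReal.ofReal_of_nonpos (by linarith)]
      simp
    · have hle := e.symm.monotone hab
      rw [← ofReal_integral_eq_lintegral_ofReal
        ((LocallyIntegrable.ii hli _ _).1.mono_set Ioo_subset_Ioc_self) (ae_of_all _ hpos),
        ← integral_Ioc_eq_integral_Ioo, ← intervalIntegral.integral_of_le hle,
        ← hprim.sub_eq, ← hecoe, ← hecoe, e.apply_symm_apply, e.apply_symm_apply]
  refine ⟨e, hinv, ?_⟩
  rw [← hinv]
  exact hmp.symm e.toHomeomorph.toMeasurableEquiv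

theorem exists_initial_of_measurable {u : ℝ → ℝ} (hg : Measurable g) (hp : IsPrim u g)
    (hu2 : MemLp u 2 volume) (hg2 : MemLp g 2 volume) (hk : MemLp g (expK l : ℝ≥0∞) volume) :
    ∃ z₀ : St, (∀ Y, z₀.u Y = u (x0 l g Y)) ∧ (∀ Y, z₀.v Y = 2 * Real.arctan (g (x0 l g Y))) ∧
      (∀ Y, z₀.xi Y = 1) ∧ (∀ Y, z₀.w Y = slopeF l (z₀.tr Y)) ∧ IsPrim z₀.u z₀.w := by
  obtain ⟨e, he, hmp⟩ := exists_charIso hg hk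
  have hpos : ∀ x, 0 ≤ charDens l g x := fun x => zero_le_one.trans (one_le_charDens l g x)
  have hdm : Measurable fun x => ENNReal.ofReal (charDens l g x) :=
    (measurable_charDens l hg).ennreal_ofReal
  have hXm : Measurable (x0 l g) := hmp.measurable
  have hXe : MeasurableEmbedding (x0 l g) := by
    rw [← he]; exact e.symm.toHomeomorph.measurableEmbedding
  have hcu := hp.continuous
  have hik := integrable_pow_expK l hk
  have comp : ∀ (h : ℝ → ℝ) (A : ℝ), Measurable h → (∀ x, h x ^ 2 ≤ A) →
      Integrable (fun x => h x ^ 2) → Integrable fun Y => h (x0 l g Y) ^ 2 := by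
    intro h A hm hA hi
    refine (hmp.integrable_comp_emb hXe (g := fun x => h x ^ 2)).2
      ((integrable_withDensity_iff hdm (ae_of_all _ fun x => ENNReal.ofReal_lt_top)).2 ?_)
    refine ((hi.add (hik.const_mul A)).const_mul (2 ^ (l + 1))).mono'
      (by have := measurable_charDens l hg; fun_prop) (ae_of_all _ fun x => ?_)
    rw [ENNReal.toReal_ofReal (hpos x), Real.norm_eq_abs, abs_of_nonneg (by
      have := hpos x; positivity)]
    have h1 := mul_le_mul_of_nonneg_left (charDens_le l g x) (sq_nonneg (h x))
    have h2 := mul_le_mul_of_nonneg_right (hA x) ((even_expK l).pow_nonneg (g x))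
    have h3 := mul_le_mul_of_nonneg_left h2 (show (0 : ℝ) ≤ 2 ^ (l + 1) by positivity)
    simp only [Pi.add_apply]
    linarith
  have hub := hp.sq_le_integral hu2 hg2
  set A := (∫ y, u y ^ 2) + ∫ y, g y ^ 2 with hA
  have hA0 : 0 ≤ A := (sq_nonneg _).trans (hub 0)
  obtain ⟨Cu, hCu⟩ : ∃ C, Bd C fun Y => u (x0 l g Y) :=
    exists_Bd (M := 1 + A) (hcu.measurable.comp hXm) (fun Y => by
      refine abs_le_of_sq_le_sq ?_ (by linarith)
      nlinarith [hub (x0 l g Y)]) (comp u A hcu.measurable hub hu2.integrable_sq)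
  have harc : ∀ x, |2 * Real.arctan (g x)| ≤ Real.pi := fun x => by
    have h1 := Real.arctan_lt_pi_div_two (g x)
    have h2 := Real.neg_pi_div_two_lt_arctan (g x)
    rw [abs_le]; constructor <;> linarith
  have hiarc : Integrable fun x => (2 * Real.arctan (g x)) ^ 2 := by
    refine (hg2.integrable_sq.const_mul 4).mono' (by
      have := Real.measurable_arctan; fun_prop) (ae_of_all _ fun x => ?_)
    rw [Real.norm_eq_abs, abs_of_nonneg (sq_nonneg _), mul_pow]
    have := sq_le_sq.2 (abs_arctan_le_abs (g x))
    linarith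
  obtain ⟨Cv, hCv⟩ : ∃ C, Bd C fun Y => 2 * Real.arctan (g (x0 l g Y)) :=
    exists_Bd (M := Real.pi) (by have := Real.measurable_arctan; fun_prop) (fun Y => harc _)
      (comp (fun x => 2 * Real.arctan (g x)) (Real.pi ^ 2)
        (by have := Real.measurable_arctan; fun_prop)
        (fun x => sq_le_sq.2 ((harc x).trans (le_abs_self _))) hiarc)
  have hw : ∀ x, slopeF l (u x, 2 * Real.arctan (g x), 1) = g x / charDens l g x := fun x => by
    have h1 : 0 < √(1 + g x ^ 2) := Real.sqrt_pos.2 (by positivity)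
    have h2 : √(1 + g x ^ 2) ^ 2 = 1 + g x ^ 2 := Real.sq_sqrt (by positivity)
    unfold slopeF charDens
    simp only
    rw [mul_div_cancel_left₀ _ two_ne_zero, Real.sin_arctan, Real.cos_arctan]
    set r := √(1 + g x ^ 2)
    have h3 : r ^ (2 * (l + 1)) = r * r ^ (2 * l + 1) := by ring
    rw [← h2, ← pow_mul, h3, one_div_pow]
    field_simp
  obtain ⟨Cw, hCw⟩ : ∃ C, Bd C fun Y => g (x0 l g Y) / charDens l g (x0 l g Y) := by
    refine ⟨_, hCv.of_le (by have := measurable_charDens l hg; fun_prop) fun Y => ?_⟩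
    rw [← hw]
    unfold slopeF
    simp only
    rw [abs_mul, abs_mul, abs_pow, abs_one, mul_one]
    have h1 : |Real.sin (2 * Real.arctan (g (x0 l g Y)) / 2)| ≤
        |2 * Real.arctan (g (x0 l g Y)) / 2| := Real.abs_sin_le_abs
    have h2 : |Real.cos (2 * Real.arctan (g (x0 l g Y)) / 2)| ^ (2 * l + 1) ≤ 1 :=
      pow_le_one₀ (abs_nonneg _) (Real.abs_cos_le_one _)
    have h3 := mul_le_of_le_one_right (abs_nonneg
      (Real.sin (2 * Real.arctan (g (x0 l g Y)) / 2))) h2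
    rw [abs_div, abs_two] at h1
    linarith [abs_nonneg (2 * Real.arctan (g (x0 l g Y)))]
  have e1 := BS.fn_mk hCu
  have e2 := BS.fn_mk hCv
  have e3 := BS.fn_mk hCw
  refine ⟨(BS.mk fun Y => u (x0 l g Y), BS.mk fun Y => 2 * Real.arctan (g (x0 l g Y)), 0,
    BS.mk fun Y => g (x0 l g Y) / charDens l g (x0 l g Y)), congrFun e1, congrFun e2, fun Y => ?_, fun Y => ?_, ?_⟩
  · show 1 + (0 : BS).fn Y = 1
    exact add_zero 1
  · refine (congrFun e3 Y).trans ?_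
    rw [← hw]
    unfold St.tr trip
    have i1 := congrFun e1 Y
    have i2 := congrFun e2 Y
    have i3 : (1 : ℝ) + (0 : BS).fn Y = 1 := add_zero 1
    exact congrArg _ (Prod.ext i1.symm (Prod.ext i2.symm i3.symm))
  · show IsPrim (BS.mk fun Y => u (x0 l g Y)).fn
      (BS.mk fun Y => g (x0 l g Y) / charDens l g (x0 l g Y)).fn
    rw [e1, e3]
    refine ⟨locallyIntegrable_of_bdd hCw.meas hCw.bound, fun a b => ?_⟩
    have key : ∀ a b : ℝ, a ≤ b → u (x0 l g b) - u (x0 l g a) =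
        ∫ Y in a..b, g (x0 l g Y) / charDens l g (x0 l g Y) := by
      intro a b hab
      have hle : x0 l g a ≤ x0 l g b := by rw [← he]; exact e.symm.monotone hab
      have hpre : x0 l g ⁻¹' Ioc (x0 l g a) (x0 l g b) = Ioc a b := by
        rw [← he]; ext Y
        simp only [mem_preimage, mem_Ioc, e.symm.lt_iff_lt, e.symm.le_iff_le]
      rw [hp.sub_eq, intervalIntegral.integral_of_le hab, intervalIntegral.integral_of_le hle,
        ← hpre, hmp.setIntegral_preimage_emb hXe (fun x => g x / charDens l g x),
        setIntegral_withDensity_eq_setIntegral_toReal_smul hdm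
          (ae_of_all _ fun x => ENNReal.ofReal_lt_top) _ measurableSet_Ioc]
      refine integral_congr_ae (ae_of_all _ fun x => ?_)
      simp only
      rw [ENNReal.toReal_ofReal (hpos x), smul_eq_mul,
        mul_div_cancel₀ _ (zero_lt_one.trans_le (one_le_charDens l g x)).ne']
    rcases le_total a b with hab | hab
    · exact key a b hab
    · rw [intervalIntegral.integral_symm, ← key b a hab]; ring

theorem exists_initial {u₀ : ℝ → ℝ} (hg : HasWeakDeriv u₀ g) (hu2 : MemLp u₀ 2 volume)
    (hg2 : MemLp g 2 volume) (hk : MemLp g (expK l : ℝ≥0∞) volume) :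
    ∃ z₀ : St, (∀ᵐ Y, z₀.u Y = u₀ (x0 l g Y)) ∧
      (∀ᵐ Y, z₀.v Y = 2 * Real.arctan (g (x0 l g Y))) ∧
      (∀ Y, z₀.xi Y = 1) ∧ (∀ Y, z₀.w Y = slopeF l (z₀.tr Y)) ∧ IsPrim z₀.u z₀.w := by
  obtain ⟨u₁, hu₁, hp⟩ := hg.exists_isPrim
  obtain ⟨g₁, hg₁, hgg⟩ := hg2.1.aemeasurable
  have hx : x0 l g = x0 l g₁ := by unfold x0; rw [charCoord_congr hgg]
  have hk' := hk.ae_eq hgg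
  obtain ⟨z₀, h1, h2, h3, h4, h5⟩ := exists_initial_of_measurable hg₁ (hp.congr_ae hgg)
    (hu2.ae_eq hu₁) (hg2.ae_eq hgg) hk'
  obtain ⟨e, he, hmp⟩ := exists_charIso hg₁ hk'
  have hq : Measure.QuasiMeasurePreserving (x0 l g₁) volume volume :=
    hmp.quasiMeasurePreserving.mono_right (withDensity_absolutelyContinuous _ _)
  refine ⟨z₀, ?_, ?_, h3, h4, h5⟩
  · filter_upwards [hq.ae_eq_comp hu₁] with Y hY
    rw [h1, hx]; exact hY.symm
  · filter_upwards [hq.ae_eq_comp hgg] with Y hY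
    rw [h2, hx]
    have : g (x0 l g₁ Y) = g₁ (x0 l g₁ Y) := hY
    rw [this]

end CharCoord

/-! ### Existence in the state space -/

theorem Bd.eLpNorm_top_le {C : ℝ} {h : ℝ → ℝ} (hb : ∀ Y, |h Y| ≤ C) :
    eLpNorm h ∞ volume ≤ ENNReal.ofReal C := by
  rw [eLpNorm_exponent_top]
  refine eLpNormEssSup_le_of_ae_enorm_bound (ae_of_all _ fun Y => ?_)
  rw [Real.enorm_eq_ofReal_abs]
  exact ENNReal.ofReal_le_ofReal (hb Y)

theorem Bd.eLpNorm_le {C : ℝ} {h : ℝ → ℝ} (hh : Bd C h) {k : ℕ} (hk : 2 ≤ k) :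
    eLpNorm h (k : ℝ≥0∞) volume ≤ ENNReal.ofReal C := by
  have hk0 : (k : ℝ≥0∞) ≠ 0 := by
    simp only [ne_eq, Nat.cast_eq_zero]; omega
  obtain ⟨j, rfl⟩ : ∃ j, k = j + 2 := ⟨k - 2, by omega⟩
  have h2 : ∫⁻ Y, ‖h Y‖ₑ ^ 2 ≤ ENNReal.ofReal C ^ 2 := by
    have := ENNReal.rpow_le_rpow hh.l2 (show (0 : ℝ) ≤ 2 by norm_num)
    rw [eLpNorm_eq_lintegral_rpow_enorm_toReal two_ne_zero ENNReal.ofNat_ne_top,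
      ← ENNReal.rpow_mul] at this
    simpa using this
  rw [eLpNorm_eq_lintegral_rpow_enorm_toReal hk0 (ENNReal.natCast_ne_top _)]
  have h3 : ∫⁻ Y, ‖h Y‖ₑ ^ ((j + 2 : ℕ) : ℝ≥0∞).toReal ≤ ENNReal.ofReal C ^ (j + 2) := by
    calc ∫⁻ Y, ‖h Y‖ₑ ^ ((j + 2 : ℕ) : ℝ≥0∞).toReal
        ≤ ∫⁻ Y, ENNReal.ofReal C ^ j * ‖h Y‖ₑ ^ 2 := by
          refine lintegral_mono fun Y => ?_
          rw [ENNReal.toReal_natCast, ENNReal.rpow_natCast, pow_add]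
          gcongr
          rw [Real.enorm_eq_ofReal_abs]
          exact ENNReal.ofReal_le_ofReal (hh.bound Y)
      _ = ENNReal.ofReal C ^ j * ∫⁻ Y, ‖h Y‖ₑ ^ 2 :=
          lintegral_const_mul' _ _ (ENNReal.pow_ne_top ENNReal.ofReal_ne_top)
      _ ≤ _ := by rw [pow_add]; gcongr
  refine (ENNReal.rpow_le_rpow h3 (by positivity)).trans (le_of_eq ?_)
  rw [ENNReal.toReal_natCast, ← ENNReal.rpow_natCast, ← ENNReal.rpow_mul,
    mul_one_div_cancel (by positivity), ENNReal.rpow_one]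

theorem two_le_expK (l : ℕ) : 2 ≤ expK l := by unfold expK; omega

theorem w1Norm_le {p : ℝ≥0∞} {a a' : ℝ → ℝ} (h : HasWeakDeriv a a') :
    w1Norm p a ≤ eLpNorm a p volume + eLpNorm a' p volume :=
  iInf₂_le a' h

theorem normX_le (l : ℕ) {C D : ℝ} {a a' b c : ℝ → ℝ} (h : HasWeakDeriv a a') (ha : Bd C a)
    (ha' : Bd C a') (hb : Bd C b) (hc : ∀ Y, |c Y| ≤ D) :
    normX l a b c ≤ ENNReal.ofReal (6 * C + D) := by
  have hC := ha.nonneg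
  have hD := (abs_nonneg _).trans (hc 0)
  have e : ENNReal.ofReal (6 * C + D) = (ENNReal.ofReal C + ENNReal.ofReal C)
      + (ENNReal.ofReal C + ENNReal.ofReal C) + ENNReal.ofReal C + ENNReal.ofReal C
      + ENNReal.ofReal D := by
    rw [← ENNReal.ofReal_add hC hC, ← ENNReal.ofReal_add (by positivity) (by positivity),
      ← ENNReal.ofReal_add (by positivity) hC, ← ENNReal.ofReal_add (by positivity) hC,
      ← ENNReal.ofReal_add (by positivity) hD]
    congr 1; ring
  rw [e]
  unfold normX
  gcongr
  · exact (w1Norm_le h).trans (add_le_add ha.l2 ha'.l2)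
  · exact (w1Norm_le h).trans
      (add_le_add (ha.eLpNorm_le (two_le_expK l)) (ha'.eLpNorm_le (two_le_expK l)))
  · exact hb.l2
  · exact Bd.eLpNorm_top_le hb.bound
  · exact Bd.eLpNorm_top_le hc

theorem memX_of_Bd (l : ℕ) {C D : ℝ} {a a' b c : ℝ → ℝ} (h : HasWeakDeriv a a') (ha : Bd C a)
    (ha' : Bd C a') (hb : Bd C b) (hcm : Measurable c) (hc : ∀ Y, |c Y| ≤ D) : MemX l a b c := by
  have hp : ∀ {f : ℝ → ℝ}, Bd C f → MemLp f (expK l : ℝ≥0∞) volume := fun hf =>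
    ⟨hf.meas.aestronglyMeasurable,
      (hf.eLpNorm_le (two_le_expK l)).trans_lt ENNReal.ofReal_lt_top⟩
  exact ⟨⟨ha.memLp, a', h, ha'.memLp⟩, ⟨hp ha, a', h, hp ha'⟩, hb.memLp,
    ⟨hb.meas.aestronglyMeasurable, (Bd.eLpNorm_top_le hb.bound).trans_lt ENNReal.ofReal_lt_top⟩,
    ⟨hcm.aestronglyMeasurable, (Bd.eLpNorm_top_le hc).trans_lt ENNReal.ofReal_lt_top⟩⟩

section Existence

variable {l : ℕ} {z : ℝ → St}

theorem isSolutionOn_of_field {u₀ g : ℝ → ℝ}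
    (hd : ∀ t, 0 ≤ t → HasDerivWithinAt z (field l (z t)) (Ici 0) t)
    (hp : ∀ t, 0 ≤ t → IsPrim (z t).u (z t).w)
    (hg : ∀ T, 0 ≤ T → ∃ R, 0 < R ∧ ∀ t ∈ Icc 0 T, z t ∈ St.good R)
    (hu : ∀ᵐ Y, (z 0).u Y = u₀ (x0 l g Y)) (hv : ∀ᵐ Y, (z 0).v Y = 2 * Real.arctan (g (x0 l g Y)))
    (hx : ∀ Y, (z 0).xi Y = 1) :
    IsSolutionOn l u₀ g (Ici 0) (fun t => (z t).u) (fun t => (z t).v) (fun t => (z t).xi) := by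
  refine ⟨fun T hT => ?_, fun T hT => ?_, hu, hv, ae_of_all _ hx⟩
  · obtain ⟨R, hR, hm⟩ := hg T hT
    have hadm := St.adm hR (hm T ⟨hT, le_rfl⟩)
    exact memX_of_Bd l (hp T hT).hasWeakDeriv (z T).bd_u (z T).bd_w (z T).bd_v hadm.meas_xi
      (hadm.abs_xi_le (by positivity))
  · obtain ⟨R, hR, hm⟩ := hg T hT
    have hR' : 0 < 1 + R + R ^ 2 := by positivity
    have hgood := hm T ⟨hT, le_rfl⟩
    have hadm := St.adm hR hgood
    obtain ⟨e1, e2, e3, e4⟩ := field_fn l hR hgood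
    have h1 := hasDerivWithinAt_iff_tendsto_slope.1 (hd T hT)
    have h2 : Tendsto (fun τ => ENNReal.ofReal (7 * ‖slope z T τ - field l (z T)‖))
        (𝓝[Ici 0 \ {T}] T) (𝓝 0) := by
      have h3 := ((h1.sub_const (field l (z T))).norm.const_mul 7)
      rw [sub_self, norm_zero, mul_zero] at h3
      have := ENNReal.tendsto_ofReal h3
      rwa [ENNReal.ofReal_zero] at this
    refine tendsto_of_tendsto_of_tendsto_of_le_of_le' tendsto_const_nhds h2
      (Eventually.of_forall fun _ => zero_le) ?_
    filter_upwards [self_mem_nhdsWithin] with τ hτ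
    set y : St := slope z T τ - field l (z T) with hy
    have hyv : y = (τ - T)⁻¹ • (z τ - z T) - field l (z T) := rfl
    have i1 : y.u = fun Y => ((z τ).u Y - (z T).u Y) / (τ - T)
        - rhsU l (z T).u (z T).v (z T).xi Y := by
      funext Y
      rw [← e1, hyv, div_eq_inv_mul]; rfl
    have i2 : y.v = fun Y => ((z τ).v Y - (z T).v Y) / (τ - T)
        - rhsV l (z T).u (z T).v (z T).xi Y := by
      funext Y
      rw [← e2, hyv, div_eq_inv_mul]; rfl
    have i3 : (fun Y => y.xi Y - 1) = fun Y => ((z τ).xi Y - (z T).xi Y) / (τ - T)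
        - rhsXi l (z T).u (z T).v (z T).xi Y := by
      funext Y
      rw [← e3, hyv, div_eq_inv_mul]
      show 1 + ((τ - T)⁻¹ * ((z τ).2.2.1.fn Y - (z T).2.2.1.fn Y) - (field l (z T)).2.2.1.fn Y) - 1
        = (τ - T)⁻¹ * (1 + (z τ).2.2.1.fn Y - (1 + (z T).2.2.1.fn Y)) - (field l (z T)).2.2.1.fn Y
      ring
    have i4 : y.w = fun Y => (τ - T)⁻¹ * ((z τ).w Y - (z T).w Y)
        - rhsW l (z T).u (z T).v (z T).xi Y := by
      funext Y
      rw [← e4, hyv]; rfl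
    have hpr : IsPrim y.u y.w := by
      rw [i1, i4]
      simp only [div_eq_inv_mul]
      exact (((hp τ hτ.1).sub (hp T hT)).const_mul _).sub (hadm.isPrim_rhsU l hR')
    have := normX_le l hpr.hasWeakDeriv y.bd_u y.bd_w y.bd_v y.bd_eta.bound
    rw [i1, i2, i3] at this
    refine this.trans (le_of_eq ?_)
    congr 1; ring

theorem normX_bound_of_good {R : ℝ} (hR : 0 < R) {y : St} (hy : y ∈ St.good R)
    (hp : IsPrim y.u y.w) : normX l y.u y.v y.xi ≤ ENNReal.ofReal (7 * R + 1) ∧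
      ∀ᵐ Y, 1 / (7 * R + 1) ≤ y.xi Y := by
  refine ⟨(normX_le l hp.hasWeakDeriv (y.bd_u.mono hy.1) (y.bd_w.mono hy.1) (y.bd_v.mono hy.1)
    (D := 1 + R) fun Y => ?_).trans (ENNReal.ofReal_le_ofReal (by linarith)), ae_of_all _ fun Y =>
    (one_div_le_one_div_of_le hR (by linarith)).trans (hy.2 Y)⟩
  have h1 := (y.bd_eta.bound Y).trans hy.1
  rw [abs_le] at h1 ⊢
  constructor <;> linarith

end Existence

/-! ### Solutions as differentiable curves in Lebesgue spaces -/

theorem eq_zero_of_deriv_le_near_zero {E : Type*} [NormedAddCommGroup E] [NormedSpace ℝ E]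
    {W W' : ℝ → E} {T ε K : ℝ} (hε : 0 < ε)
    (hd : ∀ t ∈ Icc 0 T, HasDerivWithinAt W (W' t) (Icc 0 T) t)
    (hK : ∀ t ∈ Icc 0 T, ‖W t‖ ≤ ε → ‖W' t‖ ≤ K * ‖W t‖) (h0 : W 0 = 0) :
    ∀ t ∈ Icc 0 T, W t = 0 := by
  have hc : ContinuousOn W (Icc 0 T) := fun t ht => (hd t ht).continuousWithinAt
  have hcl : IsClosed ({t | W t = 0} ∩ Icc 0 T) := by
    rw [inter_comm]
    exact hc.preimage_isClosed_of_isClosed isClosed_Icc isClosed_singleton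
  refine hcl.Icc_subset_of_forall_mem_nhdsWithin h0 fun x hx => ?_
  have hxI : x ∈ Icc 0 T := ⟨hx.2.1, hx.2.2.le⟩
  have hsmall : ∀ᶠ s in 𝓝[>] x, ∀ y ∈ Icc x s, ‖W y‖ ≤ ε := by
    have h1 : ∀ᶠ y in 𝓝[≥] x, ‖W y‖ < ε := by
      have h2 : ContinuousWithinAt W (Ici x) x := (hc x hxI).mono_of_mem_nhdsWithin
        (Icc_mem_nhdsGE_of_mem hx.2)
      refine h2.norm.eventually_lt_const ?_
      have h3 : W x = 0 := hx.1
      simpa [h3] using hε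
    obtain ⟨b, hb, hbs⟩ := mem_nhdsGE_iff_exists_Ico_subset.1 h1
    filter_upwards [Ioo_mem_nhdsGT hb] with s hs y hy
    exact (hbs ⟨hy.1, hy.2.trans_lt hs.2⟩).le
  filter_upwards [hsmall, Ioo_mem_nhdsGT hx.2.2] with s hs hsT
  have key := norm_le_gronwallBound_of_norm_deriv_right_le (f := W) (f' := W') (δ := 0) (K := K)
    (ε := 0) (a := x) (b := s)
    (hc.mono (Icc_subset_Icc hx.2.1 hsT.2.le))
    (fun y hy => (hd y ⟨hx.2.1.trans hy.1, (hy.2.trans hsT.2).le⟩).mono_of_mem_nhdsWithin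
      (Icc_mem_nhdsGE_of_mem ⟨hx.2.1.trans hy.1, hy.2.trans hsT.2⟩))
    (by rw [show W x = 0 from hx.1, norm_zero])
    (fun y hy => by
      rw [add_zero]
      exact hK y ⟨hx.2.1.trans hy.1, (hy.2.trans hsT.2).le⟩ (hs y ⟨hy.1, hy.2.le⟩))
    s ⟨hsT.1.le, le_rfl⟩
  rw [gronwallBound_ε0, zero_mul] at key
  exact norm_le_zero_iff.1 key

theorem eLpNorm_top_le_w1Norm (f : ℝ → ℝ) : eLpNorm f ∞ volume ≤ w1Norm 2 f := by
  refine le_iInf₂ fun g hg => ?_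
  by_cases hf2 : eLpNorm f 2 volume = (∞ : ℝ≥0∞)
  · rw [hf2, top_add]; exact le_top
  by_cases hg2 : eLpNorm g 2 volume = (∞ : ℝ≥0∞)
  · rw [hg2, add_top]; exact le_top
  obtain ⟨f₁, hff, hp⟩ := hg.exists_isPrim
  have mf : MemLp f 2 volume :=
    ⟨hg.locallyIntegrable.aestronglyMeasurable, lt_top_iff_ne_top.2 hf2⟩
  have mg : MemLp g 2 volume :=
    ⟨hg.locallyIntegrable_deriv.aestronglyMeasurable, lt_top_iff_ne_top.2 hg2⟩
  have sq : ∀ {h : ℝ → ℝ}, MemLp h 2 volume →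
      ∫ x, h x ^ 2 = (eLpNorm h 2 volume).toReal ^ 2 := fun {h} hh => by
    have h0 : 0 ≤ ∫ x, h x ^ 2 := integral_nonneg fun x => sq_nonneg _
    rw [hh.eLpNorm_eq_integral_rpow_norm two_ne_zero ENNReal.ofNat_ne_top,
      ENNReal.toReal_ofReal (by positivity)]
    simp only [ENNReal.toReal_ofNat, Real.rpow_two, Real.norm_eq_abs, sq_abs]
    rw [← Real.rpow_natCast, ← Real.rpow_mul h0]
    simp
  have hb : ∀ x, |f₁ x| ≤ (eLpNorm f 2 volume).toReal + (eLpNorm g 2 volume).toReal := fun x => by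
    have h1 := hp.sq_le_integral (mf.ae_eq hff) mg x
    rw [sq (mf.ae_eq hff), sq mg, ← eLpNorm_congr_ae hff] at h1
    have i1 : 0 ≤ (eLpNorm f 2 volume).toReal := ENNReal.toReal_nonneg
    have i2 : 0 ≤ (eLpNorm g 2 volume).toReal := ENNReal.toReal_nonneg
    refine abs_le_of_sq_le_sq ?_ (by positivity)
    nlinarith [mul_nonneg i1 i2]
  rw [eLpNorm_congr_ae hff]
  refine (Bd.eLpNorm_top_le hb).trans ?_
  rw [ENNReal.ofReal_add ENNReal.toReal_nonneg ENNReal.toReal_nonneg, ENNReal.ofReal_toReal hf2,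
    ENNReal.ofReal_toReal hg2]

theorem eLpNorm_le_w1Norm (p : ℝ≥0∞) (f : ℝ → ℝ) : eLpNorm f p volume ≤ w1Norm p f :=
  le_iInf₂ fun _ _ => le_self_add

theorem memLp_sub {p : ℝ≥0∞} {f g : ℝ → ℝ} (hf : MemLp f p volume) (hg : MemLp g p volume) :
    MemLp (fun Y => f Y - g Y) p volume := hf.sub hg

section ToL

variable {p : ℝ≥0∞}

open Classical in
/-- The class of `f` in `L^p`, and `0` if `f` does not belong to `L^p`. -/
def toL (p : ℝ≥0∞) (f : ℝ → ℝ) : Lp ℝ p (volume : Measure ℝ) :=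
  if h : MemLp f p volume then h.toLp f else 0

theorem toL_eq {f : ℝ → ℝ} (h : MemLp f p volume) : toL p f = h.toLp f := dif_pos h

theorem toL_sub {f g : ℝ → ℝ} (hf : MemLp f p volume) (hg : MemLp g p volume) :
    toL p f - toL p g = toL p fun Y => f Y - g Y := by
  rw [toL_eq hf, toL_eq hg, toL_eq (memLp_sub hf hg)]; rfl

theorem toL_smul {f : ℝ → ℝ} (c : ℝ) (hf : MemLp f p volume) :
    c • toL p f = toL p fun Y => c * f Y := by
  rw [toL_eq hf, toL_eq (hf.const_mul c)]; rfl

theorem norm_toL {f : ℝ → ℝ} (hf : MemLp f p volume) :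
    ‖toL p f‖ = (eLpNorm f p volume).toReal := by
  rw [toL_eq hf, Lp.norm_toLp]

theorem norm_toL_sub_le {f g : ℝ → ℝ} {C : ℝ} (hC : 0 ≤ C) (hf : MemLp f p volume)
    (hg : MemLp g p volume) (h : eLpNorm (fun Y => f Y - g Y) p volume ≤ ENNReal.ofReal C) :
    ‖toL p f - toL p g‖ ≤ C := by
  rw [toL_sub hf hg, norm_toL (memLp_sub hf hg)]
  exact ENNReal.toReal_le_of_le_ofReal hC h

theorem eLpNorm_sub_le_of_norm {f g : ℝ → ℝ} {C : ℝ} (hf : MemLp f p volume)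
    (hg : MemLp g p volume) (h : ‖toL p f - toL p g‖ ≤ C) :
    eLpNorm (fun Y => f Y - g Y) p volume ≤ ENNReal.ofReal C := by
  rw [toL_sub hf hg, norm_toL (memLp_sub hf hg)] at h
  exact (ENNReal.ofReal_toReal (memLp_sub hf hg).eLpNorm_ne_top).symm.le.trans
    (ENNReal.ofReal_le_ofReal h)

theorem ae_eq_of_toL_eq {f g : ℝ → ℝ} (hf : MemLp f p volume) (hg : MemLp g p volume)
    (h : toL p f = toL p g) : f =ᵐ[volume] g := by
  rw [toL_eq hf, toL_eq hg] at h
  exact (MemLp.toLp_eq_toLp_iff hf hg).1 h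

theorem memLp_of_tendsto {f : ℝ → ℝ → ℝ} {f' : ℝ → ℝ} {I : Set ℝ} {t : ℝ}
    (hf : ∀ τ ∈ I, MemLp (f τ) p volume) (ht : t ∈ I) (hne : (𝓝[I \ {t}] t).NeBot)
    (hm : AEStronglyMeasurable f' volume)
    (h : Tendsto (fun τ => eLpNorm (fun Y => (f τ Y - f t Y) / (τ - t) - f' Y) p volume)
      (𝓝[I \ {t}] t) (𝓝 0)) : MemLp f' p volume := by
  obtain ⟨τ, h1, h2⟩ := ((h.eventually_lt_const zero_lt_one).and self_mem_nhdsWithin).exists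
  have hq : MemLp (fun Y => (f τ Y - f t Y) / (τ - t)) p volume := by
    simp only [div_eq_inv_mul]
    exact ((hf τ h2.1).sub (hf t ht)).const_mul _
  have hr : MemLp (fun Y => (f τ Y - f t Y) / (τ - t) - f' Y) p volume :=
    ⟨hq.1.sub hm, h1.trans ENNReal.one_lt_top⟩
  refine (hq.sub hr).ae_eq (ae_of_all _ fun Y => ?_)
  simp

theorem hasDerivWithinAt_toL [Fact (1 ≤ p)] {f : ℝ → ℝ → ℝ} {f' : ℝ → ℝ} {I : Set ℝ} {t : ℝ}
    (hf : ∀ τ ∈ I, MemLp (f τ) p volume) (ht : t ∈ I) (hf' : MemLp f' p volume)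
    (h : Tendsto (fun τ => eLpNorm (fun Y => (f τ Y - f t Y) / (τ - t) - f' Y) p volume)
      (𝓝[I \ {t}] t) (𝓝 0)) :
    HasDerivWithinAt (fun τ => toL p (f τ)) (toL p f') I t := by
  rw [hasDerivWithinAt_iff_tendsto_slope, tendsto_iff_norm_sub_tendsto_zero]
  have h1 := (ENNReal.tendsto_toReal ENNReal.zero_ne_top).comp h
  rw [ENNReal.toReal_zero] at h1
  refine h1.congr' ?_
  filter_upwards [self_mem_nhdsWithin] with τ hτ
  have hq := (memLp_sub (hf τ hτ.1) (hf t ht)).const_mul (τ - t)⁻¹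
  simp only [Function.comp_apply, slope, vsub_eq_sub, div_eq_inv_mul]
  rw [toL_sub (hf τ hτ.1) (hf t ht), toL_smul _ (memLp_sub (hf τ hτ.1) (hf t ht)), toL_sub hq hf',
    norm_toL (memLp_sub hq hf')]

end ToL

/-- Membership in `(L² ∩ L^∞) × (L² ∩ L^∞) × L^∞`. -/
structure MemE (u v ξ : ℝ → ℝ) : Prop where
  u_two : MemLp u 2 volume
  u_top : MemLp u ∞ volume
  v_two : MemLp v 2 volume
  v_top : MemLp v ∞ volume
  xi_top : MemLp ξ ∞ volume

theorem MemX.memE {l : ℕ} {u v ξ : ℝ → ℝ} (h : MemX l u v ξ) : MemE u v ξ := by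
  obtain ⟨hu, g, hg, hg2⟩ := h.u_H1
  exact ⟨hu, ⟨hu.1, (eLpNorm_top_le_w1Norm u).trans_lt
    ((w1Norm_le hg).trans_lt (ENNReal.add_lt_top.2 ⟨hu.2, hg2.2⟩))⟩, h.v_L2, h.v_Linfty, h.xi_Linfty⟩

/-- The space `(L² × L^∞) × (L² × L^∞) × L^∞`. -/
abbrev LSpace : Type :=
  Lp ℝ 2 (volume : Measure ℝ) × Lp ℝ ∞ (volume : Measure ℝ) × Lp ℝ 2 (volume : Measure ℝ) ×
    Lp ℝ ∞ (volume : Measure ℝ) × Lp ℝ ∞ (volume : Measure ℝ)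

def emb (u v ξ : ℝ → ℝ) : LSpace := (toL 2 u, toL ∞ u, toL 2 v, toL ∞ v, toL ∞ ξ)

theorem pots_congr_ae (l : ℕ) {u v ξ u' v' ξ' : ℝ → ℝ} (hu : u =ᵐ[volume] u')
    (hv : v =ᵐ[volume] v') (hξ : ξ =ᵐ[volume] ξ') :
    P l u v ξ = P l u' v' ξ' ∧ Px l u v ξ = Px l u' v' ξ' ∧ Q l u v ξ = Q l u' v' ξ' ∧
      Qx l u v ξ = Qx l u' v' ξ' := by
  have hk : kern l v ξ = kern l v' ξ' := by
    funext Y Y'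
    unfold kern
    congr 3
    refine intervalIntegral.integral_congr_ae ?_
    filter_upwards [hv, hξ] with s h1 h2 _
    rw [h1, h2]
  have hP : densP l u v ξ =ᵐ[volume] densP l u' v' ξ' := by
    filter_upwards [hu, hv, hξ] with s h0 h1 h2
    unfold densP; rw [h0, h1, h2]
  have hQ : densQ l u v ξ =ᵐ[volume] densQ l u' v' ξ' := by
    filter_upwards [hu, hv, hξ] with s h0 h1 h2
    unfold densQ; rw [h0, h1, h2]
  have aux : ∀ {d d' : ℝ → ℝ}, d =ᵐ[volume] d' → ∀ (Y : ℝ) (S : Set ℝ),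
      ∫ Y' in S, kern l v' ξ' Y Y' * d Y' = ∫ Y' in S, kern l v' ξ' Y Y' * d' Y' :=
    fun h Y S => integral_congr_ae (ae_restrict_of_ae (h.mono fun s hs => by simp only [hs]))
  have aux' : ∀ {d d' : ℝ → ℝ}, d =ᵐ[volume] d' → ∀ (Y : ℝ),
      ∫ Y', kern l v' ξ' Y Y' * d Y' = ∫ Y', kern l v' ξ' Y Y' * d' Y' :=
    fun h Y => integral_congr_ae (h.mono fun s hs => by simp only [hs])
  refine ⟨?_, ?_, ?_, ?_⟩ <;> funext Y
  · unfold P; rw [hk, aux' hP]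
  · unfold Px; rw [hk, aux hP, aux hP]
  · unfold Q; rw [hk, aux' hQ]
  · unfold Qx; rw [hk, aux hQ, aux hQ]

theorem rhs_congr_ae (l : ℕ) {u v ξ u' v' ξ' : ℝ → ℝ} (hu : u =ᵐ[volume] u')
    (hv : v =ᵐ[volume] v') (hξ : ξ =ᵐ[volume] ξ') :
    rhsU l u v ξ =ᵐ[volume] rhsU l u' v' ξ' ∧ rhsV l u v ξ =ᵐ[volume] rhsV l u' v' ξ' ∧
      rhsXi l u v ξ =ᵐ[volume] rhsXi l u' v' ξ' := by
  obtain ⟨h1, h2, h3, h4⟩ := pots_congr_ae l hu hv hξ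
  refine ⟨?_, ?_, ?_⟩
  · filter_upwards with s
    unfold rhsU; rw [h2, h3]
  · filter_upwards [hu, hv, hξ] with s a b c
    unfold rhsV; rw [h1, h4, a, b]
  · filter_upwards [hu, hv, hξ] with s a b c
    unfold rhsXi; rw [h1, h4, a, b, c]

theorem ae_abs_le_of_eLpNorm_top {f : ℝ → ℝ} {C : ℝ} (hC : 0 ≤ C)
    (h : eLpNorm f ∞ volume ≤ ENNReal.ofReal C) : ∀ᵐ Y, |f Y| ≤ C := by
  rw [eLpNorm_exponent_top] at h
  filter_upwards [ae_le_eLpNormEssSup (f := f) (μ := volume)] with Y hY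
  have := hY.trans h
  rw [Real.enorm_eq_ofReal_abs] at this
  exact (ENNReal.ofReal_le_ofReal_iff hC).1 this

/-- A function within `δ` of a measurable function has a representative with the same property
everywhere. -/
theorem exists_near_rep {f f' : ℝ → ℝ} {δ : ℝ} (hδ : 0 ≤ δ) (hf : Measurable f)
    (hm : AEStronglyMeasurable f' volume) (h : ∀ᵐ Y, |f' Y - f Y| ≤ δ) :
    ∃ k : ℝ → ℝ, Measurable k ∧ f' =ᵐ[volume] k ∧ ∀ Y, |k Y - f Y| ≤ δ := by
  obtain ⟨k, hk, hkk⟩ := hm.aemeasurable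
  have hS : MeasurableSet {Y | |k Y - f Y| ≤ δ} := measurableSet_le (by fun_prop) measurable_const
  classical
  refine ⟨{Y | |k Y - f Y| ≤ δ}.piecewise k f, hk.piecewise hS hf, ?_, fun Y => ?_⟩
  · filter_upwards [hkk, h] with Y h1 h2
    rw [piecewise_eq_of_mem _ _ _ (show Y ∈ {Y | |k Y - f Y| ≤ δ} by
      rw [h1] at h2; exact h2), h1]
  · by_cases hY : Y ∈ {Y | |k Y - f Y| ≤ δ}
    · rw [piecewise_eq_of_mem _ _ _ hY]; exact hY
    · rw [piecewise_eq_of_notMem _ _ _ hY, sub_self, abs_zero]; exact hδ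

theorem MemE.aestronglyMeasurable_rhs (l : ℕ) {u v ξ : ℝ → ℝ} (h : MemE u v ξ) :
    AEStronglyMeasurable (rhsU l u v ξ) volume ∧ AEStronglyMeasurable (rhsV l u v ξ) volume ∧
      AEStronglyMeasurable (rhsXi l u v ξ) volume := by
  obtain ⟨u', hu, hu'⟩ := h.u_two.1.aemeasurable
  obtain ⟨v', hv, hv'⟩ := h.v_two.1.aemeasurable
  obtain ⟨x', hx, hx', hb⟩ := exists_near_rep (f := fun _ => 0) (f' := ξ)
    (ENNReal.toReal_nonneg (a := eLpNorm ξ ∞ volume)) measurable_const h.xi_top.1 (by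
      simp only [sub_zero]
      exact ae_abs_le_of_eLpNorm_top ENNReal.toReal_nonneg
        (ENNReal.ofReal_toReal h.xi_top.eLpNorm_ne_top).symm.le)
  obtain ⟨m1, m2, m3, -⟩ := measurable_rhs l hu hv hx (fun Y => by simpa using hb Y)
  obtain ⟨c1, c2, c3⟩ := rhs_congr_ae l hu' hv' hx'
  exact ⟨m1.aestronglyMeasurable.congr c1.symm, m2.aestronglyMeasurable.congr c2.symm,
    m3.aestronglyMeasurable.congr c3.symm⟩

theorem IsSolutionOn.hasDerivWithinAt_emb {l : ℕ} {u₀ g : ℝ → ℝ} {I : Set ℝ} {u v ξ : ℝ → ℝ → ℝ}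
    (h : IsSolutionOn l u₀ g I u v ξ) {t : ℝ} (ht : t ∈ I) (hne : (𝓝[I \ {t}] t).NeBot) :
    MemE (rhsU l (u t) (v t) (ξ t)) (rhsV l (u t) (v t) (ξ t)) (rhsXi l (u t) (v t) (ξ t)) ∧
    HasDerivWithinAt (fun τ => emb (u τ) (v τ) (ξ τ))
      (emb (rhsU l (u t) (v t) (ξ t)) (rhsV l (u t) (v t) (ξ t)) (rhsXi l (u t) (v t) (ξ t))) I t := by
  have hE : ∀ τ ∈ I, MemE (u τ) (v τ) (ξ τ) := fun τ hτ => (h.mem τ hτ).memE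
  obtain ⟨m1, m2, m3⟩ := (hE t ht).aestronglyMeasurable_rhs l
  have sq : ∀ {φ : ℝ → ℝ≥0∞}, (∀ τ, φ τ ≤ normX l
      (fun Y => (u τ Y - u t Y) / (τ - t) - rhsU l (u t) (v t) (ξ t) Y)
      (fun Y => (v τ Y - v t Y) / (τ - t) - rhsV l (u t) (v t) (ξ t) Y)
      (fun Y => (ξ τ Y - ξ t Y) / (τ - t) - rhsXi l (u t) (v t) (ξ t) Y)) →
      Tendsto φ (𝓝[I \ {t}] t) (𝓝 0) := fun hφ =>
    tendsto_of_tendsto_of_tendsto_of_le_of_le tendsto_const_nhds (h.deriv t ht)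
      (fun _ => zero_le) hφ
  have n1 : ∀ a b c : ℝ → ℝ, w1Norm 2 a ≤ normX l a b c := fun a b c => by
    unfold normX
    exact le_self_add.trans (le_self_add.trans (le_self_add.trans le_self_add))
  have n2 : ∀ a b c : ℝ → ℝ, eLpNorm b 2 volume ≤ normX l a b c := fun a b c => by
    unfold normX
    exact le_add_self.trans (le_self_add.trans le_self_add)
  have n3 : ∀ a b c : ℝ → ℝ, eLpNorm b ∞ volume ≤ normX l a b c := fun a b c => by
    unfold normX
    exact le_add_self.trans le_self_add
  have n4 : ∀ a b c : ℝ → ℝ, eLpNorm c ∞ volume ≤ normX l a b c := fun a b c => by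
    unfold normX
    exact le_add_self
  have t1 := sq fun τ => (eLpNorm_le_w1Norm 2 _).trans (n1 _ _ _)
  have t2 := sq fun τ => (eLpNorm_top_le_w1Norm _).trans (n1 _ _ _)
  have t3 := sq fun τ => n2 _ _ _
  have t4 := sq fun τ => n3 _ _ _
  have t5 := sq fun τ => n4 _ _ _
  have hm : MemE (rhsU l (u t) (v t) (ξ t)) (rhsV l (u t) (v t) (ξ t))
      (rhsXi l (u t) (v t) (ξ t)) :=
    ⟨memLp_of_tendsto (fun τ hτ => (hE τ hτ).u_two) ht hne m1 t1,
      memLp_of_tendsto (fun τ hτ => (hE τ hτ).u_top) ht hne m1 t2,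
      memLp_of_tendsto (fun τ hτ => (hE τ hτ).v_two) ht hne m2 t3,
      memLp_of_tendsto (fun τ hτ => (hE τ hτ).v_top) ht hne m2 t4,
      memLp_of_tendsto (fun τ hτ => (hE τ hτ).xi_top) ht hne m3 t5⟩
  exact ⟨hm, (hasDerivWithinAt_toL (fun τ hτ => (hE τ hτ).u_two) ht hm.u_two t1).prodMk
    ((hasDerivWithinAt_toL (fun τ hτ => (hE τ hτ).u_top) ht hm.u_top t2).prodMk
    ((hasDerivWithinAt_toL (fun τ hτ => (hE τ hτ).v_two) ht hm.v_two t3).prodMk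
    ((hasDerivWithinAt_toL (fun τ hτ => (hE τ hτ).v_top) ht hm.v_top t4).prodMk
    (hasDerivWithinAt_toL (fun τ hτ => (hE τ hτ).xi_top) ht hm.xi_top t5))))⟩

theorem IsSolutionOn.mono {l : ℕ} {u₀ g : ℝ → ℝ} {I J : Set ℝ} {u v ξ : ℝ → ℝ → ℝ}
    (h : IsSolutionOn l u₀ g J u v ξ) (hIJ : I ⊆ J) : IsSolutionOn l u₀ g I u v ξ :=
  ⟨fun T hT => h.mem T (hIJ hT), fun T hT => (h.deriv T (hIJ hT)).mono_left
    (nhdsWithin_mono _ (sdiff_subset_sdiff_left hIJ)), h.init_u, h.init_v, h.init_xi⟩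

/-! ### Uniqueness -/

theorem norm_emb_sub_le {a b c a' b' c' : ℝ → ℝ} {C : ℝ} (h : MemE a b c) (h' : MemE a' b' c')
    (hC : 0 ≤ C) (h1 : eLpNorm (fun Y => a Y - a' Y) 2 volume ≤ ENNReal.ofReal C)
    (h2 : eLpNorm (fun Y => a Y - a' Y) (∞ : ℝ≥0∞) volume ≤ ENNReal.ofReal C)
    (h3 : eLpNorm (fun Y => b Y - b' Y) 2 volume ≤ ENNReal.ofReal C)
    (h4 : eLpNorm (fun Y => b Y - b' Y) (∞ : ℝ≥0∞) volume ≤ ENNReal.ofReal C)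
    (h5 : eLpNorm (fun Y => c Y - c' Y) (∞ : ℝ≥0∞) volume ≤ ENNReal.ofReal C) :
    ‖emb a b c - emb a' b' c'‖ ≤ C :=
  max_le (norm_toL_sub_le hC h.u_two h'.u_two h1)
    (max_le (norm_toL_sub_le hC h.u_top h'.u_top h2)
      (max_le (norm_toL_sub_le hC h.v_two h'.v_two h3)
        (max_le (norm_toL_sub_le hC h.v_top h'.v_top h4)
          (norm_toL_sub_le hC h.xi_top h'.xi_top h5))))

theorem emb_sub_bounds {a b c a' b' c' : ℝ → ℝ} {C : ℝ} (h : MemE a b c) (h' : MemE a' b' c')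
    (hC : 0 ≤ C) (hle : ‖emb a b c - emb a' b' c'‖ ≤ C) :
    eLpNorm (fun Y => a Y - a' Y) 2 volume ≤ ENNReal.ofReal C ∧ (∀ᵐ Y, |a Y - a' Y| ≤ C) ∧
    eLpNorm (fun Y => b Y - b' Y) 2 volume ≤ ENNReal.ofReal C ∧ (∀ᵐ Y, |b Y - b' Y| ≤ C) ∧
    ∀ᵐ Y, |c Y - c' Y| ≤ C := by
  set w := emb a b c - emb a' b' c' with hw
  have n1 : ‖w.1‖ ≤ C := (norm_fst_le w).trans hle
  have r1 : ‖w.2‖ ≤ C := (norm_snd_le w).trans hle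
  have n2 : ‖w.2.1‖ ≤ C := (norm_fst_le w.2).trans r1
  have r2 : ‖w.2.2‖ ≤ C := (norm_snd_le w.2).trans r1
  have n3 : ‖w.2.2.1‖ ≤ C := (norm_fst_le w.2.2).trans r2
  have r3 : ‖w.2.2.2‖ ≤ C := (norm_snd_le w.2.2).trans r2
  have n4 : ‖w.2.2.2.1‖ ≤ C := (norm_fst_le w.2.2.2).trans r3
  have n5 : ‖w.2.2.2.2‖ ≤ C := (norm_snd_le w.2.2.2).trans r3
  exact ⟨eLpNorm_sub_le_of_norm h.u_two h'.u_two n1,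
    ae_abs_le_of_eLpNorm_top hC (eLpNorm_sub_le_of_norm h.u_top h'.u_top n2),
    eLpNorm_sub_le_of_norm h.v_two h'.v_two n3,
    ae_abs_le_of_eLpNorm_top hC (eLpNorm_sub_le_of_norm h.v_top h'.v_top n4),
    ae_abs_le_of_eLpNorm_top hC (eLpNorm_sub_le_of_norm h.xi_top h'.xi_top n5)⟩

theorem Adm.mono {R R' : ℝ} {u v ξ : ℝ → ℝ} (h : Adm R u v ξ) (hR : 0 < R) (hRR : R ≤ R') :
    Adm R' u v ξ :=
  ⟨h.meas_u, h.meas_v, h.meas_xi, fun Y => (h.u_le Y).trans hRR, fun Y => (h.v_le Y).trans hRR,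
    fun Y => (h.xi_le Y).trans hRR, fun Y => (one_div_le_one_div_of_le hR hRR).trans (h.le_xi Y),
    h.bad.trans (ENNReal.ofReal_le_ofReal hRR)⟩

theorem emb_congr {a b c a' b' c' : ℝ → ℝ} (h : MemE a b c) (ha : a =ᵐ[volume] a')
    (hb : b =ᵐ[volume] b') (hc : c =ᵐ[volume] c') : emb a b c = emb a' b' c' ∧ MemE a' b' c' := by
  have h' : MemE a' b' c' := ⟨h.u_two.ae_eq ha, h.u_top.ae_eq ha, h.v_two.ae_eq hb,
    h.v_top.ae_eq hb, h.xi_top.ae_eq hc⟩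
  refine ⟨?_, h'⟩
  unfold emb
  rw [toL_eq h.u_two, toL_eq h.u_top, toL_eq h.v_two, toL_eq h.v_top, toL_eq h.xi_top,
    toL_eq h'.u_two, toL_eq h'.u_top, toL_eq h'.v_two, toL_eq h'.v_top, toL_eq h'.xi_top,
    MemLp.toLp_congr h.u_two h'.u_two ha, MemLp.toLp_congr h.u_top h'.u_top ha,
    MemLp.toLp_congr h.v_two h'.v_two hb, MemLp.toLp_congr h.v_top h'.v_top hb,
    MemLp.toLp_congr h.xi_top h'.xi_top hc]

theorem emb_rhs_lipschitz (l : ℕ) {R : ℝ} (hR : 0 < R) : ∃ K : ℝ, ∀ y ∈ St.good R,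
    ∀ u v ξ : ℝ → ℝ, MemE y.u y.v y.xi → MemE u v ξ →
    MemE (rhsU l y.u y.v y.xi) (rhsV l y.u y.v y.xi) (rhsXi l y.u y.v y.xi) →
    MemE (rhsU l u v ξ) (rhsV l u v ξ) (rhsXi l u v ξ) →
    ‖emb y.u y.v y.xi - emb u v ξ‖ ≤ 1 / (2 * R) →
    ‖emb (rhsU l y.u y.v y.xi) (rhsV l y.u y.v y.xi) (rhsXi l y.u y.v y.xi)
      - emb (rhsU l u v ξ) (rhsV l u v ξ) (rhsXi l u v ξ)‖ ≤
      K * ‖emb y.u y.v y.xi - emb u v ξ‖ := by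
  set ε : ℝ := 1 / (2 * R) with hε
  have hε0 : 0 < ε := by positivity
  set R₂ : ℝ := (1 + R + R ^ 2) + (R + ε) ^ 2 + ε + 2 * R with hR₂
  have hR₂0 : 0 < R₂ := by positivity
  obtain ⟨C, hC, -, hrhs⟩ := exists_rhs_Bd l hR₂0
  refine ⟨C * (1 + R), fun y hy u v ξ my m my' m' hle => ?_⟩
  set δ := ‖emb y.u y.v y.xi - emb u v ξ‖ with hδ
  have hδ0 : 0 ≤ δ := norm_nonneg _
  obtain ⟨b1, b2, b3, b4, b5⟩ := emb_sub_bounds my m hδ0 le_rfl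
  have hadm := St.adm hR hy
  obtain ⟨u', hu, huu, hun⟩ := exists_near_rep hδ0 hadm.meas_u m.u_two.1
    (b2.mono fun Y h => by rwa [abs_sub_comm])
  obtain ⟨v', hv, hvv, hvn⟩ := exists_near_rep hδ0 hadm.meas_v m.v_two.1
    (b4.mono fun Y h => by rwa [abs_sub_comm])
  obtain ⟨ξ', hx, hxx, hxn⟩ := exists_near_rep hδ0 hadm.meas_xi m.xi_top.1
    (b5.mono fun Y h => by rwa [abs_sub_comm])
  have ube := fun Y => (y.bd_u.bound Y).trans hy.1
  have vbe := fun Y => (y.bd_v.bound Y).trans hy.1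
  have hu1 : ∀ Y, |u' Y| ≤ R + ε := fun Y => by
    have := abs_add_le (u' Y - y.u Y) (y.u Y)
    rw [sub_add_cancel] at this
    linarith [hun Y, ube Y]
  have hv1 : ∀ Y, |v' Y| ≤ R + ε := fun Y => by
    have := abs_add_le (v' Y - y.v Y) (y.v Y)
    rw [sub_add_cancel] at this
    linarith [hvn Y, vbe Y]
  have hdu : Bd δ fun Y => y.u Y - u' Y := ⟨hadm.meas_u.sub hu, fun Y => by
    rw [abs_sub_comm]; exact hun Y, by
    rw [← eLpNorm_congr_ae (huu.mono fun Y h => by simp only [h] :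
      (fun Y => y.u Y - u Y) =ᵐ[volume] fun Y => y.u Y - u' Y)]
    exact b1⟩
  have hdv : Bd δ fun Y => y.v Y - v' Y := ⟨hadm.meas_v.sub hv, fun Y => by
    rw [abs_sub_comm]; exact hvn Y, by
    rw [← eLpNorm_congr_ae (hvv.mono fun Y h => by simp only [h] :
      (fun Y => y.v Y - v Y) =ᵐ[volume] fun Y => y.v Y - v' Y)]
    exact b3⟩
  have hvb : Bd (R + ε) v' := by
    have h1 := (y.bd_v.mono hy.1).memLp
    have h2 : MemLp v' 2 volume := m.v_two.ae_eq hvv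
    refine ⟨hv, hv1, ?_⟩
    have h3 : v' = fun Y => y.v Y - (y.v Y - v' Y) := by funext Y; ring
    rw [h3]
    refine (eLpNorm_sub_le h1.1 (h1.1.sub h2.1) one_le_two).trans ?_
    rw [ENNReal.ofReal_add hR.le hε0.le]
    exact add_le_add (y.bd_v.mono hy.1).l2 (hdv.mono hle).l2
  have hadm' : Adm R₂ u' v' ξ' := by
    have hq : 0 < R ^ 2 := by positivity
    have hq2 : 0 < (R + ε) ^ 2 := by positivity
    refine ⟨hu, hv, hx, fun Y => (hu1 Y).trans (by linarith), fun Y => (hv1 Y).trans (by linarith),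
      fun Y => ?_, fun Y => ?_, (volume_bad_le hvb).trans (ENNReal.ofReal_le_ofReal (by linarith))⟩
    · have h1 := (abs_le.1 (hxn Y)).2
      have h2 := (abs_le.1 ((y.bd_eta.bound Y).trans hy.1)).2
      linarith
    · have h1 := (abs_le.1 (hxn Y)).1
      have h2 := hy.2 Y
      have h3 : 1 / R = ε + ε := by rw [hε]; field_simp; norm_num
      have h4 : 1 / R₂ ≤ ε := one_div_le_one_div_of_le (by positivity) (by linarith)
      linarith
  have hadm2 : Adm R₂ y.u y.v y.xi := hadm.mono (by positivity) (by
    have hq2 : 0 < (R + ε) ^ 2 := by positivity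
    linarith)
  obtain ⟨d1, d2, d3, -⟩ := hrhs _ _ _ _ _ _ hadm2 hadm' δ R (fun Y => ⟨by
      rw [abs_sub_comm]; exact hun Y, by rw [abs_sub_comm]; exact hvn Y, by
      rw [abs_sub_comm]; exact hxn Y⟩) (y.bd_u.mono hy.1) (y.bd_v.mono hy.1) hdu hdv
  obtain ⟨c1, c2, c3⟩ := rhs_congr_ae l huu hvv hxx
  obtain ⟨e, me⟩ := emb_congr m' c1 c2 c3
  rw [e]
  have e2 : C * (1 + R) * δ = C * (δ * (1 + R)) := by ring
  rw [e2]
  exact norm_emb_sub_le my' me (by positivity) d1.l2 (Bd.eLpNorm_top_le d1.bound) d2.l2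
    (Bd.eLpNorm_top_le d2.bound) (Bd.eLpNorm_top_le d3.bound)

theorem nhdsWithin_Icc_diff_neBot {T t : ℝ} (hT : 0 < T) (ht : t ∈ Icc 0 T) :
    (𝓝[Icc 0 T \ {t}] t).NeBot := by
  have h1 : AccPt t (𝓟 (Icc 0 T)) := (uniqueDiffOn_Icc hT t ht).accPt
  rwa [accPt_principal_iff_nhdsWithin] at h1

theorem IsSolutionOn.ae_eq_of_good {l : ℕ} {u₀ g : ℝ → ℝ} {T R : ℝ} (hT : 0 < T) (hR : 0 < R)
    {z : ℝ → St} (hz : ∀ t ∈ Icc 0 T, z t ∈ St.good R)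
    (h : IsSolutionOn l u₀ g (Icc 0 T) (fun t => (z t).u) (fun t => (z t).v) (fun t => (z t).xi))
    {u v ξ : ℝ → ℝ → ℝ} (h' : IsSolutionOn l u₀ g (Icc 0 T) u v ξ) {t : ℝ} (ht : t ∈ Icc 0 T) :
    u t =ᵐ[volume] (z t).u ∧ v t =ᵐ[volume] (z t).v ∧ ξ t =ᵐ[volume] (z t).xi := by
  obtain ⟨K, hK⟩ := emb_rhs_lipschitz l hR
  have d := fun (t : ℝ) (ht : t ∈ Icc 0 T) => h.hasDerivWithinAt_emb ht (nhdsWithin_Icc_diff_neBot hT ht)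
  have d' := fun (t : ℝ) (ht : t ∈ Icc 0 T) => h'.hasDerivWithinAt_emb ht (nhdsWithin_Icc_diff_neBot hT ht)
  have hE := fun (t : ℝ) (ht : t ∈ Icc 0 T) => (h.mem t ht).memE
  have hE' := fun (t : ℝ) (ht : t ∈ Icc 0 T) => (h'.mem t ht).memE
  have h0 : (0 : ℝ) ∈ Icc 0 T := ⟨le_rfl, hT.le⟩
  have key := eq_zero_of_deriv_le_near_zero
    (W := fun t => emb (z t).u (z t).v (z t).xi - emb (u t) (v t) (ξ t))
    (ε := 1 / (2 * R)) (K := K) (by positivity)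
    (fun t ht => (d t ht).2.sub (d' t ht).2)
    (fun t ht hle => hK _ (hz t ht) _ _ _ (hE t ht) (hE' t ht) (d t ht).1 (d' t ht).1 hle)
    (by
      have e1 : (z 0).u =ᵐ[volume] u 0 := by
        filter_upwards [h.init_u, h'.init_u] with Y a b
        exact a.trans b.symm
      have e2 : (z 0).v =ᵐ[volume] v 0 := by
        filter_upwards [h.init_v, h'.init_v] with Y a b
        exact a.trans b.symm
      have e3 : (z 0).xi =ᵐ[volume] ξ 0 := by
        filter_upwards [h.init_xi, h'.init_xi] with Y a b
        exact a.trans b.symm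
      exact sub_eq_zero.2 (emb_congr (hE 0 h0) e1 e2 e3).1) t ht
  have e := sub_eq_zero.1 key
  have ea : toL 2 (z t).u = toL 2 (u t) := congrArg (fun w : LSpace => w.1) e
  have eb : toL 2 (z t).v = toL 2 (v t) := congrArg (fun w : LSpace => w.2.2.1) e
  have ec : toL ∞ (z t).xi = toL ∞ (ξ t) := congrArg (fun w : LSpace => w.2.2.2.2) e
  exact ⟨(ae_eq_of_toL_eq (hE t ht).u_two (hE' t ht).u_two ea).symm,
    (ae_eq_of_toL_eq (hE t ht).v_two (hE' t ht).v_two eb).symm,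
    (ae_eq_of_toL_eq (hE t ht).xi_top (hE' t ht).xi_top ec).symm⟩

end LambdaFamily

end

theorem proposition5p1 (l : ℕ) (hl : 1 ≤ l) (u₀ g : ℝ → ℝ)
    (hg : LambdaFamily.HasWeakDeriv u₀ g)
    (hu₂ : MemLp u₀ 2 volume) (hg₂ : MemLp g 2 volume)
    (hu_k : MemLp u₀ (LambdaFamily.expK l : ℝ≥0∞) volume)
    (hg_k : MemLp g (LambdaFamily.expK l : ℝ≥0∞) volume) :
    ∃ u v ξ : ℝ → ℝ → ℝ,
      LambdaFamily.IsSolutionOn l u₀ g (Ici 0) u v ξ ∧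
      (∀ T₁ : ℝ, 0 ≤ T₁ → ∃ C : ℝ, 0 < C ∧ ∀ T ∈ Icc 0 T₁,
        LambdaFamily.normX l (u T) (v T) (ξ T) ≤ ENNReal.ofReal C ∧
        ∀ᵐ Y, 1 / C ≤ ξ T Y) ∧
      (∀ T₁ : ℝ, 0 < T₁ → ∀ u' v' ξ' : ℝ → ℝ → ℝ,
        LambdaFamily.IsSolutionOn l u₀ g (Icc 0 T₁) u' v' ξ' →
        ∀ T ∈ Icc 0 T₁, u' T =ᵐ[volume] u T ∧ v' T =ᵐ[volume] v T ∧ ξ' T =ᵐ[volume] ξ T) := by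
  obtain ⟨z₀, hu, hv, hx, hw, hp⟩ := LambdaFamily.exists_initial (l := l) hg hu₂ hg₂ hg_k
  obtain ⟨z, h0, hd, hpr, hgood⟩ := LambdaFamily.exists_global_field hl hw hp hx
  have hsol := LambdaFamily.isSolutionOn_of_field (u₀ := u₀) (g := g) hd hpr hgood
    (by rw [h0]; exact hu) (by rw [h0]; exact hv) (by rw [h0]; exact hx)
  refine ⟨_, _, _, hsol, fun T₁ hT₁ => ?_, fun T₁ hT₁ u' v' ξ' h' T hT => ?_⟩
  · obtain ⟨R, hR, hm⟩ := hgood T₁ hT₁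
    exact ⟨7 * R + 1, by positivity, fun T hT =>
      LambdaFamily.normX_bound_of_good hR (hm T hT) (hpr T hT.1)⟩
  · obtain ⟨R, hR, hm⟩ := hgood T₁ hT₁.le
    exact (hsol.mono Icc_subset_Ici_self).ae_eq_of_good hT₁ hR hm h' hT
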